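/- Let $(N,h)$ be a smooth Riemannian manifold (Hausdorff, $\sigma$-compact, without boundary) of dimension $n>2$, let $\rho\in C^\infty(N)$, and put $\alpha=d\rho$. Recall that a smooth map $\phi:(M,g)\to(N',h')$ of Riemannian manifolds, with tension field $\tau(\phi)=\operatorname{trace}_g\nabla d\phi$, is called biharmonic if it is a critical point of the bienergy $E_2(\phi)=\frac12\int_K|\tau(\phi)|^2\,v_g$, that is, if for every compact $K\subseteq M$ and every smooth variation $(\phi_t)_{|t|<\varepsilon}$ of $\phi_0=\phi$ with $\phi_t=\phi$ outside $K$ one has $\frac{d}{dt}\big|_{t=0}\frac12\int_K|\tau(\phi_t)|^2\,v_g=0$. Then the identity map $\mathbf 1:(N,h)\to(N,e^{2\rho}h)$ is biharmonic if and only if $$-\Delta\alpha+\frac{6-n}{2}\,d|\alpha|^2+\bigl(2\,d^*\alpha+(2-n)|\alpha|^2\bigr)\alpha+2\,(\operatorname{Ricci}\alpha^\sharp)^\flat=0$$ on $N$. Here the norm $|\cdot|$, the musical isomorphisms $\sharp,\flat$, the codifferential $d^*$ (so $d^*\alpha=-\operatorname{trace}\nabla\alpha$), the Hodge Laplacian $\Delta=dd^*+d^*d$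 on one-forms and the Ricci operator, given by $h(\operatorname{Ricci}Y,Z)=\operatorname{trace}(X\mapsto R(X,Y)Z)$ with $R(X,Y)=[\nabla_X,\nabla_Y]-\nabla_{[X,Y]}$, are all taken with respect to $h$. -/

import Mathlib

open scoped Manifold ContDiff Topology

noncomputable section

namespace Biharmonic

/-- The model space `ℝⁿ`. -/
abbrev E (n : ℕ) : Type := EuclideanSpace ℝ (Fin n)

/-- A smooth Riemannian metric on the `n`-dimensional manifold `N`. -/
abbrev RiemMetric (n : ℕ) (N : Type*) [TopologicalSpace N] [ChartedSpace (E n) N]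
    [IsManifold (𝓡 n) ∞ N] :=
  Bundle.ContMDiffRiemannianMetric (𝓡 n) ∞ (E n) (fun x : N => TangentSpace (𝓡 n) x)

/-- The conformal metric `e^{2ρ} h`. -/
def conformal {n : ℕ} {N : Type*} [TopologicalSpace N] [ChartedSpace (E n) N]
    [IsManifold (𝓡 n) ∞ N] (h : RiemMetric n N) (ρ : C^∞⟮𝓡 n, N; 𝓘(ℝ, ℝ), ℝ⟯) :
    RiemMetric n N where
  inner x := Real.exp (2 * ρ x) • h.inner x
  symm x v w := by
    change Real.exp (2 * ρ x) * h.inner x v w = Real.exp (2 * ρ x) * h.inner x w v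
    rw [h.symm]
  pos x v hv := by
    change 0 < Real.exp (2 * ρ x) * h.inner x v v
    exact mul_pos (Real.exp_pos _) (h.pos x v hv)
  isVonNBounded x := by
    have key := (h.isVonNBounded x).image
      (Real.exp (-ρ x) • ContinuousLinearMap.id ℝ (TangentSpace (𝓡 n) x))
    apply Bornology.IsVonNBounded.subset _ key
    intro v hv
    refine (Set.mem_image _ _ _).2 ⟨Real.exp (ρ x) • v, ?_, ?_⟩
    · change Real.exp (2 * ρ x) * h.inner x v v < 1 at hv
      change h.inner x (Real.exp (ρ x) • v) (Real.exp (ρ x) • v) < 1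
      rw [map_smul, map_smul, smul_apply, smul_smul, smul_eq_mul,
        ← Real.exp_add, ← two_mul]
      exact hv
    · change Real.exp (-ρ x) • Real.exp (ρ x) • v = v
      rw [smul_smul, ← Real.exp_add, neg_add_cancel, Real.exp_zero, one_smul]
  contMDiff := by
    have h1 : ContMDiff (𝓡 n) 𝓘(ℝ, ℝ) ∞ (fun x : N => Real.exp (2 * ρ x)) := by
      have h2 : ContDiff ℝ ∞ (fun t : ℝ => Real.exp (2 * t)) := by fun_prop
      exact h2.contMDiff.comp ρ.contMDiff
    exact h1.smul_section h.contMDiff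

/-! ### Local coordinates

The tangent space `TangentSpace (𝓡 n) x` is by definition `ℝⁿ`, a tangent vector being identified
with its components in the preferred chart at `x`. -/

/-- The partial derivative `∂ᵢ f` at `y`. -/
def pd {n : ℕ} (i : Fin n) (f : E n → ℝ) (y : E n) : ℝ :=
  fderiv ℝ f y (EuclideanSpace.single i 1)

section Charts

variable {n : ℕ} {N : Type*} [TopologicalSpace N] [ChartedSpace (E n) N]

/-- The point of `N` with coordinates `y` in the preferred chart at `p`. -/
def pt (p : N) (y : E n) : N := (extChartAt (𝓡 n) p).symm y

/-- The coordinates of `x` in its preferred chart. -/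
def coordAt (x : N) : E n := extChartAt (𝓡 n) x x

/-- The differential at `y` of the parametrization `pt p`. -/
def param (p : N) (y : E n) : E n →L[ℝ] TangentSpace (𝓡 n) (pt p y) :=
  mfderiv 𝓘(ℝ, E n) (𝓡 n) (pt p) y

/-- The coordinate vector field `∂ᵢ` of the preferred chart at `p`, at the point with
coordinates `y`. -/
def coordVec (p : N) (y : E n) (i : Fin n) : TangentSpace (𝓡 n) (pt p y) :=
  param p y (EuclideanSpace.single i 1)

/-- The tangent vector at `x` with the given components in the preferred chart at `x`. -/
def ofComponents (x : N) (v : Fin n → ℝ) : TangentSpace (𝓡 n) x := (WithLp.toLp 2 v : E n)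

/-- The components of a tangent vector at `x` in the preferred chart at `x`. -/
def components (x : N) (v : TangentSpace (𝓡 n) x) : Fin n → ℝ := WithLp.ofLp (v : E n)

end Charts

section Curvature

variable {n : ℕ} {N : Type*} [TopologicalSpace N] [ChartedSpace (E n) N] [IsManifold (𝓡 n) ∞ N]

/-- The matrix `(h_{ij})` of the metric in the preferred chart at `p`, as a function of the
coordinates. -/
def gram (h : RiemMetric n N) (p : N) (y : E n) : Matrix (Fin n) (Fin n) ℝ :=
  Matrix.of fun i j => h.inner (pt p y) (coordVec p y i) (coordVec p y j)

/-- The entries `h^{ij}` of the inverse matrix. -/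
def gramInv (h : RiemMetric n N) (p : N) (i j : Fin n) (y : E n) : ℝ := (gram h p y)⁻¹ i j

/-- The Christoffel symbols `Γᵏ_{ij}` of the Levi-Civita connection. -/
def christoffel (h : RiemMetric n N) (p : N) (k i j : Fin n) (y : E n) : ℝ :=
  (1 / 2) * ∑ l, gramInv h p k l y *
    (pd i (fun z => gram h p z j l) y + pd j (fun z => gram h p z i l) y
      - pd l (fun z => gram h p z i j) y)

/-- The components of the curvature tensor `R(X, Y) = [∇_X, ∇_Y] - ∇_{[X, Y]}`:
`R(∂ᵢ, ∂ⱼ) ∂ₖ = ∑ₗ (curvature h p l k i j) ∂ₗ`. -/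
def curvature (h : RiemMetric n N) (p : N) (l k i j : Fin n) (y : E n) : ℝ :=
  pd i (christoffel h p l j k) y - pd j (christoffel h p l i k) y
    + ∑ m, (christoffel h p l i m y * christoffel h p m j k y
      - christoffel h p l j m y * christoffel h p m i k y)

/-- The components `Ric(∂ⱼ, ∂ₖ)` of the Ricci tensor `Ric(Y, Z) = trace (X ↦ R(X, Y) Z)`. -/
def ricciCoord (h : RiemMetric n N) (p : N) (j k : Fin n) (y : E n) : ℝ :=
  ∑ i, curvature h p i k i j y

/-- The Ricci operator on tangent vectors, `h(Ricci v, w) = Ric(v, w)`. -/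
def ricci (h : RiemMetric n N) (x : N) (v : TangentSpace (𝓡 n) x) : TangentSpace (𝓡 n) x :=
  ofComponents x fun i => ∑ j, ∑ k, gramInv h x i j (coordAt x) *
    ricciCoord h x j k (coordAt x) * components x v k

end Curvature

/-! ### Tension field, bienergy and biharmonic maps -/

section Maps

variable {m n : ℕ} {M N : Type*}
  [TopologicalSpace M] [ChartedSpace (E m) M] [IsManifold (𝓡 m) ∞ M]
  [TopologicalSpace N] [ChartedSpace (E n) N] [IsManifold (𝓡 n) ∞ N]

/-- The component `φᶜ` of `φ` in the preferred charts at `p` and `q`. -/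
def mapComp (φ : M → N) (p : M) (q : N) (c : Fin n) (y : E m) : ℝ :=
  (extChartAt (𝓡 n) q (φ (pt p y)) : E n) c

/-- The tension field `τ(φ) = trace_g ∇dφ` of `φ : (M, g) → (N, h)`; its components are
`∑ g^{ij} (∂ᵢ∂ⱼφᶜ - ∑ Γᵏ_{ij} ∂ₖφᶜ + ∑ Γᶜ_{ab}(φ) ∂ᵢφᵃ ∂ⱼφᵇ)`. -/
def tension (g : RiemMetric m M) (h : RiemMetric n N) (φ : M → N) (x : M) :
    TangentSpace (𝓡 n) (φ x) :=
  ofComponents (φ x) fun c => ∑ i, ∑ j, gramInv g x i j (coordAt x) *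
    (pd i (pd j (mapComp φ x (φ x) c)) (coordAt x)
      - ∑ k, christoffel g x k i j (coordAt x) * pd k (mapComp φ x (φ x) c) (coordAt x)
      + ∑ a, ∑ b, christoffel h (φ x) c a b (coordAt (φ x)) *
          pd i (mapComp φ x (φ x) a) (coordAt x) * pd j (mapComp φ x (φ x) b) (coordAt x))

variable (m M) in
/-- A smooth partition of unity subordinate to the preferred charts. -/
def chartPartition [T2Space M] [SigmaCompactSpace M] :
    SmoothPartitionOfUnity M (𝓡 m) M Set.univ :=
  (SmoothPartitionOfUnity.exists_isSubordinate_chartAt_source (𝓡 m) M).choose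

/-- The Riemannian volume measure `v_g`: the sum over a partition of unity `(ψₚ)` subordinate to
charts of the measures `ψₚ √(det g_{ij}) dy¹ … dyᵐ`. (As usual, it does not depend on the
partition.) -/
def volumeMeasure [T2Space M] [SigmaCompactSpace M] [MeasurableSpace M] (g : RiemMetric m M) :
    MeasureTheory.Measure M :=
  MeasureTheory.Measure.sum fun p : M =>
    ((MeasureTheory.volume.restrict (extChartAt (𝓡 m) p).target).withDensity fun y : E m =>
      ENNReal.ofReal (chartPartition m M p (pt p y) * √(gram g p y).det)).map (pt p)

variable [T2Space M] [SigmaCompactSpace M] [MeasurableSpace M]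

/-- The bienergy `E₂(φ) = ½ ∫_K |τ(φ)|² v_g`. -/
def bienergy (g : RiemMetric m M) (h : RiemMetric n N) (K : Set M) (φ : M → N) : ℝ :=
  (1 / 2) * ∫ x in K, h.inner (φ x) (tension g h φ x) (tension g h φ x) ∂(volumeMeasure g)

/-- A smooth map `φ : (M, g) → (N, h)` is biharmonic if it is a critical point of the bienergy:
for every compact `K` and every smooth variation `(Φ_t)` of `φ` with `Φ_t = φ` outside `K`, the
derivative of `E₂(Φ_t)` at `t = 0` vanishes. -/
def IsBiharmonic (g : RiemMetric m M) (h : RiemMetric n N) (φ : M → N) : Prop :=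
  ContMDiff (𝓡 m) (𝓡 n) ∞ φ ∧
  ∀ K : Set M, IsCompact K → ∀ ε : ℝ, 0 < ε → ∀ Φ : ℝ → M → N,
    ContMDiffOn (𝓘(ℝ, ℝ).prod (𝓡 m)) (𝓡 n) ∞ (fun q : ℝ × M => Φ q.1 q.2)
      (Set.Ioo (-ε) ε ×ˢ Set.univ) →
    Φ 0 = φ →
    (∀ t ∈ Set.Ioo (-ε) ε, ∀ x ∉ K, Φ t x = φ x) →
    HasDerivAt (fun t => bienergy g h K (Φ t)) 0 0

end Maps

/-! ### Differential forms of degrees one and two -/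

section Forms

variable {n : ℕ} {N : Type*} [TopologicalSpace N] [ChartedSpace (E n) N]

variable (n N) in
/-- Fields of covectors. -/
abbrev OneForm := (x : N) → TangentSpace (𝓡 n) x →L[ℝ] ℝ

variable (n N) in
/-- Fields of bilinear forms on the tangent spaces; two-forms are the alternating ones. -/
abbrev TwoForm := (x : N) → TangentSpace (𝓡 n) x →L[ℝ] TangentSpace (𝓡 n) x →L[ℝ] ℝ

/-- The covector at `x` with the given components in the preferred chart at `x`. -/
def covectorOfComponents (x : N) (θ : Fin n → ℝ) : TangentSpace (𝓡 n) x →L[ℝ] ℝ :=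
  (∑ j, θ j • EuclideanSpace.proj j : E n →L[ℝ] ℝ)

/-- The differential `df` of a function. -/
def dFun (f : N → ℝ) : OneForm n N := fun x => mvfderiv (𝓡 n) f x

/-- The coefficient `θⱼ` of a one-form in the preferred chart at `p`. -/
def coeffOne (θ : OneForm n N) (p : N) (j : Fin n) (y : E n) : ℝ :=
  θ (pt p y) (coordVec p y j)

/-- The coefficient `βᵢⱼ` of a two-form in the preferred chart at `p`. -/
def coeffTwo (β : TwoForm n N) (p : N) (i j : Fin n) (y : E n) : ℝ :=
  β (pt p y) (coordVec p y i) (coordVec p y j)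

/-- The expression of a one-form in the preferred chart at `p`. -/
def pullback (θ : OneForm n N) (p : N) (y : E n) : E n →L[ℝ] ℝ := (θ (pt p y)).comp (param p y)

/-- The exterior derivative of a one-form, in coordinates
`dθ(u, v) = D_u θ (v) - D_v θ (u)`. -/
def dOne (θ : OneForm n N) : TwoForm n N := fun x =>
  (fderiv ℝ (pullback θ x) (coordAt x) - (fderiv ℝ (pullback θ x) (coordAt x)).flip :
    E n →L[ℝ] E n →L[ℝ] ℝ)

variable [IsManifold (𝓡 n) ∞ N]

/-- The musical isomorphism `v ↦ v♭ = h(v, ·)`. -/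
def flat (h : RiemMetric n N) (x : N) (v : TangentSpace (𝓡 n) x) :
    TangentSpace (𝓡 n) x →L[ℝ] ℝ := h.inner x v

/-- The musical isomorphism `θ ↦ θ♯`, with components `∑ⱼ h^{ij} θⱼ`. -/
def sharp (h : RiemMetric n N) (x : N) (θ : TangentSpace (𝓡 n) x →L[ℝ] ℝ) :
    TangentSpace (𝓡 n) x :=
  ofComponents x fun i => ∑ j, gramInv h x i j (coordAt x) * θ (ofComponents x (Pi.single j 1))

/-- The squared norm `|θ|² = θ(θ♯)` of a one-form. -/
def normSq (h : RiemMetric n N) (θ : OneForm n N) (x : N) : ℝ := θ x (sharp h x (θ x))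

/-- The codifferential `d*θ = -∑ h^{ij} (∇ᵢθ)ⱼ` of a one-form. -/
def codiffOne (h : RiemMetric n N) (θ : OneForm n N) (x : N) : ℝ :=
  -∑ i, ∑ j, gramInv h x i j (coordAt x) *
    (pd i (coeffOne θ x j) (coordAt x)
      - ∑ k, christoffel h x k i j (coordAt x) * coeffOne θ x k (coordAt x))

/-- The codifferential `(d*β)ⱼ = -∑ h^{ik} (∇ₖβ)ᵢⱼ` of a two-form. -/
def codiffTwo (h : RiemMetric n N) (β : TwoForm n N) : OneForm n N := fun x =>
  covectorOfComponents x fun j => -∑ i, ∑ k, gramInv h x i k (coordAt x) *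
    (pd k (coeffTwo β x i j) (coordAt x)
      - ∑ l, christoffel h x l k i (coordAt x) * coeffTwo β x l j (coordAt x)
      - ∑ l, christoffel h x l k j (coordAt x) * coeffTwo β x i l (coordAt x))

/-- The Hodge Laplacian `Δ = d d* + d* d` on one-forms. -/
def hodgeLaplacian (h : RiemMetric n N) (θ : OneForm n N) : OneForm n N := fun x =>
  dFun (codiffOne h θ) x + codiffTwo h (dOne θ) x

end Forms

end Biharmonic

end

open scoped Manifold ContDiff Topology

set_option maxSynthPendingDepth 3

noncomputable section

/-! Let A be the difference of the Levi-Civita connections of e^{2ρ}h and h, so that A(u,v) = dρ(u)v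
+ dρ(v)u − h(u,v) grad ρ. The identity map has tension field trace A = (2−n) grad ρ, and lowering it
with the target metric gives the exact form (2−n) df, where f = e^{2ρ}/2. Along a variation with
field V, the derivative of ½|τ|² is therefore (2−n) df paired with the linearized tension field,
plus the term from differentiating the target metric. The part of the linearization that involves
only the connection ∇ of h is the trace of the Lie derivative L_V∇, and df(L_V∇) = Hess(Vf) −
L_V(Hess f). The traced Codazzi equation, div Hess f = d(lap f) + Ric(grad f, ·), then takes the
derivatives off V, up to divergences (`MetOn.trG_linSff_self`). The terms containing A need only the
Leibniz rule. The outcome is the pointwise identity `firstVar_conf`: the derivative of ½|τ|² equals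
(2−n)(e^{2ρ} 𝓔(V) + div θ), where 𝓔 is the left-hand side of the asserted equation and θ vanishes
wherever V vanishes locally.

For V supported in a chart, the divergence theorem (`MetOn.integral_divG`) removes θ. If 𝓔 = 0, the
first variation vanishes. Conversely, fields V = ηw with η a test function and w constant force 𝓔 =
0, because n ≠ 2 and 𝓔 is continuous.

Two points remain. First, every tensor is defined at x through the preferred chart at x, so the
quantities to be differentiated or integrated must be moved to one fixed chart. Transition maps are
isometries of the coordinate metrics, hence have zero second fundamental form
(`sff_eq_zero_of_isometry`); the composition law `sff_comp`, the naturality of curvature `curv_map`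
and the invariance of traces `trG_pull` do the rest. Secondly, a general variation is not supported
in a chart. The first variation is linear in V, and Φ_{tψ(x)}(x) is a variation with field ψV, so a
partition of unity reduces to chart-supported variations. Differentiation under the integral sign
(`IsVariation.hasDerivAt_bienergy`) rests on a uniform bound over the compact set K. -/

namespace Biharmonic

/-! ### Metric traces, gradients and determinants on ℝⁿ -/

section TraceAlgebra

variable {n : ℕ} {F : Type*} [NormedAddCommGroup F] [NormedSpace ℝ F]

/-- The standard basis vectors of `ℝⁿ`. -/
def bv (i : Fin n) : E n := EuclideanSpace.single i 1

/-- The matrix of a bilinear form in the standard basis. -/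
def bmat (B : E n →L[ℝ] E n →L[ℝ] ℝ) : Matrix (Fin n) (Fin n) ℝ := Matrix.of fun i j => B (bv i) (bv j)

/-- The trace of a bilinear map with respect to a nondegenerate bilinear form. -/
def trG (B : E n →L[ℝ] E n →L[ℝ] ℝ) (Q : E n → E n → F) : F := ∑ i, ∑ j, (bmat B)⁻¹ i j • Q (bv i) (bv j)

/-- The gradient vector of a linear form with respect to a nondegenerate bilinear form. -/
def gradG (B : E n →L[ℝ] E n →L[ℝ] ℝ) (θ : E n →L[ℝ] ℝ) : E n := ∑ i, (∑ j, (bmat B)⁻¹ i j * θ (bv j)) • bv i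

/-- Inner products on `ℝⁿ`. -/
structure IsMet (B : E n →L[ℝ] E n →L[ℝ] ℝ) : Prop where
  symm : ∀ u v, B u v = B v u
  pos : ∀ v, v ≠ 0 → 0 < B v v

lemma bv_apply (i j : Fin n) : (bv i : E n) j = if j = i then 1 else 0 := by
  simp [bv]

lemma eq_sum_bv (v : E n) : v = ∑ i, v i • bv i := by
  ext j
  simp [bv_apply]

lemma clm_eq_sum_bv (A : E n →L[ℝ] F) (v : E n) : A v = ∑ i, v i • A (bv i) := by
  conv_lhs => rw [eq_sum_bv v]
  simp

lemma bil_eq_sum_bv (Q : E n →L[ℝ] E n →L[ℝ] F) (u v : E n) :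
    Q u v = ∑ i, ∑ j, (u i * v j) • Q (bv i) (bv j) := by
  rw [clm_eq_sum_bv Q u]
  simp only [sum_apply, smul_apply]
  refine Finset.sum_congr rfl fun i _ => ?_
  rw [clm_eq_sum_bv (Q (bv i)) v, Finset.smul_sum]
  simp only [smul_smul]

lemma clm_ext_bv {A A' : E n →L[ℝ] F} (h : ∀ i, A (bv i) = A' (bv i)) : A = A' := by
  ext1 v
  rw [clm_eq_sum_bv A, clm_eq_sum_bv A']
  simp [h]

lemma IsMet.posDef {B : E n →L[ℝ] E n →L[ℝ] ℝ} (hB : IsMet B) : (bmat B).PosDef := by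
  refine Matrix.PosDef.of_dotProduct_mulVec_pos ?_ ?_
  · ext i j
    exact hB.symm _ _
  · intro x hx
    have h := hB.pos (WithLp.toLp 2 x) (by
      intro h0
      apply hx
      simpa using h0)
    rw [bil_eq_sum_bv] at h
    refine h.trans_eq (Eq.symm ?_)
    simp only [dotProduct, Matrix.mulVec, bmat, Matrix.of_apply, Finset.mul_sum, smul_eq_mul]
    refine Finset.sum_congr rfl fun i _ => Finset.sum_congr rfl fun j _ => ?_
    simp only [Pi.star_apply, star_trivial]
    ring

lemma IsMet.det_pos {B : E n →L[ℝ] E n →L[ℝ] ℝ} (hB : IsMet B) : 0 < (bmat B).det := hB.posDef.det_pos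

lemma IsMet.isUnit {B : E n →L[ℝ] E n →L[ℝ] ℝ} (hB : IsMet B) : IsUnit (bmat B).det := hB.det_pos.ne'.isUnit

lemma IsMet.inv_symm {B : E n →L[ℝ] E n →L[ℝ] ℝ} (hB : IsMet B) (i j : Fin n) :
    (bmat B)⁻¹ i j = (bmat B)⁻¹ j i := by
  have h : (bmat B).transpose = bmat B := by
    ext i j
    simp [bmat, hB.symm (bv i) (bv j)]
  have h2 : ((bmat B)⁻¹).transpose = (bmat B)⁻¹ := by
    rw [Matrix.transpose_nonsing_inv, h]
  conv_lhs => rw [← h2]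
  rfl

lemma trG_congr {B : E n →L[ℝ] E n →L[ℝ] ℝ} {Q Q' : E n → E n → F} (h : ∀ u v, Q u v = Q' u v) :
    trG B Q = trG B Q' := by
  simp [trG, h]

lemma trG_add (B : E n →L[ℝ] E n →L[ℝ] ℝ) (Q Q' : E n → E n → F) :
    trG B (fun u v => Q u v + Q' u v) = trG B Q + trG B Q' := by
  simp [trG, Finset.sum_add_distrib]

lemma trG_sub (B : E n →L[ℝ] E n →L[ℝ] ℝ) (Q Q' : E n → E n → F) :
    trG B (fun u v => Q u v - Q' u v) = trG B Q - trG B Q' := by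
  simp [trG, Finset.sum_sub_distrib, smul_sub]

lemma trG_neg (B : E n →L[ℝ] E n →L[ℝ] ℝ) (Q : E n → E n → F) :
    trG B (fun u v => -Q u v) = -trG B Q := by
  simp [trG]

lemma trG_smul (B : E n →L[ℝ] E n →L[ℝ] ℝ) (c : ℝ) (Q : E n → E n → F) :
    trG B (fun u v => c • Q u v) = c • trG B Q := by
  simp only [trG, Finset.smul_sum, smul_smul, mul_comm]

lemma trG_mul (B : E n →L[ℝ] E n →L[ℝ] ℝ) (c : ℝ) (Q : E n → E n → ℝ) :
    trG B (fun u v => c * Q u v) = c * trG B Q := trG_smul B c Q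

lemma trG_mul_right (B : E n →L[ℝ] E n →L[ℝ] ℝ) (c : ℝ) (Q : E n → E n → ℝ) :
    trG B (fun u v => Q u v * c) = trG B Q * c := by
  simp only [mul_comm _ c, trG_mul]

lemma map_trG {F' : Type*} [NormedAddCommGroup F'] [NormedSpace ℝ F'] (A : F →L[ℝ] F')
    (B : E n →L[ℝ] E n →L[ℝ] ℝ) (Q : E n → E n → F) : A (trG B Q) = trG B (fun u v => A (Q u v)) := by
  simp [trG]

lemma IsMet.trG_swap {B : E n →L[ℝ] E n →L[ℝ] ℝ} (hB : IsMet B) (Q : E n → E n → F) :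
    trG B (fun u v => Q v u) = trG B Q := by
  unfold trG
  rw [Finset.sum_comm]
  exact Finset.sum_congr rfl fun i _ => Finset.sum_congr rfl fun j _ => by rw [hB.inv_symm]

lemma gradG_apply (B : E n →L[ℝ] E n →L[ℝ] ℝ) (θ : E n →L[ℝ] ℝ) (i : Fin n) :
    gradG B θ i = ∑ j, (bmat B)⁻¹ i j * θ (bv j) := by
  simp [gradG, bv_apply]

lemma IsMet.apply_gradG {B : E n →L[ℝ] E n →L[ℝ] ℝ} (hB : IsMet B) (θ : E n →L[ℝ] ℝ) (w : E n) :
    B (gradG B θ) w = θ w := by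
  have key : ∀ k, B (gradG B θ) (bv k) = θ (bv k) := by
    intro k
    rw [hB.symm, clm_eq_sum_bv (B (bv k))]
    simp only [gradG_apply, smul_eq_mul, Finset.sum_mul]
    rw [Finset.sum_comm]
    have h1 : ∀ j, ∑ i, (bmat B)⁻¹ i j * θ (bv j) * B (bv k) (bv i)
        = (1 : Matrix (Fin n) (Fin n) ℝ) k j * θ (bv j) := by
      intro j
      rw [← Matrix.mul_nonsing_inv _ hB.isUnit, Matrix.mul_apply, Finset.sum_mul]
      refine Finset.sum_congr rfl fun i _ => ?_
      simp [bmat]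
      ring
    simp [h1, Matrix.one_apply]
  exact congrArg (fun A : E n →L[ℝ] ℝ => A w) (clm_ext_bv key)

lemma IsMet.eq_of_apply_eq {B : E n →L[ℝ] E n →L[ℝ] ℝ} (hB : IsMet B) {u v : E n} (h : ∀ w, B u w = B v w) :
    u = v := by
  by_contra hne
  have := hB.pos (u - v) (sub_ne_zero.2 hne)
  have h0 : B (u - v) (u - v) = 0 := by
    rw [map_sub B, sub_apply, h, sub_self]
  exact this.ne' h0

lemma IsMet.trG_tmul {B : E n →L[ℝ] E n →L[ℝ] ℝ} (hB : IsMet B) (θ : E n →L[ℝ] ℝ) (A : E n →L[ℝ] F) :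
    trG B (fun u v => θ u • A v) = A (gradG B θ) := by
  rw [clm_eq_sum_bv A]
  unfold trG
  rw [Finset.sum_comm]
  simp only [gradG_apply, Finset.sum_smul, smul_smul]
  exact Finset.sum_congr rfl fun i _ => Finset.sum_congr rfl fun j _ => by rw [hB.inv_symm]

lemma IsMet.trG_tmul' {B : E n →L[ℝ] E n →L[ℝ] ℝ} (hB : IsMet B) (θ : E n →L[ℝ] ℝ) (A : E n →L[ℝ] F) :
    trG B (fun u v => θ v • A u) = A (gradG B θ) := by
  rw [← hB.trG_tmul, ← hB.trG_swap]

/-- Lowering an index with B and raising it again cancels, so the metric trace becomes the ordinary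
trace of A. This links the contracted Christoffel symbols and the Ricci trace to `trG`. -/
lemma IsMet.trG_apply_clm {B : E n →L[ℝ] E n →L[ℝ] ℝ} (hB : IsMet B) (A : E n →L[ℝ] E n) :
    trG B (fun u v => B u (A v)) = ∑ i, (A (bv i)) i := by
  unfold trG
  have h1 : ∀ i j, B (bv i) (A (bv j)) = ∑ k, (A (bv j)) k * bmat B i k := by
    intro i j
    rw [clm_eq_sum_bv (B (bv i))]
    rfl
  have h2 : ∀ j k, ∑ i, (bmat B)⁻¹ i j * bmat B i k = (1 : Matrix (Fin n) (Fin n) ℝ) j k := by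
    intro j k
    rw [← Matrix.nonsing_inv_mul _ hB.isUnit, Matrix.mul_apply]
    exact Finset.sum_congr rfl fun i _ => by rw [hB.inv_symm]
  rw [Finset.sum_comm]
  refine Finset.sum_congr rfl fun j _ => ?_
  simp only [h1, smul_eq_mul, Finset.mul_sum]
  rw [Finset.sum_comm]
  have h3 : ∀ k, ∑ i, (bmat B)⁻¹ i j * ((A (bv j)) k * bmat B i k)
      = (A (bv j)) k * (1 : Matrix (Fin n) (Fin n) ℝ) j k := by
    intro k
    rw [← h2, Finset.mul_sum]
    exact Finset.sum_congr rfl fun i _ => by ring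
  simp [h3, Matrix.one_apply]

lemma IsMet.trG_self {B : E n →L[ℝ] E n →L[ℝ] ℝ} (hB : IsMet B) : trG B (fun u v => B u v) = n := by
  have := hB.trG_apply_clm (ContinuousLinearMap.id ℝ (E n))
  simpa [bv_apply] using this

/-- The matrix of an endomorphism in the standard basis. -/
def amat (A : E n →L[ℝ] E n) : Matrix (Fin n) (Fin n) ℝ := Matrix.of fun i j => (A (bv j)) i

lemma det_amat (A : E n →L[ℝ] E n) : (amat A).det = A.det := by
  rw [ContinuousLinearMap.det, ← LinearMap.det_toMatrix (EuclideanSpace.basisFun (Fin n) ℝ).toBasis]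
  congr 1

lemma bmat_pull (B' : E n →L[ℝ] E n →L[ℝ] ℝ) (A : E n →L[ℝ] E n) :
    bmat (B'.bilinearComp A A) = (amat A).transpose * bmat B' * amat A := by
  ext i j
  have h1 : bmat (B'.bilinearComp A A) i j = B' (A (bv i)) (A (bv j)) := rfl
  rw [h1, bil_eq_sum_bv, Matrix.mul_assoc, Matrix.mul_apply]
  refine Finset.sum_congr rfl fun k _ => ?_
  rw [Matrix.mul_apply, Finset.mul_sum]
  refine Finset.sum_congr rfl fun l _ => ?_
  simp only [amat, bmat, Matrix.transpose_apply, Matrix.of_apply, smul_eq_mul]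
  ring

/-- Invariance of the metric trace under a change of frame. Nondegeneracy of B already forces det A
≠ 0, so (B')⁻¹ = A B⁻¹ Aᵀ, and Q absorbs the two factors A. -/
lemma trG_pull {B B' : E n →L[ℝ] E n →L[ℝ] ℝ} (hB : IsMet B) (A : E n →L[ℝ] E n)
    (h : ∀ u v, B u v = B' (A u) (A v)) (Q : E n →L[ℝ] E n →L[ℝ] F) :
    trG B (fun u v => Q (A u) (A v)) = trG B' (fun u v => Q u v) := by
  have hBB : B = B'.bilinearComp A A := by
    ext u v
    simp [h]
  have hm : bmat B = (amat A).transpose * bmat B' * amat A := by rw [hBB, bmat_pull]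
  have hd := hB.det_pos.ne'
  rw [hm, Matrix.det_mul, Matrix.det_mul, Matrix.det_transpose] at hd
  have hA : IsUnit (amat A).det := (right_ne_zero_of_mul hd).isUnit
  have key : (bmat B')⁻¹ = amat A * (bmat B)⁻¹ * (amat A).transpose := by
    rw [hm, Matrix.mul_inv_rev, Matrix.mul_inv_rev, ← Matrix.mul_assoc, Matrix.mul_nonsing_inv _ hA,
      Matrix.one_mul, Matrix.mul_assoc, Matrix.nonsing_inv_mul, Matrix.mul_one]
    rwa [Matrix.det_transpose]
  have hent : ∀ k l, (bmat B')⁻¹ k l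
      = ∑ i, ∑ j, (bmat B)⁻¹ i j * ((A (bv i)) k * (A (bv j)) l) := by
    intro k l
    rw [key, Matrix.mul_assoc, Matrix.mul_apply]
    refine Finset.sum_congr rfl fun i _ => ?_
    rw [Matrix.mul_apply, Finset.mul_sum]
    refine Finset.sum_congr rfl fun j _ => ?_
    simp [amat]
    ring
  unfold trG
  simp only [hent, Finset.sum_smul]
  have h2 : ∀ i j, (bmat B)⁻¹ i j • Q (A (bv i)) (A (bv j)) = ∑ k, ∑ l,
      ((bmat B)⁻¹ i j * ((A (bv i)) k * (A (bv j)) l)) • Q (bv k) (bv l) := by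
    intro i j
    rw [bil_eq_sum_bv Q (A (bv i)), Finset.smul_sum]
    refine Finset.sum_congr rfl fun k _ => ?_
    rw [Finset.smul_sum]
    exact Finset.sum_congr rfl fun l _ => smul_smul _ _ _
  simp only [h2]
  rw [Finset.sum_congr rfl fun i _ => Finset.sum_comm (s := Finset.univ), Finset.sum_comm]
  refine Finset.sum_congr rfl fun k _ => ?_
  rw [Finset.sum_congr rfl fun i _ => Finset.sum_comm (s := Finset.univ), Finset.sum_comm]

/-- The Jacobian factor |det A| is the one in the change of variables formula, which makes the
Riemannian volume independent of the chart. -/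
lemma sqrt_det_pull {B B' : E n →L[ℝ] E n →L[ℝ] ℝ} (A : E n →L[ℝ] E n)
    (h : ∀ u v, B u v = B' (A u) (A v)) :
    √(bmat B).det = |A.det| * √(bmat B').det := by
  have hBB : B = B'.bilinearComp A A := by
    ext u v
    simp [h]
  rw [hBB, bmat_pull, Matrix.det_mul, Matrix.det_mul, Matrix.det_transpose, det_amat,
    show A.det * (bmat B').det * A.det = A.det ^ 2 * (bmat B').det by ring,
    Real.sqrt_mul (sq_nonneg _), Real.sqrt_sq_eq_abs]

end TraceAlgebra

/-! ### Derivatives of inverse metrics, traces and volume densities -/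

section TraceCalculus

variable {n : ℕ} {F : Type*} [NormedAddCommGroup F] [NormedSpace ℝ F]
  {X : Type*} [NormedAddCommGroup X] [NormedSpace ℝ X]

lemma contDiffAt_det {k : WithTop ℕ∞} {ι : Type*} [Fintype ι] [DecidableEq ι]
    {M : X → Matrix ι ι ℝ} {x : X} (hM : ∀ i j, ContDiffAt ℝ k (fun z => M z i j) x) :
    ContDiffAt ℝ k (fun z => (M z).det) x := by
  simp only [Matrix.det_apply]
  refine ContDiffAt.sum fun σ _ => ContDiffAt.const_smul _ ?_
  exact contDiffAt_prod fun i _ => hM _ _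

lemma contDiffAt_inv_entry {k : WithTop ℕ∞} {ι : Type*} [Fintype ι] [DecidableEq ι]
    {M : X → Matrix ι ι ℝ} {x : X} (hM : ∀ i j, ContDiffAt ℝ k (fun z => M z i j) x)
    (hx : (M x).det ≠ 0) (i j : ι) : ContDiffAt ℝ k (fun z => (M z)⁻¹ i j) x := by
  simp only [Matrix.inv_def, Ring.inverse_eq_inv', Matrix.smul_apply, Matrix.adjugate_apply,
    smul_eq_mul]
  refine (((contDiffAt_det hM).inv hx)).mul (contDiffAt_det fun a b => ?_)
  by_cases h : a = j
  · subst h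
    simpa using contDiffAt_const
  · simpa [Matrix.updateRow_ne h] using hM a b

lemma contDiffAt_bmat_entry {k : WithTop ℕ∞} {G : X → E n →L[ℝ] E n →L[ℝ] ℝ} {x : X} (hG : ContDiffAt ℝ k G x)
    (i j : Fin n) : ContDiffAt ℝ k (fun z => bmat (G z) i j) x :=
  (hG.clm_apply contDiffAt_const).clm_apply contDiffAt_const

lemma contDiffAt_bmat_inv {k : WithTop ℕ∞} {G : X → E n →L[ℝ] E n →L[ℝ] ℝ} {x : X} (hG : ContDiffAt ℝ k G x)
    (hx : IsMet (G x)) (i j : Fin n) : ContDiffAt ℝ k (fun z => (bmat (G z))⁻¹ i j) x :=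
  contDiffAt_inv_entry (contDiffAt_bmat_entry hG) hx.det_pos.ne' i j

lemma ContDiffAt.trG {k : WithTop ℕ∞} {G : X → E n →L[ℝ] E n →L[ℝ] ℝ} {Q : X → E n →L[ℝ] E n →L[ℝ] F} {x : X}
    (hG : ContDiffAt ℝ k G x) (hx : IsMet (G x)) (hQ : ContDiffAt ℝ k Q x) :
    ContDiffAt ℝ k (fun z => trG (G z) (fun u v => Q z u v)) x := by
  unfold Biharmonic.trG
  refine ContDiffAt.sum fun i _ => ContDiffAt.sum fun j _ => (contDiffAt_bmat_inv hG hx i j).smul ?_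
  exact (hQ.clm_apply contDiffAt_const).clm_apply contDiffAt_const

lemma contDiffAt_gradG {k : WithTop ℕ∞} {G : X → E n →L[ℝ] E n →L[ℝ] ℝ} {θ : X → E n →L[ℝ] ℝ} {x : X}
    (hG : ContDiffAt ℝ k G x) (hx : IsMet (G x)) (hθ : ContDiffAt ℝ k θ x) :
    ContDiffAt ℝ k (fun z => gradG (G z) (θ z)) x := by
  unfold gradG
  refine ContDiffAt.sum fun i _ => (ContDiffAt.sum fun j _ =>
    (contDiffAt_bmat_inv hG hx i j).mul ?_).smul contDiffAt_const
  exact hθ.clm_apply contDiffAt_const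

lemma contDiffAt_sqrt_det {k : WithTop ℕ∞} {G : X → E n →L[ℝ] E n →L[ℝ] ℝ} {x : X} (hG : ContDiffAt ℝ k G x)
    (hx : IsMet (G x)) : ContDiffAt ℝ k (fun z => √(bmat (G z)).det) x :=
  (contDiffAt_det (contDiffAt_bmat_entry hG)).sqrt hx.det_pos.ne'

lemma differentiable_det (ι : Type*) [Fintype ι] [DecidableEq ι] :
    Differentiable ℝ (fun M : ι → ι → ℝ => (Matrix.of M).det) := fun _ =>
  (contDiffAt_det (k := 1) (M := (Matrix.of : (ι → ι → ℝ) → _)) fun i j =>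
    (contDiff_apply_apply ℝ ℝ i j).contDiffAt).differentiableAt one_ne_zero

/-- Jacobi's formula for the derivative of the determinant. -/
lemma fderiv_det {ι : Type*} [Fintype ι] [DecidableEq ι] (M W : ι → ι → ℝ)
    (hM : IsUnit (Matrix.of M).det) :
    fderiv ℝ (fun M : ι → ι → ℝ => (Matrix.of M).det) M W
      = (Matrix.of M).det * ((Matrix.of M)⁻¹ * Matrix.of W).trace := by
  have h1 : HasDerivAt (fun s : ℝ => M + s • W) W 0 := by
    simpa using ((hasDerivAt_id (0 : ℝ)).smul_const W).const_add M
  have h2 := (differentiable_det ι M).hasFDerivAt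
  have h3 : HasFDerivAt (fun M : ι → ι → ℝ => (Matrix.of M).det) (fderiv ℝ
      (fun M : ι → ι → ℝ => (Matrix.of M).det) M) (M + (0 : ℝ) • W) := by simpa using h2
  have h4 := h3.comp_hasDerivAt (0 : ℝ) h1
  set A := (Matrix.of M)⁻¹ * Matrix.of W with hA
  set p := (Matrix.det (1 + (Polynomial.X : Polynomial ℝ) • A.map Polynomial.C)).divX.divX
  -- Since M is invertible, det(M + sW) = det M · det(1 + sA). The second factor is a polynomial in
  -- s with constant coefficient 1 and linear coefficient tr A; p is what remains after division by
  -- s².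
  have h5 : (fun s : ℝ => (Matrix.of (M + s • W)).det)
      = fun s : ℝ => (Matrix.of M).det * (1 + A.trace * s + p.eval s * s ^ 2) := by
    funext s
    rw [← Matrix.det_one_add_smul, ← Matrix.det_mul, mul_add, Matrix.mul_one, Matrix.mul_smul, hA,
      Matrix.mul_nonsing_inv_cancel_left _ _ hM]
    rfl
  have h6 : HasDerivAt (fun s : ℝ => (Matrix.of M).det * (1 + A.trace * s + p.eval s * s ^ 2))
      ((Matrix.of M).det * A.trace) 0 := by
    have := ((((hasDerivAt_id (0 : ℝ)).const_mul A.trace).const_add 1).add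
      ((p.hasDerivAt 0).mul ((hasDerivAt_id (0 : ℝ)).pow 2))).const_mul (Matrix.of M).det
    simpa using this
  have h7 : HasDerivAt (fun s : ℝ => (Matrix.of (M + s • W)).det) _ 0 := h4
  rw [h5] at h7
  exact h7.unique h6

variable {G : X → E n →L[ℝ] E n →L[ℝ] ℝ} {x : X}

lemma hasFDerivAt_apply_apply {Q : X → E n →L[ℝ] E n →L[ℝ] F} (hQ : DifferentiableAt ℝ Q x)
    (u v : E n) : HasFDerivAt (fun z => Q z u v) (((fderiv ℝ Q x).flip u).flip v) x := by
  have h1 : HasFDerivAt (fun z => Q z u) ((fderiv ℝ Q x).flip u) x := by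
    have := hQ.hasFDerivAt.clm_apply (hasFDerivAt_const u x)
    simpa using this
  have := h1.clm_apply (hasFDerivAt_const v x)
  simpa using this

lemma fderiv_apply_apply {Q : X → E n →L[ℝ] E n →L[ℝ] F} (hQ : DifferentiableAt ℝ Q x)
    (u v : E n) (w : X) : fderiv ℝ (fun z => Q z u v) x w = fderiv ℝ Q x w u v := by
  rw [(hasFDerivAt_apply_apply hQ u v).fderiv]
  rfl

/-- The derivative of the volume density. -/
lemma fderiv_sqrt_det (hG : DifferentiableAt ℝ G x) (hx : IsMet (G x)) (w : X) :
    fderiv ℝ (fun z => √(bmat (G z)).det) x w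
      = √(bmat (G x)).det * (1 / 2 * trG (G x) (fun u v => fderiv ℝ G x w u v)) := by
  have h1 : HasFDerivAt (fun z i j => bmat (G z) i j) (ContinuousLinearMap.pi fun i =>
      ContinuousLinearMap.pi fun j => ((fderiv ℝ G x).flip (bv i)).flip (bv j)) x :=
    hasFDerivAt_pi.2 fun i => hasFDerivAt_pi.2 fun j => hasFDerivAt_apply_apply hG _ _
  have h2 := (differentiable_det (Fin n) (fun i j => bmat (G x) i j)).hasFDerivAt.comp x h1
  have h3 := h2.sqrt hx.det_pos.ne'
  have h4 := congrArg (fun A : X →L[ℝ] ℝ => A w) h3.fderiv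
  have h5 : fderiv ℝ (fun z => √(bmat (G z)).det) x w = _ := h4
  rw [h5, smul_apply, ContinuousLinearMap.comp_apply, fderiv_det]
  swap
  · exact hx.isUnit
  change 1 / (2 * √(bmat (G x)).det) * ((bmat (G x)).det * ((bmat (G x))⁻¹ *
    Matrix.of (fun i j => fderiv ℝ G x w (bv i) (bv j))).trace) = _
  have h6 : ((bmat (G x))⁻¹ * Matrix.of (fun i j => fderiv ℝ G x w (bv i) (bv j))).trace
      = trG (G x) (fun u v => fderiv ℝ G x w u v) := by
    rw [← hx.trG_swap]
    simp [Matrix.trace, Matrix.mul_apply, trG]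
  rw [h6]
  have h7 : 0 < √(bmat (G x)).det := Real.sqrt_pos.2 hx.det_pos
  have h8 : (bmat (G x)).det = √(bmat (G x)).det * √(bmat (G x)).det :=
    (Real.mul_self_sqrt hx.det_pos.le).symm
  field_simp
  rw [Real.sq_sqrt hx.det_pos.le]

/-- The derivative of the inverse metric. -/
lemma fderiv_bmat_inv (hG : ContDiffAt ℝ 1 G x) (hx : IsMet (G x)) (w : X)
    {Γ : E n →L[ℝ] E n} (hΓ : ∀ u v, fderiv ℝ G x w u v = G x (Γ u) v + G x u (Γ v))
    (i j : Fin n) :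
    fderiv ℝ (fun z => (bmat (G z))⁻¹ i j) x w
      = -((amat Γ * (bmat (G x))⁻¹) i j + (amat Γ * (bmat (G x))⁻¹) j i) := by
  set D : Matrix (Fin n) (Fin n) ℝ :=
    Matrix.of fun i j => fderiv ℝ (fun z => (bmat (G z))⁻¹ i j) x w with hD
  set M := bmat (G x) with hM
  have hdi : ∀ i j, DifferentiableAt ℝ (fun z => (bmat (G z))⁻¹ i j) x := fun i j =>
    (contDiffAt_bmat_inv hG hx i j).differentiableAt one_ne_zero
  have hdm : ∀ i j, DifferentiableAt ℝ (fun z => bmat (G z) i j) x := fun i j =>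
    (contDiffAt_bmat_entry hG i j).differentiableAt one_ne_zero
  have hev : ∀ᶠ z in 𝓝 x, (bmat (G z)).det ≠ 0 :=
    (contDiffAt_det (contDiffAt_bmat_entry hG)).continuousAt.eventually_ne hx.det_pos.ne'
  have hW : ∀ j k, fderiv ℝ (fun z => bmat (G z) j k) x w
      = ((amat Γ).transpose * M + M * amat Γ) j k := by
    intro j k
    have h0 : fderiv ℝ (fun z => bmat (G z) j k) x w = _ :=
      fderiv_apply_apply (hG.differentiableAt one_ne_zero) (bv j) (bv k) w
    rw [h0, hΓ, hx.symm, clm_eq_sum_bv (G x (bv k)), clm_eq_sum_bv (G x (bv j))]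
    simp only [Matrix.add_apply, Matrix.mul_apply, smul_eq_mul]
    congr 1
    · refine Finset.sum_congr rfl fun l _ => ?_
      rw [hx.symm]
      rfl
    · exact Finset.sum_congr rfl fun l _ => mul_comm _ _
  -- The derivative of M⁻¹M = 1, where compatibility gives the derivative of M as ΓᵀM + MΓ.
  have h1 : D * M + M⁻¹ * ((amat Γ).transpose * M + M * amat Γ) = 0 := by
    ext i k
    have h2 : (fun z => ∑ j, (bmat (G z))⁻¹ i j * bmat (G z) j k)
        =ᶠ[𝓝 x] fun _ => (1 : Matrix (Fin n) (Fin n) ℝ) i k := by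
      filter_upwards [hev] with z hz
      rw [← Matrix.nonsing_inv_mul _ hz.isUnit, Matrix.mul_apply]
    have h3 := congrArg (fun A : X →L[ℝ] ℝ => A w) h2.fderiv_eq
    simp only [fderiv_fun_const, Pi.zero_apply, zero_apply] at h3
    rw [fderiv_fun_sum fun j _ => (hdi i j).fun_mul (hdm j k), sum_apply] at h3
    simp only [Matrix.add_apply, Matrix.mul_apply, Matrix.zero_apply]
    rw [← h3, ← Finset.sum_add_distrib]
    refine Finset.sum_congr rfl fun j _ => ?_
    rw [fderiv_fun_mul (hdi i j) (hdm j k), add_apply, smul_apply, smul_apply, hW]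
    simp only [Matrix.add_apply, Matrix.mul_apply, hD, Matrix.of_apply, smul_eq_mul, hM]
    ring
  have h4 : D = -(M⁻¹ * (amat Γ).transpose + amat Γ * M⁻¹) := by
    have h5 : (D * M + M⁻¹ * ((amat Γ).transpose * M + M * amat Γ)) * M⁻¹ = 0 := by
      rw [h1, Matrix.zero_mul]
    rw [Matrix.add_mul, Matrix.mul_add, Matrix.add_mul, Matrix.mul_assoc D,
      Matrix.mul_nonsing_inv _ hx.isUnit, Matrix.mul_one, Matrix.mul_assoc,
      Matrix.mul_assoc, Matrix.mul_nonsing_inv _ hx.isUnit, Matrix.mul_one,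
      Matrix.nonsing_inv_mul_cancel_left _ _ hx.isUnit] at h5
    exact eq_neg_of_add_eq_zero_left h5
  have h6 : D i j = _ := congrFun (congrFun h4 i) j
  have h7 : (M⁻¹ * (amat Γ).transpose) i j = (amat Γ * M⁻¹) j i := by
    simp only [Matrix.mul_apply, Matrix.transpose_apply]
    exact Finset.sum_congr rfl fun l _ => by rw [hx.inv_symm, mul_comm]
  change D i j = _
  rw [h6, Matrix.neg_apply, Matrix.add_apply, h7, add_comm]

/-- Derivative of a metric trace, in terms of a connection compatible with the metric. -/
lemma fderiv_trG (hG : ContDiffAt ℝ 1 G x) (hx : IsMet (G x)) (w : X)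
    {Γ : E n →L[ℝ] E n} (hΓ : ∀ u v, fderiv ℝ G x w u v = G x (Γ u) v + G x u (Γ v))
    {Q : X → E n →L[ℝ] E n →L[ℝ] F} (hQ : DifferentiableAt ℝ Q x) :
    fderiv ℝ (fun z => trG (G z) (fun u v => Q z u v)) x w
      = trG (G x) (fun u v => fderiv ℝ Q x w u v - Q x (Γ u) v - Q x u (Γ v)) := by
  have hdi : ∀ i j, DifferentiableAt ℝ (fun z => (bmat (G z))⁻¹ i j) x := fun i j =>
    (contDiffAt_bmat_inv hG hx i j).differentiableAt one_ne_zero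
  have hq : ∀ i j, DifferentiableAt ℝ (fun z => Q z (bv i) (bv j)) x := fun i j =>
    (hasFDerivAt_apply_apply hQ _ _).differentiableAt
  have hA : ∀ k, Γ (bv k) = ∑ i, amat Γ i k • bv i := fun k => eq_sum_bv _
  have h1 : trG (G x) (fun u v => Q x (Γ u) v)
      = ∑ i, ∑ j, (amat Γ * (bmat (G x))⁻¹) i j • Q x (bv i) (bv j) := by
    unfold trG
    conv_lhs => rw [Finset.sum_comm]
    conv_rhs => rw [Finset.sum_comm]
    refine Finset.sum_congr rfl fun j _ => ?_
    simp only [hA, map_sum, map_smul, sum_apply, smul_apply, Finset.smul_sum, Matrix.mul_apply,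
      Finset.sum_smul, smul_smul]
    rw [Finset.sum_comm]
    exact Finset.sum_congr rfl fun i _ => Finset.sum_congr rfl fun k _ => by rw [mul_comm]
  have h2 : trG (G x) (fun u v => Q x u (Γ v))
      = ∑ i, ∑ j, (amat Γ * (bmat (G x))⁻¹) j i • Q x (bv i) (bv j) := by
    unfold trG
    refine Finset.sum_congr rfl fun i _ => ?_
    simp only [hA, map_sum, map_smul, Finset.smul_sum, Matrix.mul_apply,
      Finset.sum_smul, smul_smul]
    rw [Finset.sum_comm]
    exact Finset.sum_congr rfl fun j _ => Finset.sum_congr rfl fun k _ => by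
      rw [mul_comm, hx.inv_symm]
  rw [trG_sub, trG_sub, h1, h2]
  unfold trG
  rw [fderiv_fun_sum fun i _ => DifferentiableAt.fun_sum fun j _ => (hdi i j).fun_smul (hq i j),
    sum_apply, ← Finset.sum_sub_distrib, ← Finset.sum_sub_distrib]
  refine Finset.sum_congr rfl fun i _ => ?_
  rw [fderiv_fun_sum fun j _ => (hdi i j).fun_smul (hq i j),
    sum_apply, ← Finset.sum_sub_distrib, ← Finset.sum_sub_distrib]
  refine Finset.sum_congr rfl fun j _ => ?_
  rw [fderiv_fun_smul (hdi i j) (hq i j), add_apply, smul_apply, fderiv_apply_apply hQ,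
    ContinuousLinearMap.smulRight_apply, fderiv_bmat_inv hG hx w hΓ]
  module

/-- The divergence of the metric dual of a one-form. -/
lemma sum_fderiv_sqrt_det_gradG {G : E n → E n →L[ℝ] E n →L[ℝ] ℝ} {y : E n} (hG : ContDiffAt ℝ 1 G y)
    (hy : IsMet (G y)) {Γ : E n →L[ℝ] E n →L[ℝ] E n} (hs : ∀ u v, Γ u v = Γ v u)
    (hΓ : ∀ w u v, fderiv ℝ G y w u v = G y (Γ w u) v + G y u (Γ w v))
    {θ : E n → E n →L[ℝ] ℝ} (hθ : DifferentiableAt ℝ θ y) :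
    ∑ i, fderiv ℝ (fun z => √(bmat (G z)).det * gradG (G z) (θ z) i) y (bv i)
      = √(bmat (G y)).det * trG (G y) (fun u v => fderiv ℝ θ y u v - θ y (Γ u v)) := by
  have hdi : ∀ i j, DifferentiableAt ℝ (fun z => (bmat (G z))⁻¹ i j) y := fun i j =>
    (contDiffAt_bmat_inv hG hy i j).differentiableAt one_ne_zero
  have hω : DifferentiableAt ℝ (fun z => √(bmat (G z)).det) y :=
    (contDiffAt_sqrt_det hG hy).differentiableAt one_ne_zero
  have hθj : ∀ j, HasFDerivAt (fun z => θ z (bv j)) ((fderiv ℝ θ y).flip (bv j)) y := by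
    intro j
    have := hθ.hasFDerivAt.clm_apply (hasFDerivAt_const (bv j) y)
    simpa using this
  have hdj : ∀ j, DifferentiableAt ℝ (fun z => θ z (bv j)) y := fun j =>
    (hθj j).differentiableAt
  -- The logarithmic derivative of the density is a contracted symbol: the two terms of the
  -- compatibility identity have the same trace, which the factor 1/2 compensates.
  have htr : ∀ w, 1 / 2 * trG (G y) (fun u v => fderiv ℝ G y w u v) = ∑ k, Γ w (bv k) k := by
    intro w
    have h1 : trG (G y) (fun u v => fderiv ℝ G y w u v) = trG (G y) (fun u v => G y u (Γ w v))
        + trG (G y) (fun u v => G y v (Γ w u)) := by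
      rw [← trG_add]
      exact trG_congr fun u v => by rw [hΓ, hy.symm (Γ w u)]; ring
    rw [h1, hy.trG_swap (fun u v => G y u (Γ w v)), hy.trG_apply_clm (Γ w)]
    ring
  have h1 : ∀ i, fderiv ℝ (fun z => √(bmat (G z)).det * gradG (G z) (θ z) i) y (bv i)
      = √(bmat (G y)).det * ((∑ k, Γ (bv i) (bv k) k) * gradG (G y) (θ y) i
        - (∑ k, Γ (bv i) (bv k) i * gradG (G y) (θ y) k)
        - (∑ k, (bmat (G y))⁻¹ i k * θ y (Γ (bv i) (bv k)))
        + ∑ j, (bmat (G y))⁻¹ i j * fderiv ℝ θ y (bv i) (bv j)) := by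
    intro i
    simp only [gradG_apply]
    have hd : ∀ j, DifferentiableAt ℝ (fun z => (bmat (G z))⁻¹ i j * θ z (bv j)) y :=
      fun j => (hdi i j).fun_mul (hdj j)
    rw [fderiv_fun_mul hω (DifferentiableAt.fun_sum fun j _ => hd j), add_apply, smul_apply,
      smul_apply, fderiv_sqrt_det (hG.differentiableAt one_ne_zero) hy, htr,
      fderiv_fun_sum fun j _ => hd j, sum_apply]
    have h2 : ∀ j, fderiv ℝ (fun z => (bmat (G z))⁻¹ i j * θ z (bv j)) y (bv i)
        = (bmat (G y))⁻¹ i j * fderiv ℝ θ y (bv i) (bv j)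
          - (∑ k, Γ (bv i) (bv k) i * ((bmat (G y))⁻¹ k j * θ y (bv j)))
          - ∑ k, (bmat (G y))⁻¹ i k * (Γ (bv i) (bv k) j * θ y (bv j)) := by
      intro j
      rw [fderiv_fun_mul (hdi i j) (hdj j), add_apply, smul_apply, smul_apply, (hθj j).fderiv,
        fderiv_bmat_inv hG hy (bv i) (hΓ (bv i)), ContinuousLinearMap.flip_apply]
      have h3 : (amat (Γ (bv i)) * (bmat (G y))⁻¹) i j * θ y (bv j)
          = ∑ k, Γ (bv i) (bv k) i * ((bmat (G y))⁻¹ k j * θ y (bv j)) := by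
        rw [Matrix.mul_apply, Finset.sum_mul]
        exact Finset.sum_congr rfl fun k _ => by simp [amat, mul_assoc]
      have h4 : (amat (Γ (bv i)) * (bmat (G y))⁻¹) j i * θ y (bv j)
          = ∑ k, (bmat (G y))⁻¹ i k * (Γ (bv i) (bv k) j * θ y (bv j)) := by
        rw [Matrix.mul_apply, Finset.sum_mul]
        refine Finset.sum_congr rfl fun k _ => ?_
        rw [hy.inv_symm i k]
        simp only [amat, Matrix.of_apply]
        ring
      rw [← h3, ← h4]
      simp only [smul_eq_mul]
      ring
    simp only [h2, Finset.sum_sub_distrib, smul_eq_mul]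
    have h5 : ∑ j, ∑ k, Γ (bv i) (bv k) i * ((bmat (G y))⁻¹ k j * θ y (bv j))
        = ∑ k, Γ (bv i) (bv k) i * ∑ j, (bmat (G y))⁻¹ k j * θ y (bv j) := by
      rw [Finset.sum_comm]
      simp only [Finset.mul_sum]
    have h6 : ∑ j, ∑ k, (bmat (G y))⁻¹ i k * (Γ (bv i) (bv k) j * θ y (bv j))
        = ∑ k, (bmat (G y))⁻¹ i k * θ y (Γ (bv i) (bv k)) := by
      rw [Finset.sum_comm]
      refine Finset.sum_congr rfl fun k _ => ?_
      rw [clm_eq_sum_bv (θ y) (Γ (bv i) (bv k)), Finset.mul_sum]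
      rfl
    rw [h5, h6]
    ring
  simp only [h1]
  rw [← Finset.mul_sum, Finset.sum_add_distrib, Finset.sum_sub_distrib, Finset.sum_sub_distrib,
    trG_sub]
  -- Here the symmetry of Γ enters: the contraction from differentiating the inverse metric cancels
  -- the one from differentiating the density.
  have h7 : ∑ i, ∑ k, Γ (bv i) (bv k) i * gradG (G y) (θ y) k
      = ∑ i, (∑ k, Γ (bv i) (bv k) k) * gradG (G y) (θ y) i := by
    rw [Finset.sum_comm]
    refine Finset.sum_congr rfl fun k _ => ?_
    rw [Finset.sum_mul]
    exact Finset.sum_congr rfl fun i _ => by rw [hs]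
  rw [h7]
  simp only [trG, smul_eq_mul]
  ring

end TraceCalculus

/-! ### Second fundamental forms and curvature of symbols -/

section SecondOrder

lemma two_le_infty : (2 : WithTop ℕ∞) ≤ ∞ := WithTop.coe_le_coe.2 (le_top : (2 : ℕ∞) ≤ ⊤)

lemma three_le_infty : (3 : WithTop ℕ∞) ≤ ∞ := WithTop.coe_le_coe.2 (le_top : (3 : ℕ∞) ≤ ⊤)

variable {X Y Z : Type*} [NormedAddCommGroup X] [NormedSpace ℝ X] [NormedAddCommGroup Y]
  [NormedSpace ℝ Y] [NormedAddCommGroup Z] [NormedSpace ℝ Z]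

lemma ContDiffAt.eventually_differentiableAt {f : X → Y} {x : X} (hf : ContDiffAt ℝ 1 f x) :
    ∀ᶠ z in 𝓝 x, DifferentiableAt ℝ f z :=
  (hf.eventually (by simp)).mono fun _ hz => hz.differentiableAt one_ne_zero

lemma ContDiffAt.differentiableAt_fderiv {f : X → Y} {x : X} (hf : ContDiffAt ℝ 2 f x) :
    DifferentiableAt ℝ (fderiv ℝ f) x :=
  (hf.fderiv_right (m := 1) (by norm_num)).differentiableAt one_ne_zero

lemma contDiffAt_fderiv_infty {f : X → Y} {x : X} (hf : ContDiffAt ℝ ∞ f x) :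
    ContDiffAt ℝ ∞ (fderiv ℝ f) x := hf.fderiv_right (by simp)

lemma ContDiffAt.fderiv_fderiv_comm {f : X → Y} {x : X} (hf : ContDiffAt ℝ 2 f x) (u v : X) :
    fderiv ℝ (fderiv ℝ f) x u v = fderiv ℝ (fderiv ℝ f) x v u :=
  (hf.isSymmSndFDerivAt (by simp)) u v

lemma fderiv_fderiv_comp {T : Y → Z} {ψ : X → Y} {x : X} (hT : ContDiffAt ℝ 2 T (ψ x))
    (hψ : ContDiffAt ℝ 2 ψ x) (u v : X) :
    fderiv ℝ (fderiv ℝ (fun z => T (ψ z))) x u v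
      = fderiv ℝ (fderiv ℝ T) (ψ x) (fderiv ℝ ψ x u) (fderiv ℝ ψ x v)
        + fderiv ℝ T (ψ x) (fderiv ℝ (fderiv ℝ ψ) x u v) := by
  have h1 : fderiv ℝ (fun z => T (ψ z)) =ᶠ[𝓝 x]
      fun z => (fderiv ℝ T (ψ z)).comp (fderiv ℝ ψ z) := by
    have e1 := ContDiffAt.eventually_differentiableAt (hψ.of_le one_le_two)
    have e2 := hψ.continuousAt.eventually
      (ContDiffAt.eventually_differentiableAt (hT.of_le one_le_two))
    filter_upwards [e1, e2] with z hz1 hz2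
    exact fderiv_fun_comp z hz2 hz1
  have h2 : HasFDerivAt (fun z => fderiv ℝ T (ψ z))
      ((fderiv ℝ (fderiv ℝ T) (ψ x)).comp (fderiv ℝ ψ x)) x :=
    HasFDerivAt.comp (g := fderiv ℝ T) x (ContDiffAt.differentiableAt_fderiv hT).hasFDerivAt
      (hψ.differentiableAt two_ne_zero).hasFDerivAt
  have h3 := h2.clm_comp (ContDiffAt.differentiableAt_fderiv hψ).hasFDerivAt
  rw [h1.fderiv_eq, h3.fderiv]
  simp [add_comm]

/-- The second fundamental form `∇dψ` with respect to symbols `Γ` on the source and `Γ'` on the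
target. -/
def sff (Γ : X → X →L[ℝ] X →L[ℝ] X) (Γ' : Y → Y →L[ℝ] Y →L[ℝ] Y) (ψ : X → Y) (x : X) :
    X →L[ℝ] X →L[ℝ] Y :=
  fderiv ℝ (fderiv ℝ ψ) x - (ContinuousLinearMap.compL ℝ X X Y (fderiv ℝ ψ x)).comp (Γ x)
    + (Γ' (ψ x)).bilinearComp (fderiv ℝ ψ x) (fderiv ℝ ψ x)

lemma sff_apply (Γ : X → X →L[ℝ] X →L[ℝ] X) (Γ' : Y → Y →L[ℝ] Y →L[ℝ] Y) (ψ : X → Y) (x u v : X) :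
    sff Γ Γ' ψ x u v = fderiv ℝ (fderiv ℝ ψ) x u v - fderiv ℝ ψ x (Γ x u v)
      + Γ' (ψ x) (fderiv ℝ ψ x u) (fderiv ℝ ψ x v) := rfl

/-- By the chain rule for second derivatives, the symbols Γ' of the middle space enter the two
summands with opposite signs. When T or ψ is a change of coordinates, one summand vanishes; this is
how tension fields and Hessians pass between charts. -/
lemma sff_comp {Γ : X → X →L[ℝ] X →L[ℝ] X} (Γ' : Y → Y →L[ℝ] Y →L[ℝ] Y)
    {Γ'' : Z → Z →L[ℝ] Z →L[ℝ] Z} {T : Y → Z} {ψ : X → Y} {x : X} (hT : ContDiffAt ℝ 2 T (ψ x))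
    (hψ : ContDiffAt ℝ 2 ψ x) (u v : X) :
    sff Γ Γ'' (fun z => T (ψ z)) x u v = fderiv ℝ T (ψ x) (sff Γ Γ' ψ x u v)
      + sff Γ' Γ'' T (ψ x) (fderiv ℝ ψ x u) (fderiv ℝ ψ x v) := by
  have h : fderiv ℝ (fun z => T (ψ z)) x = (fderiv ℝ T (ψ x)).comp (fderiv ℝ ψ x) :=
    fderiv_fun_comp x (hT.differentiableAt two_ne_zero) (hψ.differentiableAt two_ne_zero)
  simp only [sff_apply, fderiv_fderiv_comp hT hψ, h, ContinuousLinearMap.comp_apply, map_add,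
    map_sub]
  abel

/-- The curvature `R(u, w) v` of the symbols `Γ`, as a bilinear map in `u` and `v`. -/
def curv (Γ : X → X →L[ℝ] X →L[ℝ] X) (x w : X) : X →L[ℝ] X →L[ℝ] X :=
  (fderiv ℝ Γ x).flip w - fderiv ℝ Γ x w + (Γ x).bilinearComp (ContinuousLinearMap.id ℝ X) (Γ x w)
    - (ContinuousLinearMap.compL ℝ X X X (Γ x w)).comp (Γ x)

lemma curv_apply (Γ : X → X →L[ℝ] X →L[ℝ] X) (x w u v : X) :
    curv Γ x w u v = fderiv ℝ Γ x u w v - fderiv ℝ Γ x w u v + Γ x u (Γ x w v)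
      - Γ x w (Γ x u v) := rfl

/-- Curvature is natural under maps with vanishing second fundamental form. -/
lemma curv_map {Γ : X → X →L[ℝ] X →L[ℝ] X} {Γ' : Y → Y →L[ℝ] Y →L[ℝ] Y} {T : X → Y} {x : X}
    (hT : ContDiffAt ℝ 3 T x) (hΓ : DifferentiableAt ℝ Γ x) (hΓ' : DifferentiableAt ℝ Γ' (T x))
    (h0 : ∀ᶠ z in 𝓝 x, ∀ u v, sff Γ Γ' T z u v = 0) (w u v : X) :
    fderiv ℝ T x (curv Γ x w u v)
      = curv Γ' (T x) (fderiv ℝ T x w) (fderiv ℝ T x u) (fderiv ℝ T x v) := by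
  have hT2 : ContDiffAt ℝ 2 (fderiv ℝ T) x := hT.fderiv_right (by norm_num)
  have hTd : DifferentiableAt ℝ T x := hT.differentiableAt (by norm_num)
  have hT1 : DifferentiableAt ℝ (fderiv ℝ T) x := hT2.differentiableAt two_ne_zero
  have hTT : DifferentiableAt ℝ (fderiv ℝ (fderiv ℝ T)) x :=
    ContDiffAt.differentiableAt_fderiv hT2
  have hΓT : HasFDerivAt (fun z => Γ' (T z)) ((fderiv ℝ Γ' (T x)).comp (fderiv ℝ T x)) x :=
    HasFDerivAt.comp (g := Γ') x hΓ'.hasFDerivAt hTd.hasFDerivAt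
  have hz := h0.self_of_nhds
  simp only [sff_apply] at hz h0
  have h1 : ∀ a b, fderiv ℝ T x (Γ x a b) = fderiv ℝ (fderiv ℝ T) x a b
      + Γ' (T x) (fderiv ℝ T x a) (fderiv ℝ T x b) := by
    intro a b
    have := hz a b
    rw [sub_add_eq_add_sub, sub_eq_zero] at this
    exact this.symm
  -- One derivative of the vanishing second fundamental form in the direction a. Skew-symmetrizing
  -- in a and b removes the third derivatives of T and leaves the relation between the curvatures.
  have key : ∀ a b c, fderiv ℝ (fderiv ℝ (fderiv ℝ T)) x a b c
      - (fderiv ℝ (fderiv ℝ T) x a (Γ x b c) + fderiv ℝ T x (fderiv ℝ Γ x a b c))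
      + (fderiv ℝ Γ' (T x) (fderiv ℝ T x a) (fderiv ℝ T x b) (fderiv ℝ T x c)
        + Γ' (T x) (fderiv ℝ (fderiv ℝ T) x a b) (fderiv ℝ T x c)
        + Γ' (T x) (fderiv ℝ T x b) (fderiv ℝ (fderiv ℝ T) x a c)) = 0 := by
    intro a b c
    have e : (fun z => fderiv ℝ (fderiv ℝ T) z b c - fderiv ℝ T z (Γ z b c)
        + Γ' (T z) (fderiv ℝ T z b) (fderiv ℝ T z c)) =ᶠ[𝓝 x] fun _ => (0 : Y) :=
      h0.mono fun z hz => hz b c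
    have d1 := (hTT.hasFDerivAt.clm_apply (hasFDerivAt_const b x)).clm_apply
      (hasFDerivAt_const c x)
    have d2 := hT1.hasFDerivAt.clm_apply
      ((hΓ.hasFDerivAt.clm_apply (hasFDerivAt_const b x)).clm_apply (hasFDerivAt_const c x))
    have d3 := (hΓT.clm_apply (hT1.hasFDerivAt.clm_apply (hasFDerivAt_const b x))).clm_apply
      (hT1.hasFDerivAt.clm_apply (hasFDerivAt_const c x))
    have h4 := ((d1.sub d2).add d3).unique ((hasFDerivAt_const (0 : Y) x).congr_of_eventuallyEq e)
    have h5 := congrArg (fun A : X →L[ℝ] Y => A a) h4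
    simp only [ContinuousLinearMap.comp_zero, zero_add, add_apply, sub_apply,
      ContinuousLinearMap.comp_apply, ContinuousLinearMap.flip_apply, zero_apply] at h5
    rw [← h5]
    abel
  have k1 := key u w v
  have k2 := key w u v
  have s3 : fderiv ℝ (fderiv ℝ (fderiv ℝ T)) x u w v = fderiv ℝ (fderiv ℝ (fderiv ℝ T)) x w u v := by
    rw [ContDiffAt.fderiv_fderiv_comm hT2]
  have s2 : fderiv ℝ (fderiv ℝ T) x u w = fderiv ℝ (fderiv ℝ T) x w u :=
    ContDiffAt.fderiv_fderiv_comm (hT.of_le (by norm_num)) u w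
  rw [s3, s2] at k1
  have k3 : fderiv ℝ T x (fderiv ℝ Γ x u w v) - fderiv ℝ T x (fderiv ℝ Γ x w u v)
      = fderiv ℝ (fderiv ℝ T) x w (Γ x u v) - fderiv ℝ (fderiv ℝ T) x u (Γ x w v)
      + (fderiv ℝ Γ' (T x) (fderiv ℝ T x u) (fderiv ℝ T x w) (fderiv ℝ T x v)
        + Γ' (T x) (fderiv ℝ T x w) (fderiv ℝ (fderiv ℝ T) x u v))
      - (fderiv ℝ Γ' (T x) (fderiv ℝ T x w) (fderiv ℝ T x u) (fderiv ℝ T x v)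
        + Γ' (T x) (fderiv ℝ T x u) (fderiv ℝ (fderiv ℝ T) x w v)) := by
    linear_combination (norm := module) k2 - k1
  simp only [curv_apply, map_sub, map_add, h1, k3]
  abel

end SecondOrder

/-! ### The Levi-Civita connection of a coordinate metric -/

section LeviCivita

variable {n : ℕ}

/-- The bilinear map with components `c k i j`. -/
def bilOf (c : Fin n → Fin n → Fin n → ℝ) : E n →L[ℝ] E n →L[ℝ] E n :=
  ∑ k, ∑ i, ∑ j, c k i j • (EuclideanSpace.proj i : E n →L[ℝ] ℝ).smulRight
    ((EuclideanSpace.proj j : E n →L[ℝ] ℝ).smulRight (bv k))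

lemma bilOf_bv (c : Fin n → Fin n → Fin n → ℝ) (i j k : Fin n) :
    bilOf c (bv i) (bv j) k = c k i j := by
  simp [bilOf, bv_apply]

lemma bil_ext {F : Type*} [NormedAddCommGroup F] [NormedSpace ℝ F] {Q Q' : E n →L[ℝ] E n →L[ℝ] F}
    (h : ∀ i j, Q (bv i) (bv j) = Q' (bv i) (bv j)) : Q = Q' :=
  clm_ext_bv fun i => clm_ext_bv fun j => h i j

/-- The Christoffel symbols of the Levi-Civita connection of a metric on an open set of `ℝⁿ`. -/
def chrSym (g : E n → Matrix (Fin n) (Fin n) ℝ) (k i j : Fin n) (y : E n) : ℝ :=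
  (1 / 2) * ∑ l, (g y)⁻¹ k l *
    (pd i (fun z => g z j l) y + pd j (fun z => g z i l) y - pd l (fun z => g z i j) y)

/-- The Christoffel symbols as a bilinear map. -/
def chr (G : E n → E n →L[ℝ] E n →L[ℝ] ℝ) (y : E n) : E n →L[ℝ] E n →L[ℝ] E n :=
  bilOf fun k i j => chrSym (fun z => bmat (G z)) k i j y

/-- `G` is a smooth Riemannian metric on the open set `U`. -/
structure MetOn (U : Set (E n)) (G : E n → E n →L[ℝ] E n →L[ℝ] ℝ) : Prop where
  isOpen : IsOpen U
  smooth : ∀ y ∈ U, ContDiffAt ℝ ∞ G y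
  met : ∀ y ∈ U, IsMet (G y)

variable {U : Set (E n)} {G : E n → E n →L[ℝ] E n →L[ℝ] ℝ}

lemma pd_eq (i : Fin n) (f : E n → ℝ) (y : E n) : pd i f y = fderiv ℝ f y (bv i) := rfl

lemma contDiffAt_pd {f : E n → ℝ} {y : E n} (hf : ContDiffAt ℝ ∞ f y) (i : Fin n) :
    ContDiffAt ℝ ∞ (pd i f) y :=
  (contDiffAt_fderiv_infty hf).clm_apply contDiffAt_const

lemma MetOn.diff (h : MetOn U G) {y : E n} (hy : y ∈ U) : DifferentiableAt ℝ G y :=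
  (h.smooth y hy).differentiableAt (by simp)

lemma MetOn.contDiffAt_chr (h : MetOn U G) {y : E n} (hy : y ∈ U) : ContDiffAt ℝ ∞ (chr G) y := by
  unfold chr bilOf
  refine ContDiffAt.sum fun k _ => ContDiffAt.sum fun i _ => ContDiffAt.sum fun j _ =>
    ContDiffAt.fun_smul ?_ contDiffAt_const
  have hG := h.smooth y hy
  refine contDiffAt_const.mul (ContDiffAt.sum fun l _ =>
    (contDiffAt_bmat_inv hG (h.met y hy) k l).mul ?_)
  exact ((contDiffAt_pd (contDiffAt_bmat_entry hG j l) i).add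
    (contDiffAt_pd (contDiffAt_bmat_entry hG i l) j)).sub
    (contDiffAt_pd (contDiffAt_bmat_entry hG i j) l)

/-- The Koszul formula. -/
lemma MetOn.koszul (h : MetOn U G) {y : E n} (hy : y ∈ U) (u v w : E n) :
    G y (chr G y u v) w = 1 / 2 * (fderiv ℝ G y u v w + fderiv ℝ G y v u w - fderiv ℝ G y w u v) := by
  set D := fderiv ℝ G y with hD
  have hDe : ∀ i j k, pd i (fun z => bmat (G z) j k) y = D (bv i) (bv j) (bv k) :=
    fun i j k => fderiv_apply_apply (h.diff hy) (bv j) (bv k) (bv i)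
  -- K is the right-hand side of the Koszul formula as a trilinear form; the outer flip produces the
  -- term D w u v. The coordinate Christoffel symbols are K with its last index raised by G.
  let K : E n →L[ℝ] E n →L[ℝ] E n →L[ℝ] ℝ := (1 / 2 : ℝ) • (D + D.flip -
    (ContinuousLinearMap.flipₗᵢ ℝ (E n) (E n) ℝ).toContinuousLinearEquiv.toContinuousLinearMap.comp
      D.flip)
  have hK : ∀ u v w, K u v w = 1 / 2 * (D u v w + D v u w - D w u v) := fun u v w => rfl
  have h1 : (ContinuousLinearMap.compL ℝ (E n) (E n) (E n →L[ℝ] ℝ) (G y)).comp (chr G y) = K := by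
    refine bil_ext fun i j => ?_
    change G y (chr G y (bv i) (bv j)) = K (bv i) (bv j)
    have h2 : chr G y (bv i) (bv j) = gradG (G y) (K (bv i) (bv j)) := by
      ext k
      rw [chr, bilOf_bv, gradG_apply, chrSym, Finset.mul_sum]
      refine Finset.sum_congr rfl fun l _ => ?_
      rw [hK, hDe, hDe, hDe]
      ring
    ext1 w
    rw [h2, (h.met y hy).apply_gradG]
  rw [← hK, ← h1]
  rfl

lemma MetOn.fderiv_symm (h : MetOn U G) {y : E n} (hy : y ∈ U) (u v w : E n) :
    fderiv ℝ G y u v w = fderiv ℝ G y u w v := by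
  rw [← fderiv_apply_apply (h.diff hy), ← fderiv_apply_apply (h.diff hy)]
  have e : (fun z => G z v w) =ᶠ[𝓝 y] fun z => G z w v := by
    filter_upwards [h.isOpen.mem_nhds hy] with z hz
    exact (h.met z hz).symm v w
  rw [e.fderiv_eq]

lemma MetOn.chr_symm (h : MetOn U G) {y : E n} (hy : y ∈ U) (u v : E n) :
    chr G y u v = chr G y v u := by
  refine (h.met y hy).eq_of_apply_eq fun w => ?_
  rw [h.koszul hy, h.koszul hy, h.fderiv_symm hy w u v]
  ring

/-- The Levi-Civita connection is compatible with the metric. -/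
lemma MetOn.compat (h : MetOn U G) {y : E n} (hy : y ∈ U) (w u v : E n) :
    fderiv ℝ G y w u v = G y (chr G y w u) v + G y u (chr G y w v) := by
  rw [(h.met y hy).symm u, h.koszul hy, h.koszul hy, h.fderiv_symm hy w v u,
    h.fderiv_symm hy v w u, h.fderiv_symm hy u w v]
  ring

/-- Uniqueness of the Levi-Civita symbols. -/
lemma MetOn.eq_chr (h : MetOn U G) {y : E n} (hy : y ∈ U) (a u v : E n)
    (ha : ∀ w, G y a w
      = 1 / 2 * (fderiv ℝ G y u v w + fderiv ℝ G y v u w - fderiv ℝ G y w u v)) :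
    a = chr G y u v :=
  (h.met y hy).eq_of_apply_eq fun w => by rw [ha, h.koszul hy]

/-- Local isometries have vanishing second fundamental form. -/
lemma sff_eq_zero_of_isometry {U' : Set (E n)} {G' : E n → E n →L[ℝ] E n →L[ℝ] ℝ} (h : MetOn U G)
    (h' : MetOn U' G') {T : E n → E n} {y : E n} (hy : y ∈ U) (hTy : T y ∈ U')
    (hT : ContDiffAt ℝ 2 T y)
    (hiso : ∀ᶠ z in 𝓝 y, ∀ u v, G z u v = G' (T z) (fderiv ℝ T z u) (fderiv ℝ T z v))
    (u v : E n) : sff (chr G) (chr G') T y u v = 0 := by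
  have hTd : DifferentiableAt ℝ T y := hT.differentiableAt two_ne_zero
  have hT1 : DifferentiableAt ℝ (fderiv ℝ T) y := ContDiffAt.differentiableAt_fderiv hT
  set D := fderiv ℝ T y with hD
  have h0 := hiso.self_of_nhds
  have hinj : Function.Injective D := by
    refine (injective_iff_map_eq_zero D).2 fun u hu => ?_
    by_contra hne
    have := (h.met y hy).pos u hne
    rw [h0, hu] at this
    simp at this
  -- An isometric differential is injective, hence onto by equality of dimensions, so vectors in the
  -- target may be tested against images D w only.
  have hsurj : Function.Surjective D :=
    LinearMap.surjective_of_injective (f := (D : E n →ₗ[ℝ] E n)) hinj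
  have hG'T : HasFDerivAt (fun z => G' (T z)) ((fderiv ℝ G' (T y)).comp D) y :=
    HasFDerivAt.comp (g := G') y (h'.diff hTy).hasFDerivAt hTd.hasFDerivAt
  have hder : ∀ a b c, fderiv ℝ G y a b c = fderiv ℝ G' (T y) (D a) (D b) (D c)
      + G' (T y) (fderiv ℝ (fderiv ℝ T) y a b) (D c)
      + G' (T y) (D b) (fderiv ℝ (fderiv ℝ T) y a c) := by
    intro a b c
    rw [← fderiv_apply_apply (h.diff hy)]
    have e : (fun z => G z b c) =ᶠ[𝓝 y] fun z => G' (T z) (fderiv ℝ T z b) (fderiv ℝ T z c) :=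
      hiso.mono fun z hz => hz b c
    have d := (hG'T.clm_apply (hT1.hasFDerivAt.clm_apply (hasFDerivAt_const b y))).clm_apply
      (hT1.hasFDerivAt.clm_apply (hasFDerivAt_const c y))
    rw [e.fderiv_eq, d.fderiv]
    simp only [ContinuousLinearMap.comp_zero, zero_add, add_apply,
      ContinuousLinearMap.comp_apply, ContinuousLinearMap.flip_apply, ← hD]
    ring
  rw [sff_apply, sub_add_eq_add_sub, sub_eq_zero]
  refine (h'.met _ hTy).eq_of_apply_eq fun w' => ?_
  obtain ⟨w, rfl⟩ := hsurj w'
  have s := fun a b => ContDiffAt.fderiv_fderiv_comm hT a b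
  rw [← h0, h.koszul hy, map_add, add_apply, h'.koszul hTy, hder, hder, hder, s w u, s w v, s v u,
    (h'.met _ hTy).symm (D v), (h'.met _ hTy).symm (D u) (fderiv ℝ (fderiv ℝ T) y v w)]
  ring

/-- The curvature is skew-symmetric with respect to the metric. -/
lemma MetOn.curv_skew (h : MetOn U G) {y : E n} (hy : y ∈ U) (w u a b : E n) :
    G y (curv (chr G) y w u a) b = -G y a (curv (chr G) y w u b) := by
  have hD2 : ContDiffAt ℝ 2 G y := (h.smooth y hy).of_le two_le_infty
  have hDD := ContDiffAt.differentiableAt_fderiv hD2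
  have hGd := (h.diff hy).hasFDerivAt
  have hΓ : HasFDerivAt (chr G) _ y :=
    ((h.contDiffAt_chr hy).differentiableAt (by simp)).hasFDerivAt
  -- Metric compatibility differentiated once more. As the second derivative of G is symmetric in u
  -- and w, comparing the two orders gives the skew-symmetry of the curvature.
  have key : ∀ u w, fderiv ℝ (fderiv ℝ G) y u w a b
      = fderiv ℝ G y u (chr G y w a) b + G y (fderiv ℝ (chr G) y u w a) b
        + fderiv ℝ G y u a (chr G y w b) + G y a (fderiv ℝ (chr G) y u w b) := by
    intro u w
    have e : (fun z => fderiv ℝ G z w a b) =ᶠ[𝓝 y]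
        fun z => G z (chr G z w a) b + G z a (chr G z w b) := by
      filter_upwards [h.isOpen.mem_nhds hy] with z hz
      exact h.compat hz w a b
    have d1 := ((hDD.hasFDerivAt.clm_apply (hasFDerivAt_const w y)).clm_apply
      (hasFDerivAt_const a y)).clm_apply (hasFDerivAt_const b y)
    have d2 := (hGd.clm_apply ((hΓ.clm_apply (hasFDerivAt_const w y)).clm_apply
      (hasFDerivAt_const a y))).clm_apply (hasFDerivAt_const b y)
    have d3 := (hGd.clm_apply (hasFDerivAt_const a y)).clm_apply
      ((hΓ.clm_apply (hasFDerivAt_const w y)).clm_apply (hasFDerivAt_const b y))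
    have h4 := d1.unique ((d2.add d3).congr_of_eventuallyEq e)
    have h5 := congrArg (fun A : E n →L[ℝ] ℝ => A u) h4
    simp only [ContinuousLinearMap.comp_zero, zero_add, add_apply,
      ContinuousLinearMap.comp_apply, ContinuousLinearMap.flip_apply] at h5
    rw [h5]
    ring
  have k1 := key u w
  have k2 := key w u
  rw [ContDiffAt.fderiv_fderiv_comm hD2] at k1
  simp only [h.compat hy] at k1 k2
  simp only [curv_apply, map_sub, map_add, add_apply, sub_apply]
  linarith only [k1, k2]

end LeviCivita

/-! ### Symmetry of third derivatives and the second-order Leibniz rule -/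

section ThirdOrder

variable {X Y : Type*} [NormedAddCommGroup X] [NormedSpace ℝ X] [NormedAddCommGroup Y]
  [NormedSpace ℝ Y]

lemma fderiv_three_comm_left {f : X → Y} {x : X} (hf : ContDiffAt ℝ ∞ f x) (u v w : X) :
    fderiv ℝ (fderiv ℝ (fderiv ℝ f)) x u v w = fderiv ℝ (fderiv ℝ (fderiv ℝ f)) x v u w := by
  rw [ContDiffAt.fderiv_fderiv_comm ((contDiffAt_fderiv_infty hf).of_le two_le_infty)]

lemma fderiv_three_comm_right {f : X → Y} {x : X} (hf : ContDiffAt ℝ ∞ f x) (u v w : X) :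
    fderiv ℝ (fderiv ℝ (fderiv ℝ f)) x u v w = fderiv ℝ (fderiv ℝ (fderiv ℝ f)) x u w v := by
  have hd : DifferentiableAt ℝ (fderiv ℝ (fderiv ℝ f)) x :=
    (contDiffAt_fderiv_infty (contDiffAt_fderiv_infty hf)).differentiableAt (by simp)
  have e : (fun z => fderiv ℝ (fderiv ℝ f) z v w) =ᶠ[𝓝 x] fun z => fderiv ℝ (fderiv ℝ f) z w v := by
    filter_upwards [(hf.of_le two_le_infty).eventually (by simp)] with z hz
    exact ContDiffAt.fderiv_fderiv_comm hz v w
  have d1 := fun a b : X => (hd.hasFDerivAt.clm_apply (hasFDerivAt_const a x)).clm_apply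
    (hasFDerivAt_const b x)
  have h := (d1 v w).unique ((d1 w v).congr_of_eventuallyEq e)
  have h5 := congrArg (fun A : X →L[ℝ] Y => A u) h
  simpa using h5

/-- Second derivative of the contraction of a one-form with a vector field. -/
lemma fderiv_fderiv_apply {α : X → X →L[ℝ] Y} {V : X → X} {x : X} (hα : ContDiffAt ℝ 2 α x)
    (hV : ContDiffAt ℝ 2 V x) (u v : X) :
    fderiv ℝ (fderiv ℝ (fun z => α z (V z))) x u v
      = fderiv ℝ (fderiv ℝ α) x u v (V x) + fderiv ℝ α x v (fderiv ℝ V x u)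
        + fderiv ℝ α x u (fderiv ℝ V x v) + α x (fderiv ℝ (fderiv ℝ V) x u v) := by
  have hαd := (hα.differentiableAt two_ne_zero).hasFDerivAt
  have hVd := (hV.differentiableAt two_ne_zero).hasFDerivAt
  have hα2 := (ContDiffAt.differentiableAt_fderiv hα).hasFDerivAt
  have hV2 := (ContDiffAt.differentiableAt_fderiv hV).hasFDerivAt
  have hd : DifferentiableAt ℝ (fderiv ℝ (fun z => α z (V z))) x :=
    ContDiffAt.differentiableAt_fderiv (hα.clm_apply hV)
  have e : (fun z => fderiv ℝ (fun z => α z (V z)) z v) =ᶠ[𝓝 x]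
      fun z => α z (fderiv ℝ V z v) + fderiv ℝ α z v (V z) := by
    filter_upwards [ContDiffAt.eventually_differentiableAt (hα.of_le one_le_two),
      ContDiffAt.eventually_differentiableAt (hV.of_le one_le_two)] with z h1 h2
    rw [(h1.hasFDerivAt.clm_apply h2.hasFDerivAt).fderiv]
    simp
  have d1 := hd.hasFDerivAt.clm_apply (hasFDerivAt_const v x)
  have d2 := (hαd.clm_apply (hV2.clm_apply (hasFDerivAt_const v x))).add
    ((hα2.clm_apply (hasFDerivAt_const v x)).clm_apply hVd)
  have h5 := congrArg (fun A : X →L[ℝ] Y => A u) (d1.unique (d2.congr_of_eventuallyEq e))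
  simp only [ContinuousLinearMap.comp_zero, zero_add, add_apply,
    ContinuousLinearMap.comp_apply, ContinuousLinearMap.flip_apply] at h5
  rw [h5]
  abel

end ThirdOrder

/-! ### Hessian, Laplacian and norm of the gradient in coordinates -/

section Laplacian

variable {n : ℕ} {U : Set (E n)} {G : E n → E n →L[ℝ] E n →L[ℝ] ℝ} {f r : E n → ℝ} {y : E n}

/-- The Hessian `∇df`. -/
def hess (G : E n → E n →L[ℝ] E n →L[ℝ] ℝ) (f : E n → ℝ) : E n → E n →L[ℝ] E n →L[ℝ] ℝ :=
  sff (chr G) (fun _ => 0) f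

lemma hess_apply (u v : E n) :
    hess G f y u v = fderiv ℝ (fderiv ℝ f) y u v - fderiv ℝ f y (chr G y u v) := by
  rw [hess, sff_apply]
  simp

/-- The Laplace–Beltrami operator `trace ∇df`. -/
def lap (G : E n → E n →L[ℝ] E n →L[ℝ] ℝ) (f : E n → ℝ) (y : E n) : ℝ :=
  trG (G y) fun u v => hess G f y u v

/-- The squared norm of the differential. -/
def nsq (G : E n → E n →L[ℝ] E n →L[ℝ] ℝ) (f : E n → ℝ) (y : E n) : ℝ :=
  trG (G y) fun u v => fderiv ℝ f y u * fderiv ℝ f y v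

/-- The Ricci tensor applied to the gradient of `f`. -/
def ricT (G : E n → E n →L[ℝ] E n →L[ℝ] ℝ) (f : E n → ℝ) (y w : E n) : ℝ :=
  -trG (G y) fun u v => fderiv ℝ f y (curv (chr G) y w u v)

/-- The divergence of a one-form. -/
def divG (G : E n → E n →L[ℝ] E n →L[ℝ] ℝ) (θ : E n → E n →L[ℝ] ℝ) (y : E n) : ℝ :=
  trG (G y) fun u v => fderiv ℝ θ y u v - θ y (chr G y u v)

lemma MetOn.contDiffAt_hess (h : MetOn U G) (hy : y ∈ U) (hf : ContDiffAt ℝ ∞ f y) :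
    ContDiffAt ℝ ∞ (hess G f) y := by
  have h1 := contDiffAt_fderiv_infty hf
  have h2 := contDiffAt_fderiv_infty h1
  have e : hess G f = fun z => fderiv ℝ (fderiv ℝ f) z
      - (ContinuousLinearMap.compL ℝ (E n) (E n) ℝ (fderiv ℝ f z)).comp (chr G z) := by
    funext z
    ext u v
    rw [hess_apply]
    rfl
  rw [e]
  refine h2.sub (ContDiffAt.clm_comp ?_ (h.contDiffAt_chr hy))
  exact (ContinuousLinearMap.compL ℝ (E n) (E n) ℝ).contDiff.contDiffAt.comp y h1

lemma MetOn.fderiv_hess (h : MetOn U G) (hy : y ∈ U) (hf : ContDiffAt ℝ ∞ f y) (w u v : E n) :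
    fderiv ℝ (hess G f) y w u v = fderiv ℝ (fderiv ℝ (fderiv ℝ f)) y w u v
      - fderiv ℝ (fderiv ℝ f) y w (chr G y u v) - fderiv ℝ f y (fderiv ℝ (chr G) y w u v) := by
  rw [← fderiv_apply_apply ((h.contDiffAt_hess hy hf).differentiableAt (by simp))]
  simp only [hess_apply]
  have h1 := contDiffAt_fderiv_infty hf
  have d1 := (h1.differentiableAt (by simp)).hasFDerivAt
  have d2 := ((contDiffAt_fderiv_infty h1).differentiableAt (by simp)).hasFDerivAt
  have d3 := ((h.contDiffAt_chr hy).differentiableAt (by simp)).hasFDerivAt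
  have d := ((d2.clm_apply (hasFDerivAt_const u y)).clm_apply (hasFDerivAt_const v y)).fun_sub
    (d1.clm_apply ((d3.clm_apply (hasFDerivAt_const u y)).clm_apply (hasFDerivAt_const v y)))
  rw [d.fderiv]
  simp only [ContinuousLinearMap.comp_zero, zero_add, add_apply, sub_apply,
    ContinuousLinearMap.comp_apply, ContinuousLinearMap.flip_apply]
  ring

lemma MetOn.hess_symm (h : MetOn U G) (hy : y ∈ U) (hf : ContDiffAt ℝ 2 f y) (u v : E n) :
    hess G f y u v = hess G f y v u := by
  rw [hess_apply, hess_apply, h.chr_symm hy,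
    ContDiffAt.fderiv_fderiv_comm hf]

lemma MetOn.contDiffAt_lap (h : MetOn U G) (hy : y ∈ U) (hf : ContDiffAt ℝ ∞ f y) :
    ContDiffAt ℝ ∞ (lap G f) y :=
  ContDiffAt.trG (h.smooth y hy) (h.met y hy) (h.contDiffAt_hess hy hf)

lemma nsq_eq (h : IsMet (G y)) :
    nsq G f y = fderiv ℝ f y (gradG (G y) (fderiv ℝ f y)) :=
  h.trG_tmul (fderiv ℝ f y) (fderiv ℝ f y)

/-- The tensor square of a one-form. -/
def tsq (θ : E n →L[ℝ] ℝ) : E n →L[ℝ] E n →L[ℝ] ℝ := θ.smulRight θ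

lemma MetOn.contDiffAt_nsq (h : MetOn U G) (hy : y ∈ U) (hf : ContDiffAt ℝ ∞ f y) :
    ContDiffAt ℝ ∞ (nsq G f) y := by
  have h1 := contDiffAt_fderiv_infty hf
  exact ContDiffAt.trG (Q := fun z => tsq (fderiv ℝ f z)) (h.smooth y hy) (h.met y hy)
    (h1.smulRight h1)

/-- The Codazzi equation for the Hessian. -/
lemma MetOn.codazzi (h : MetOn U G) (hy : y ∈ U) (hf : ContDiffAt ℝ ∞ f y) (w u v : E n) :
    fderiv ℝ (hess G f) y u v w - hess G f y (chr G y u v) w - fderiv ℝ (hess G f) y w v u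
      + hess G f y (chr G y w v) u = -fderiv ℝ f y (curv (chr G) y w u v) := by
  have s2 := fun a b => ContDiffAt.fderiv_fderiv_comm (hf.of_le two_le_infty) a b
  have dsym : ∀ a b c, fderiv ℝ (chr G) y a b c = fderiv ℝ (chr G) y a c b := by
    intro a b c
    have hd := (h.contDiffAt_chr hy).differentiableAt (by simp)
    rw [← fderiv_apply_apply hd, ← fderiv_apply_apply hd]
    have e : (fun z => chr G z b c) =ᶠ[𝓝 y] fun z => chr G z c b := by
      filter_upwards [h.isOpen.mem_nhds hy] with z hz
      exact h.chr_symm hz b c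
    rw [e.fderiv_eq]
  rw [h.fderiv_hess hy hf, h.fderiv_hess hy hf, hess_apply, hess_apply, curv_apply,
    fderiv_three_comm_right hf u v w, fderiv_three_comm_left hf u w v,
    fderiv_three_comm_right hf w u v, dsym u v w, dsym w v u, h.chr_symm hy v w,
    h.chr_symm hy v u, s2 u (chr G y w v), s2 w (chr G y u v), h.chr_symm hy (chr G y u v) w,
    h.chr_symm hy (chr G y w v) u]
  simp only [map_sub, map_add]
  ring

/-- The metric is parallel, so the derivative of the trace is the trace of the covariant derivative;
the two Christoffel corrections agree because the Hessian is symmetric. -/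
lemma MetOn.fderiv_lap (h : MetOn U G) (hy : y ∈ U) (hf : ContDiffAt ℝ ∞ f y) (w : E n) :
    fderiv ℝ (lap G f) y w = trG (G y) (fun u v => fderiv ℝ (hess G f) y w u v)
      - 2 * trG (G y) (fun u v => hess G f y (chr G y w u) v) := by
  have h1 := fderiv_trG ((h.smooth y hy).of_le (by simp)) (h.met y hy) w (h.compat hy w)
    ((h.contDiffAt_hess hy hf).differentiableAt (by simp))
  have h2 : fderiv ℝ (lap G f) y w = _ := h1
  rw [h2, trG_sub, trG_sub]
  have h3 : trG (G y) (fun u v => hess G f y u (chr G y w v))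
      = trG (G y) (fun u v => hess G f y (chr G y w u) v) := by
    rw [← (h.met y hy).trG_swap]
    exact trG_congr fun u v => h.hess_symm hy (hf.of_le two_le_infty) _ _
  rw [h3]
  ring

/-- This is d|df|²(w) = 2 Hess f(w, grad f), with the Hessian left expanded so that its two pieces
can be matched separately in the first variation. -/
lemma MetOn.fderiv_nsq (h : MetOn U G) (hy : y ∈ U) (hf : ContDiffAt ℝ ∞ f y) (w : E n) :
    fderiv ℝ (nsq G f) y w = 2 * fderiv ℝ (fderiv ℝ f) y w (gradG (G y) (fderiv ℝ f y))
      - 2 * fderiv ℝ f y (chr G y w (gradG (G y) (fderiv ℝ f y))) := by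
  have hm := h.met y hy
  have d1 := ((contDiffAt_fderiv_infty hf).differentiableAt (by simp)).hasFDerivAt
  have hQ : DifferentiableAt ℝ (fun z => tsq (fderiv ℝ f z)) y :=
    (((contDiffAt_fderiv_infty hf).smulRight (contDiffAt_fderiv_infty hf))).differentiableAt
      (by simp)
  have h1 := fderiv_trG ((h.smooth y hy).of_le (by simp)) hm w (h.compat hy w) hQ
  have h2 : fderiv ℝ (nsq G f) y w = _ := h1
  have h3 : ∀ u v, fderiv ℝ (fun z => tsq (fderiv ℝ f z)) y w u v
      = fderiv ℝ f y u * fderiv ℝ (fderiv ℝ f) y w v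
        + fderiv ℝ f y v * fderiv ℝ (fderiv ℝ f) y w u := by
    intro u v
    rw [← fderiv_apply_apply hQ]
    have d := (d1.clm_apply (hasFDerivAt_const u y)).fun_mul (d1.clm_apply (hasFDerivAt_const v y))
    have e : (fun z => tsq (fderiv ℝ f z) u v) = fun z => fderiv ℝ f z u * fderiv ℝ f z v := rfl
    rw [e, d.fderiv]
    simp
  rw [h2]
  simp only [h3]
  have h4 : ∀ u v, tsq (fderiv ℝ f y) u v = fderiv ℝ f y u * fderiv ℝ f y v := fun u v => rfl
  simp only [h4]
  rw [trG_sub, trG_sub, trG_add]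
  have e1 := hm.trG_tmul (fderiv ℝ f y) (fderiv ℝ (fderiv ℝ f) y w)
  have e2 := hm.trG_tmul' (fderiv ℝ f y) (fderiv ℝ (fderiv ℝ f) y w)
  have e3 := hm.trG_tmul (fderiv ℝ f y) ((fderiv ℝ f y).comp (chr G y w))
  have e4 := hm.trG_tmul' (fderiv ℝ f y) ((fderiv ℝ f y).comp (chr G y w))
  simp only [smul_eq_mul, ContinuousLinearMap.comp_apply] at e1 e2 e3 e4
  simp only [mul_comm (fderiv ℝ f y (chr G y w _)) (fderiv ℝ f y _)]
  rw [e1, e2, e3, e4]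
  ring

end Laplacian

/-! ### The pointwise first variation formula -/

section FirstVariation

variable {n : ℕ} {U : Set (E n)} {G : E n → E n →L[ℝ] E n →L[ℝ] ℝ} {f r : E n → ℝ} {y : E n}

/-- The conformal metric `exp(2 r) G`. -/
def conf (r : E n → ℝ) (G : E n → E n →L[ℝ] E n →L[ℝ] ℝ) (y : E n) : E n →L[ℝ] E n →L[ℝ] ℝ :=
  Real.exp (2 * r y) • G y

lemma contDiffAt_exp_two_mul (hr : ContDiffAt ℝ ∞ r y) :
    ContDiffAt ℝ ∞ (fun z => Real.exp (2 * r z)) y := (contDiffAt_const.mul hr).exp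

lemma hasFDerivAt_exp_two_mul (hr : DifferentiableAt ℝ r y) :
    HasFDerivAt (fun z => Real.exp (2 * r z)) ((2 * Real.exp (2 * r y)) • fderiv ℝ r y) y := by
  have h := (hr.hasFDerivAt.const_mul 2).exp
  rwa [smul_smul, mul_comm (Real.exp _)] at h

lemma MetOn.conf (h : MetOn U G) (hr : ∀ z ∈ U, ContDiffAt ℝ ∞ r z) : MetOn U (conf r G) where
  isOpen := h.isOpen
  smooth y hy := (contDiffAt_exp_two_mul (hr y hy)).smul (h.smooth y hy)
  met y hy :=
    { symm := fun u v => by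
        change Real.exp (2 * r y) * G y u v = Real.exp (2 * r y) * G y v u
        rw [(h.met y hy).symm]
      pos := fun v hv => mul_pos (Real.exp_pos _) ((h.met y hy).pos v hv) }

lemma MetOn.fderiv_conf (h : MetOn U G) (hy : y ∈ U) (hr : DifferentiableAt ℝ r y) (w u v : E n) :
    fderiv ℝ (Biharmonic.conf r G) y w u v
      = Real.exp (2 * r y) * (2 * fderiv ℝ r y w * G y u v + fderiv ℝ G y w u v) := by
  have d := (hasFDerivAt_exp_two_mul hr).fun_smul (h.diff hy).hasFDerivAt
  have e : fderiv ℝ (Biharmonic.conf r G) y = _ := d.fderiv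
  rw [e]
  simp only [add_apply, smul_apply, ContinuousLinearMap.smulRight_apply, smul_eq_mul]
  ring

/-- The difference of the Levi-Civita symbols of conformal metrics. -/
def confDiff (r : E n → ℝ) (G : E n → E n →L[ℝ] E n →L[ℝ] ℝ) (y : E n) :
    E n →L[ℝ] E n →L[ℝ] E n := chr (conf r G) y - chr G y

/-- The candidate satisfies the Koszul identity of `conf r G`, which determines the symbols uniquely
(`MetOn.eq_chr`). -/
lemma confDiff_apply (h : MetOn U G) (hr : ∀ z ∈ U, ContDiffAt ℝ ∞ r z) (hy : y ∈ U) (u v : E n) :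
    confDiff r G y u v = fderiv ℝ r y u • v + fderiv ℝ r y v • u
      - G y u v • gradG (G y) (fderiv ℝ r y) := by
  have hm := h.met y hy
  have hrd : DifferentiableAt ℝ r y := (hr y hy).differentiableAt (by simp)
  have key : chr G y u v + (fderiv ℝ r y u • v + fderiv ℝ r y v • u
      - G y u v • gradG (G y) (fderiv ℝ r y)) = chr (conf r G) y u v := by
    refine (h.conf hr).eq_chr hy _ u v fun w => ?_
    rw [h.fderiv_conf hy hrd, h.fderiv_conf hy hrd, h.fderiv_conf hy hrd]
    change Real.exp (2 * r y) * G y _ w = _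
    simp only [map_add, map_sub, map_smul, add_apply, sub_apply, smul_apply, smul_eq_mul,
      hm.apply_gradG, h.koszul hy]
    rw [hm.symm v w, hm.symm u w]
    ring
  rw [confDiff, sub_apply, sub_apply, ← key]
  abel

/-- Apart from its trace, the difference tensor enters the first variation only paired with dr,
because the tension field is a multiple of grad r. In this pairing the gradient term becomes the
scalar |dr|². -/
lemma fderiv_confDiff (h : MetOn U G) (hr : ∀ z ∈ U, ContDiffAt ℝ ∞ r z) (hy : y ∈ U)
    (u v : E n) : fderiv ℝ r y (confDiff r G y u v) = 2 * fderiv ℝ r y u * fderiv ℝ r y v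
      - G y u v * nsq G r y := by
  rw [confDiff_apply h hr hy, nsq_eq (h.met y hy)]
  simp only [map_add, map_sub, map_smul, smul_eq_mul]
  ring

/-- The tension field of the identity map between conformal metrics. -/
lemma trG_confDiff (h : MetOn U G) (hr : ∀ z ∈ U, ContDiffAt ℝ ∞ r z) (hy : y ∈ U) :
    trG (G y) (fun u v => confDiff r G y u v) = (2 - (n : ℝ)) • gradG (G y) (fderiv ℝ r y) := by
  have hm := h.met y hy
  simp only [confDiff_apply h hr hy]
  rw [trG_sub, trG_add]
  have e1 := hm.trG_tmul (fderiv ℝ r y) (ContinuousLinearMap.id ℝ (E n))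
  have e2 := hm.trG_tmul' (fderiv ℝ r y) (ContinuousLinearMap.id ℝ (E n))
  have e3 : trG (G y) (fun u v => G y u v • gradG (G y) (fderiv ℝ r y))
      = (n : ℝ) • gradG (G y) (fderiv ℝ r y) := by
    rw [← hm.trG_self]
    exact (map_trG (ContinuousLinearMap.toSpanSingleton ℝ (gradG (G y) (fderiv ℝ r y))) (G y)
      (fun u v => G y u v)).symm
  simp only [ContinuousLinearMap.id_apply] at e1 e2
  rw [e1, e2, e3]
  module

/-- The linearization along `V` at the identity of the second fundamental form, where `Γ` and `Γ'`
are the symbols on the source and the target. -/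
def linSff (Γ Γ' : E n → E n →L[ℝ] E n →L[ℝ] E n) (V : E n → E n) (y u v : E n) : E n :=
  fderiv ℝ (fderiv ℝ V) y u v - fderiv ℝ V y (Γ y u v) + fderiv ℝ Γ' y (V y) u v
    + Γ' y (fderiv ℝ V y u) v + Γ' y u (fderiv ℝ V y v)

/-- The linearization along `V` at the identity of the squared norm of the tension field of maps
from `G` to `G'`. -/
def firstVar (G G' : E n → E n →L[ℝ] E n →L[ℝ] ℝ) (V : E n → E n) (y : E n) : ℝ :=
  fderiv ℝ G' y (V y) (trG (G y) fun u v => chr G' y u v - chr G y u v)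
      (trG (G y) fun u v => chr G' y u v - chr G y u v)
    + 2 * G' y (trG (G y) fun u v => chr G' y u v - chr G y u v)
      (trG (G y) fun u v => linSff (chr G) (chr G') V y u v)

/-- The Euler–Lagrange form of the identity map `G → exp(2 r) G`, up to a factor. -/
def eulerForm (G : E n → E n →L[ℝ] E n →L[ℝ] ℝ) (r : E n → ℝ) (y w : E n) : ℝ :=
  fderiv ℝ (lap G r) y w + (6 - n) / 2 * fderiv ℝ (nsq G r) y w
    + (-2 * lap G r y + (2 - n) * nsq G r y) * fderiv ℝ r y w + 2 * ricT G r y w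

/-! ### The Bochner formula for the linearized connection -/

section Bochner

variable {V : E n → E n}

/-- The one-forms whose divergence enters the Bochner formula. -/
lemma MetOn.trG_linSff_self (h : MetOn U G) (hy : y ∈ U) (hf : ContDiffAt ℝ ∞ f y)
    (hV : ContDiffAt ℝ ∞ V y) :
    trG (G y) (fun u v => fderiv ℝ f y (linSff (chr G) (chr G) V y u v))
      = divG G (fderiv ℝ (fun z => fderiv ℝ f z (V z))) y
        - 2 * divG G (fun z => hess G f z (V z)) y + fderiv ℝ (lap G f) y (V y)
        + 2 * ricT G f y (V y) := by
  have hm := h.met y hy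
  have hf1 := contDiffAt_fderiv_infty hf
  have hf2 := hf1.of_le two_le_infty
  have hV2 := hV.of_le two_le_infty
  have hVd := (hV.differentiableAt (by simp)).hasFDerivAt
  have s2 := fun a b => ContDiffAt.fderiv_fderiv_comm (hf.of_le two_le_infty) a b
  have hfV : ∀ w, fderiv ℝ (fun z => fderiv ℝ f z (V z)) y w
      = fderiv ℝ f y (fderiv ℝ V y w) + fderiv ℝ (fderiv ℝ f) y w (V y) := by
    intro w
    rw [((hf1.differentiableAt (by simp)).hasFDerivAt.clm_apply hVd).fderiv]
    simp
  have hHd := (h.contDiffAt_hess hy hf).differentiableAt (by simp)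
  have hHV : ∀ u v, fderiv ℝ (fun z => hess G f z (V z)) y u v
      = hess G f y (fderiv ℝ V y u) v + fderiv ℝ (hess G f) y u (V y) v := by
    intro u v
    rw [(hHd.hasFDerivAt.clm_apply hVd).fderiv]
    simp
  -- With equal source and target symbols, `linSff` is the Lie derivative of the connection along V.
  -- This is df(L_V∇) = Hess(Vf) − L_V(Hess f) in coordinates.
  have hpt : ∀ u v, fderiv ℝ f y (linSff (chr G) (chr G) V y u v)
      = (fderiv ℝ (fderiv ℝ (fun z => fderiv ℝ f z (V z))) y u v
          - fderiv ℝ (fun z => fderiv ℝ f z (V z)) y (chr G y u v))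
        - (fderiv ℝ (hess G f) y (V y) u v + hess G f y (fderiv ℝ V y u) v
          + hess G f y (fderiv ℝ V y v) u) := by
    intro u v
    rw [fderiv_fderiv_apply hf2 hV2, hfV, h.fderiv_hess hy hf, hess_apply, hess_apply, linSff,
      fderiv_three_comm_right hf u v, fderiv_three_comm_left hf u (V y), s2 v, s2 u,
      s2 (chr G y u v), h.chr_symm hy (fderiv ℝ V y v) u]
    simp only [map_sub, map_add]
    ring
  simp only [hpt]
  unfold divG
  simp only [hHV]
  rw [h.fderiv_lap hy hf, ricT]
  simp only [trG_sub, trG_add]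
  rw [hm.trG_swap (fun u v => hess G f y (fderiv ℝ V y u) v)]
  -- The trace of the Codazzi equation, that is div Hess f = d(lap f) + Ric(grad f, ·) evaluated at
  -- V. It is the only source of the Ricci term.
  have hcod : trG (G y) (fun u v => fderiv ℝ f y (curv (chr G) y (V y) u v))
      = -(trG (G y) (fun u v => fderiv ℝ (hess G f) y u (V y) v)
        - trG (G y) (fun u v => hess G f y (V y) (chr G y u v))
        - trG (G y) (fun u v => fderiv ℝ (hess G f) y (V y) u v)
        + trG (G y) (fun u v => hess G f y (chr G y (V y) u) v)) := by
    rw [← hm.trG_swap (fun u v => fderiv ℝ (hess G f) y (V y) u v),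
      ← hm.trG_swap (fun u v => hess G f y (chr G y (V y) u) v), ← trG_sub, ← trG_sub, ← trG_add,
      ← trG_neg]
    refine trG_congr fun u v => ?_
    have hsym : fderiv ℝ (hess G f) y u v (V y) = fderiv ℝ (hess G f) y u (V y) v := by
      rw [← fderiv_apply_apply hHd, ← fderiv_apply_apply hHd]
      have e : (fun z => hess G f z v (V y)) =ᶠ[𝓝 y] fun z => hess G f z (V y) v := by
        filter_upwards [h.isOpen.mem_nhds hy,
          (hf.of_le two_le_infty).eventually (by simp)] with z hz hz2
        exact h.hess_symm hz hz2 v (V y)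
      rw [e.fderiv_eq]
    rw [← hsym, h.hess_symm hy (hf.of_le two_le_infty) (V y)]
    have := h.codazzi hy hf (V y) u v
    linarith only [this]
  rw [hcod]
  ring

lemma divG_add {θ θ' : E n → E n →L[ℝ] ℝ} (hθ : DifferentiableAt ℝ θ y)
    (hθ' : DifferentiableAt ℝ θ' y) :
    divG G (fun z => θ z + θ' z) y = divG G θ y + divG G θ' y := by
  unfold divG
  rw [fderiv_fun_add hθ hθ', ← trG_add]
  refine trG_congr fun u v => ?_
  simp only [add_apply]
  ring

lemma divG_smul {c : E n → ℝ} {θ : E n → E n →L[ℝ] ℝ} (hc : DifferentiableAt ℝ c y)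
    (hθ : DifferentiableAt ℝ θ y) (hm : IsMet (G y)) :
    divG G (fun z => c z • θ z) y = fderiv ℝ c y (gradG (G y) (θ y)) + c y * divG G θ y := by
  unfold divG
  rw [fderiv_fun_smul hc hθ, ← hm.trG_tmul' (θ y) (fderiv ℝ c y), ← trG_mul, ← trG_add]
  refine trG_congr fun u v => ?_
  simp only [add_apply, smul_apply, ContinuousLinearMap.smulRight_apply, smul_eq_mul]
  ring

lemma divG_fderiv : divG G (fderiv ℝ f) y = lap G f y := by
  unfold divG lap
  simp only [hess_apply]

lemma MetOn.gradG_flat (h : MetOn U G) (hy : y ∈ U) (v : E n) : gradG (G y) (G y v) = v :=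
  (h.met y hy).eq_of_apply_eq fun w => (h.met y hy).apply_gradG _ w

/-- By compatibility and symmetry of the symbols, the divergence is the trace of ∇V. Its two
summands depend on coordinates separately; they are kept apart because the first variation produces
them apart. -/
lemma MetOn.divG_flat (h : MetOn U G) (hy : y ∈ U) (hV : DifferentiableAt ℝ V y) :
    divG G (fun z => G z (V z)) y = trG (G y) (fun u v => G y (chr G y (V y) u) v)
      + trG (G y) (fun u v => G y (fderiv ℝ V y u) v) := by
  unfold divG
  rw [← trG_add]
  refine trG_congr fun u v => ?_
  rw [((h.diff hy).hasFDerivAt.clm_apply hV.hasFDerivAt).fderiv]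
  simp only [add_apply, ContinuousLinearMap.comp_apply, ContinuousLinearMap.flip_apply, h.compat hy,
    h.chr_symm hy (V y) u]
  ring

end Bochner

/-! ### The first variation at the identity onto a conformal metric -/

section Conformal

variable {V : E n → E n}

/-- The primitive `exp(2 r) / 2` of the form `exp(2 r) dr`. -/
def halfExp (r : E n → ℝ) (z : E n) : ℝ := Real.exp (2 * r z) / 2

lemma contDiffAt_halfExp (hr : ContDiffAt ℝ ∞ r y) : ContDiffAt ℝ ∞ (halfExp r) y :=
  (contDiffAt_exp_two_mul hr).div_const 2

lemma fderiv_halfExp (hr : DifferentiableAt ℝ r y) :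
    fderiv ℝ (halfExp r) y = Real.exp (2 * r y) • fderiv ℝ r y := by
  have h := (hasFDerivAt_exp_two_mul hr).mul_const (1 / 2 : ℝ)
  have e : halfExp r = fun z => Real.exp (2 * r z) * (1 / 2) := by
    funext z
    simp [halfExp, div_eq_mul_inv]
  rw [e, h.fderiv, smul_smul]
  congr 1
  ring

lemma fderiv_fderiv_halfExp (hr : ContDiffAt ℝ ∞ r y) (u v : E n) :
    fderiv ℝ (fderiv ℝ (halfExp r)) y u v = Real.exp (2 * r y) *
      (2 * fderiv ℝ r y u * fderiv ℝ r y v + fderiv ℝ (fderiv ℝ r) y u v) := by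
  have e : fderiv ℝ (halfExp r) =ᶠ[𝓝 y] fun z => Real.exp (2 * r z) • fderiv ℝ r z :=
    (ContDiffAt.eventually_differentiableAt (hr.of_le (by simp))).mono fun z hz =>
      fderiv_halfExp hz
  have d := (hasFDerivAt_exp_two_mul (hr.differentiableAt (by simp))).fun_smul
    ((contDiffAt_fderiv_infty hr).differentiableAt (by simp)).hasFDerivAt
  rw [e.fderiv_eq, d.fderiv]
  simp only [add_apply, smul_apply, ContinuousLinearMap.smulRight_apply, smul_eq_mul]
  ring

lemma lap_halfExp (hr : ContDiffAt ℝ ∞ r y) :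
    lap G (halfExp r) y = Real.exp (2 * r y) * (lap G r y + 2 * nsq G r y) := by
  unfold lap nsq
  rw [← trG_mul, ← trG_add, ← trG_mul]
  refine trG_congr fun u v => ?_
  rw [hess_apply, hess_apply, fderiv_fderiv_halfExp hr,
    fderiv_halfExp (hr.differentiableAt (by simp)), smul_apply, smul_eq_mul]
  ring

lemma MetOn.fderiv_lap_halfExp (h : MetOn U G) (hy : y ∈ U) (hr : ∀ z ∈ U, ContDiffAt ℝ ∞ r z)
    (w : E n) : fderiv ℝ (lap G (halfExp r)) y w = Real.exp (2 * r y) *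
      (2 * fderiv ℝ r y w * (lap G r y + 2 * nsq G r y) + fderiv ℝ (lap G r) y w
        + 2 * fderiv ℝ (nsq G r) y w) := by
  have e : lap G (halfExp r) =ᶠ[𝓝 y]
      fun z => Real.exp (2 * r z) * (lap G r z + 2 * nsq G r z) := by
    filter_upwards [h.isOpen.mem_nhds hy] with z hz
    exact lap_halfExp (hr z hz)
  have d := (hasFDerivAt_exp_two_mul ((hr y hy).differentiableAt (by simp))).fun_mul
    (((h.contDiffAt_lap hy (hr y hy)).differentiableAt (by simp)).hasFDerivAt.fun_add
      (((h.contDiffAt_nsq hy (hr y hy)).differentiableAt (by simp)).hasFDerivAt.const_mul 2))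
  rw [e.fderiv_eq, d.fderiv]
  simp only [add_apply, smul_apply, smul_eq_mul]
  ring

lemma ricT_halfExp (hr : ContDiffAt ℝ ∞ r y) (w : E n) :
    ricT G (halfExp r) y w = Real.exp (2 * r y) * ricT G r y w := by
  unfold ricT
  rw [fderiv_halfExp (hr.differentiableAt (by simp)), mul_neg, ← trG_mul]
  rfl

/-- The one-form whose divergence is the difference of the first variation and its Euler–Lagrange
part. -/
def bdryForm (G : E n → E n →L[ℝ] E n →L[ℝ] ℝ) (r : E n → ℝ) (V : E n → E n) (z : E n) :
    E n →L[ℝ] ℝ :=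
  fderiv ℝ (fun x => fderiv ℝ (halfExp r) x (V x)) z + ((-2 : ℝ) • hess G (halfExp r) z (V z)
    + ((4 * (Real.exp (2 * r z) * fderiv ℝ r z (V z))) • fderiv ℝ r z
      + (-2 * (Real.exp (2 * r z) * nsq G r z)) • G z (V z)))

lemma MetOn.contDiffAt_bdryForm (h : MetOn U G) (hy : y ∈ U) (hr : ContDiffAt ℝ ∞ r y)
    (hV : ContDiffAt ℝ ∞ V y) : ContDiffAt ℝ ∞ (bdryForm G r V) y := by
  have h1 := contDiffAt_fderiv_infty hr
  have h2 := contDiffAt_fderiv_infty (contDiffAt_halfExp hr)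
  have h3 := contDiffAt_exp_two_mul hr
  refine (contDiffAt_fderiv_infty (h2.clm_apply hV)).add (ContDiffAt.add ?_ (ContDiffAt.add ?_ ?_))
  · exact ((h.contDiffAt_hess hy (contDiffAt_halfExp hr)).clm_apply hV).const_smul (-2 : ℝ)
  · exact (contDiffAt_const.mul (h3.mul (h1.clm_apply hV))).smul h1
  · exact (contDiffAt_const.mul (h3.mul (h.contDiffAt_nsq hy hr))).smul
      ((h.smooth y hy).clm_apply hV)

/-- Only the last two summands of `bdryForm` are expanded by the Leibniz rule. The first two
divergences stay as they are, to be matched with those of the Bochner formula for `halfExp r`. -/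
lemma MetOn.divG_bdryForm (h : MetOn U G) (hy : y ∈ U) (hr : ContDiffAt ℝ ∞ r y)
    (hV : ContDiffAt ℝ ∞ V y) :
    divG G (bdryForm G r V) y = divG G (fderiv ℝ (fun z => fderiv ℝ (halfExp r) z (V z))) y
      - 2 * divG G (fun z => hess G (halfExp r) z (V z)) y
      + 4 * Real.exp (2 * r y) * (2 * nsq G r y * fderiv ℝ r y (V y)
        + fderiv ℝ (fderiv ℝ r) y (V y) (gradG (G y) (fderiv ℝ r y))
        + fderiv ℝ r y (fderiv ℝ V y (gradG (G y) (fderiv ℝ r y)))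
        + fderiv ℝ r y (V y) * lap G r y)
      - 2 * Real.exp (2 * r y) * (2 * fderiv ℝ r y (V y) * nsq G r y + fderiv ℝ (nsq G r) y (V y)
        + nsq G r y * (trG (G y) (fun u v => G y (chr G y (V y) u) v)
          + trG (G y) (fun u v => G y (fderiv ℝ V y u) v))) := by
  have hm := h.met y hy
  have h1 := contDiffAt_fderiv_infty hr
  have h2 := contDiffAt_fderiv_infty (contDiffAt_halfExp hr)
  have h3 := contDiffAt_exp_two_mul hr
  have hVd := hV.differentiableAt (x := y) (by simp)
  have h1d := h1.differentiableAt (x := y) (by simp)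
  have hed := hasFDerivAt_exp_two_mul (hr.differentiableAt (x := y) (by simp))
  have a1 : DifferentiableAt ℝ (fderiv ℝ (fun z => fderiv ℝ (halfExp r) z (V z))) y :=
    (contDiffAt_fderiv_infty (h2.clm_apply hV)).differentiableAt (by simp)
  have a2 : DifferentiableAt ℝ (fun z => hess G (halfExp r) z (V z)) y :=
    ((h.contDiffAt_hess hy (contDiffAt_halfExp hr)).clm_apply hV).differentiableAt (by simp)
  have c3 := (hed.fun_mul (h1d.hasFDerivAt.clm_apply hVd.hasFDerivAt)).const_mul 4
  have c4 := (hed.fun_mul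
    ((h.contDiffAt_nsq hy hr).differentiableAt (by simp)).hasFDerivAt).const_mul (-2)
  have a4 : DifferentiableAt ℝ (fun z => G z (V z)) y :=
    ((h.smooth y hy).clm_apply hV).differentiableAt (by simp)
  unfold bdryForm
  rw [divG_add a1 ((a2.fun_const_smul _).fun_add
      ((c3.differentiableAt.fun_smul h1d).fun_add (c4.differentiableAt.fun_smul a4))),
    divG_add (a2.fun_const_smul _)
      ((c3.differentiableAt.fun_smul h1d).fun_add (c4.differentiableAt.fun_smul a4)),
    divG_add (c3.differentiableAt.fun_smul h1d) (c4.differentiableAt.fun_smul a4),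
    divG_smul (differentiableAt_const _) a2 hm, divG_smul c3.differentiableAt h1d hm,
    divG_smul c4.differentiableAt a4 hm, c3.fderiv, c4.fderiv, h.gradG_flat hy,
    h.divG_flat hy hVd, fderiv_fun_const,
    ContDiffAt.fderiv_fderiv_comm (hr.of_le two_le_infty) (V y)]
  simp only [divG_fderiv, add_apply, smul_apply, smul_eq_mul, ContinuousLinearMap.comp_apply,
    ContinuousLinearMap.flip_apply, Pi.zero_apply, zero_apply, ← nsq_eq hm]
  ring

lemma contDiffAt_confDiff (h : MetOn U G) (hr : ∀ z ∈ U, ContDiffAt ℝ ∞ r z) (hy : y ∈ U) :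
    ContDiffAt ℝ ∞ (confDiff r G) y :=
  ((h.conf hr).contDiffAt_chr hy).sub (h.contDiffAt_chr hy)

/-- Obtained by differentiating the scalar identity `fderiv_confDiff`, which avoids any derivative
of the gradient field; the last term corrects for the derivative falling on dr. -/
lemma fderiv_apply_fderiv_confDiff (h : MetOn U G) (hr : ∀ z ∈ U, ContDiffAt ℝ ∞ r z) (hy : y ∈ U)
    (w u v : E n) : fderiv ℝ r y (fderiv ℝ (confDiff r G) y w u v)
      = 2 * (fderiv ℝ r y u * fderiv ℝ (fderiv ℝ r) y w v)
        + 2 * (fderiv ℝ r y v * fderiv ℝ (fderiv ℝ r) y w u)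
        - fderiv ℝ G y w u v * nsq G r y - G y u v * fderiv ℝ (nsq G r) y w
        - fderiv ℝ (fderiv ℝ r) y w (confDiff r G y u v) := by
  have e : (fun z => fderiv ℝ r z (confDiff r G z u v)) =ᶠ[𝓝 y]
      fun z => 2 * fderiv ℝ r z u * fderiv ℝ r z v - G z u v * nsq G r z := by
    filter_upwards [h.isOpen.mem_nhds hy] with z hz
    exact fderiv_confDiff h hr hz u v
  have d1 := ((contDiffAt_fderiv_infty (hr y hy)).differentiableAt (by simp)).hasFDerivAt
  have dA := ((contDiffAt_confDiff h hr hy).differentiableAt (by simp)).hasFDerivAt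
  have dG := (h.diff hy).hasFDerivAt
  have dn := ((h.contDiffAt_nsq hy (hr y hy)).differentiableAt (by simp)).hasFDerivAt
  have l := d1.clm_apply ((dA.clm_apply (hasFDerivAt_const u y)).clm_apply (hasFDerivAt_const v y))
  have k := (((d1.clm_apply (hasFDerivAt_const u y)).const_mul 2).fun_mul
    (d1.clm_apply (hasFDerivAt_const v y))).fun_sub
    (((dG.clm_apply (hasFDerivAt_const u y)).clm_apply (hasFDerivAt_const v y)).fun_mul dn)
  have h5 := congrArg (fun A : E n →L[ℝ] ℝ => A w) (l.unique (k.congr_of_eventuallyEq e))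
  simp only [ContinuousLinearMap.comp_zero, zero_add, add_apply, sub_apply, smul_apply, smul_eq_mul,
    ContinuousLinearMap.comp_apply, ContinuousLinearMap.flip_apply] at h5
  linarith only [h5]

/-- The first variation formula at the identity between conformal metrics. -/
theorem firstVar_conf (h : MetOn U G) (hr : ∀ z ∈ U, ContDiffAt ℝ ∞ r z) (hy : y ∈ U)
    (hV : ContDiffAt ℝ ∞ V y) :
    1 / 2 * firstVar G (conf r G) V y = (2 - (n : ℝ)) *
      (Real.exp (2 * r y) * eulerForm G r y (V y) + divG G (bdryForm G r V) y) := by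
  have hm := h.met y hy
  have hry := hr y hy
  set g := gradG (G y) (fderiv ℝ r y) with hg
  have hτ : trG (G y) (fun u v => chr (conf r G) y u v - chr G y u v) = (2 - (n : ℝ)) • g :=
    trG_confDiff h hr hy
  have hΓ : fderiv ℝ (chr (conf r G)) y = fderiv ℝ (chr G) y + fderiv ℝ (confDiff r G) y := by
    have e : chr (conf r G) = fun z => chr G z + confDiff r G z := by
      funext z
      simp [confDiff]
    rw [e, fderiv_fun_add ((h.contDiffAt_chr hy).differentiableAt (by simp))
      ((contDiffAt_confDiff h hr hy).differentiableAt (by simp))]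
  -- The target symbols are those of G plus the difference tensor. The linearization splits
  -- accordingly into the Lie derivative of the connection, for the Bochner formula, and terms of
  -- order at most one in V.
  have hlin : ∀ u v, linSff (chr G) (chr (conf r G)) V y u v
      = linSff (chr G) (chr G) V y u v + fderiv ℝ (confDiff r G) y (V y) u v
        + confDiff r G y (fderiv ℝ V y u) v + confDiff r G y u (fderiv ℝ V y v) := by
    intro u v
    simp only [linSff, hΓ, confDiff, sub_apply, add_apply]
    abel
  -- Lowered with the target metric, the tension field is (2−n) times the differential of `halfExp
  -- r`; hence the Bochner formula is applied to that function.
  have hflat : ∀ X, conf r G y ((2 - (n : ℝ)) • g) X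
      = (2 - (n : ℝ)) * Real.exp (2 * r y) * fderiv ℝ r y X := by
    intro X
    change Real.exp (2 * r y) * G y ((2 - (n : ℝ)) • g) X = _
    rw [map_smul, smul_apply, hm.apply_gradG, smul_eq_mul]
    ring
  have hboch := h.trG_linSff_self hy (contDiffAt_halfExp hry) hV
  rw [fderiv_halfExp (hry.differentiableAt (by simp)), h.fderiv_lap_halfExp hy hr,
    ricT_halfExp hry] at hboch
  simp only [smul_apply, smul_eq_mul, trG_mul] at hboch
  have hA1 : trG (G y) (fun u v => fderiv ℝ r y (fderiv ℝ (confDiff r G) y (V y) u v))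
      = 4 * fderiv ℝ (fderiv ℝ r) y (V y) g
        - 2 * trG (G y) (fun u v => G y (chr G y (V y) u) v) * nsq G r y
        - n * fderiv ℝ (nsq G r) y (V y) - (2 - n) * fderiv ℝ (fderiv ℝ r) y (V y) g := by
    simp only [fderiv_apply_fderiv_confDiff h hr hy, trG_sub, trG_add, trG_mul, trG_mul_right]
    have e1 := hm.trG_tmul (fderiv ℝ r y) (fderiv ℝ (fderiv ℝ r) y (V y))
    have e2 := hm.trG_tmul' (fderiv ℝ r y) (fderiv ℝ (fderiv ℝ r) y (V y))
    have e3 : trG (G y) (fun u v => fderiv ℝ G y (V y) u v)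
        = 2 * trG (G y) (fun u v => G y (chr G y (V y) u) v) := by
      simp only [h.compat hy, trG_add]
      rw [← hm.trG_swap (fun u v => G y u (chr G y (V y) v))]
      simp only [hm.symm _ (chr G y (V y) _)]
      ring
    have e4 := map_trG (fderiv ℝ (fderiv ℝ r) y (V y)) (G y) (fun u v => confDiff r G y u v)
    rw [trG_confDiff h hr hy, map_smul, smul_eq_mul] at e4
    simp only [smul_eq_mul] at e1 e2
    rw [e1, e2, e3, ← e4, hm.trG_self]
    ring
  have hA2 : trG (G y) (fun u v => fderiv ℝ r y (confDiff r G y (fderiv ℝ V y u) v))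
      = 2 * fderiv ℝ r y (fderiv ℝ V y g)
        - trG (G y) (fun u v => G y (fderiv ℝ V y u) v) * nsq G r y := by
    simp only [fderiv_confDiff h hr hy, trG_sub, trG_mul_right, mul_assoc, trG_mul]
    have e1 := hm.trG_tmul' (fderiv ℝ r y) ((fderiv ℝ r y).comp (fderiv ℝ V y))
    simp only [smul_eq_mul, ContinuousLinearMap.comp_apply] at e1
    simp only [mul_comm (fderiv ℝ r y (fderiv ℝ V y _)) (fderiv ℝ r y _)]
    rw [e1]
  have hA3 : trG (G y) (fun u v => fderiv ℝ r y (confDiff r G y u (fderiv ℝ V y v)))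
      = trG (G y) (fun u v => fderiv ℝ r y (confDiff r G y (fderiv ℝ V y u) v)) := by
    rw [← hm.trG_swap]
    refine trG_congr fun u v => ?_
    rw [fderiv_confDiff h hr hy, fderiv_confDiff h hr hy, hm.symm]
    ring
  have hdG : fderiv ℝ G y (V y) g g = 2 * fderiv ℝ (fderiv ℝ r) y (V y) g
      - fderiv ℝ (nsq G r) y (V y) := by
    rw [h.compat hy, hm.symm (chr G y (V y) g), hm.apply_gradG, h.fderiv_nsq hy hry]
    ring
  have hGg : G y g g = nsq G r y := by rw [hm.apply_gradG, nsq_eq hm]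
  unfold firstVar
  rw [hτ, hflat, h.fderiv_conf hy (hry.differentiableAt (by simp)), map_trG]
  simp only [hlin, map_add, trG_add, map_smul, smul_apply, smul_eq_mul, hdG, hGg]
  rw [hA3, hA2, hA1, h.divG_bdryForm hy hry hV, eulerForm]
  -- Only scalars at y remain. The traces of `chr G y (V y)` and of the derivative of V, multiplied
  -- by |dr|², cancel against the divergence of `bdryForm`.
  linear_combination (2 - (n : ℝ)) * hboch

end Conformal

end FirstVariation

/-! ### Smooth dependence on a time parameter -/

section Parametric

variable {X Y : Type*} [NormedAddCommGroup X] [NormedSpace ℝ X] [NormedAddCommGroup Y]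
  [NormedSpace ℝ Y]

lemma contDiffAt_fderiv_snd {f : ℝ × X → Y} {p : ℝ × X} (hf : ContDiffAt ℝ ∞ f p) :
    ContDiffAt ℝ ∞ (fun q : ℝ × X => fderiv ℝ (fun z => f (q.1, z)) q.2) p := by
  refine ContDiffAt.fderiv (n := ∞) (f := fun (q : ℝ × X) z => f (q.1, z)) (g := Prod.snd) ?_
    contDiffAt_snd (by simp)
  have h1 : ContDiffAt ℝ ∞ (fun a : (ℝ × X) × X => (a.1.1, a.2)) (p, p.2) :=
    (contDiffAt_fst.fst).prodMk contDiffAt_snd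
  exact ContDiffAt.comp (g := f) (p, p.2) hf h1

lemma contDiffAt_deriv_fst {f : ℝ × X → Y} {t : ℝ} {x : X} (hf : ContDiffAt ℝ ∞ f (t, x)) :
    ContDiffAt ℝ ∞ (fun z => deriv (fun s => f (s, z)) t) x := by
  have h2 : ContDiffAt ℝ ∞ (fun z => fderiv ℝ (fun s => f (s, z)) t) x := by
    refine ContDiffAt.fderiv (n := ∞) (f := fun (z : X) s => f (s, z)) (g := fun _ => t) ?_
      contDiffAt_const (by simp)
    have h1 : ContDiffAt ℝ ∞ (fun a : X × ℝ => (a.2, a.1)) (x, t) :=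
      contDiffAt_snd.prodMk contDiffAt_fst
    exact ContDiffAt.comp (g := f) (x, t) hf h1
  exact h2.clm_apply contDiffAt_const

lemma hasFDerivAt_slice_snd {f : ℝ × X → Y} {t : ℝ} {x : X} (hf : DifferentiableAt ℝ f (t, x)) :
    HasFDerivAt (fun z => f (t, z)) ((fderiv ℝ f (t, x)).comp (ContinuousLinearMap.inr ℝ ℝ X)) x :=
  HasFDerivAt.comp (g := f) x hf.hasFDerivAt (hasFDerivAt_prodMk_right t x)

lemma hasDerivAt_slice_fst {f : ℝ × X → Y} {t : ℝ} {x : X} (hf : DifferentiableAt ℝ f (t, x)) :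
    HasDerivAt (fun s => f (s, x)) (fderiv ℝ f (t, x) (1, 0)) t := by
  have h := HasFDerivAt.comp (g := f) (f := fun s : ℝ => (s, x)) t hf.hasFDerivAt
    (hasFDerivAt_prodMk_left t x)
  exact h.hasDerivAt.congr_deriv (by simp)

/-- Derivatives in the parameter and in the space variable commute. -/
lemma hasDerivAt_fderiv_slice {f : ℝ × X → Y} {t : ℝ} {x : X} (hf : ContDiffAt ℝ 2 f (t, x)) :
    HasDerivAt (fun s => fderiv ℝ (fun z => f (s, z)) x)
      (fderiv ℝ (fun z => deriv (fun s => f (s, z)) t) x) t := by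
  have hd := ContDiffAt.eventually_differentiableAt (hf.of_le one_le_two)
  have h2 := ContDiffAt.differentiableAt_fderiv hf
  have e1 : (fun s => fderiv ℝ (fun z => f (s, z)) x) =ᶠ[𝓝 t]
      fun s => (fderiv ℝ f (s, x)).comp (ContinuousLinearMap.inr ℝ ℝ X) := by
    have hc : ContinuousAt (fun s : ℝ => (s, x)) t := by fun_prop
    filter_upwards [hc.eventually hd] with s hs
    exact (hasFDerivAt_slice_snd hs).fderiv
  have e2 : (fun z => deriv (fun s => f (s, z)) t) =ᶠ[𝓝 x] fun z => fderiv ℝ f (t, z) (1, 0) := by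
    have hc : ContinuousAt (fun z : X => (t, z)) x := by fun_prop
    filter_upwards [hc.eventually hd] with z hz
    exact (hasDerivAt_slice_fst hz).deriv
  have d1 : HasDerivAt (fun s => (fderiv ℝ f (s, x)).comp (ContinuousLinearMap.inr ℝ ℝ X))
      ((fderiv ℝ (fderiv ℝ f) (t, x) (1, 0)).comp (ContinuousLinearMap.inr ℝ ℝ X)) t := by
    have := (hasDerivAt_slice_fst h2).clm_comp
      (hasDerivAt_const t (ContinuousLinearMap.inr ℝ ℝ X))
    simpa using this
  have d2 := (hasFDerivAt_slice_snd h2).clm_apply (hasFDerivAt_const ((1, 0) : ℝ × X) x)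
  rw [e2.fderiv_eq, d2.fderiv]
  refine (d1.congr_of_eventuallyEq e1).congr_deriv ?_
  ext u
  simp [ContDiffAt.fderiv_fderiv_comm hf (1, 0)]

end Parametric

/-! ### The energy density of a variation in coordinates -/

section LocalDensity

variable {n : ℕ} {U : Set (E n)} {G G' : E n → E n →L[ℝ] E n →L[ℝ] ℝ} {y : E n}

/-- The tension field of a map in coordinates. -/
def locTension (G G' : E n → E n →L[ℝ] E n →L[ℝ] ℝ) (ψ : E n → E n) (y : E n) : E n :=
  trG (G y) fun u v => sff (chr G) (chr G') ψ y u v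

/-- The squared norm of the tension field in coordinates. -/
def locDensity (G G' : E n → E n →L[ℝ] E n →L[ℝ] ℝ) (ψ : E n → E n) (y : E n) : ℝ :=
  G' (ψ y) (locTension G G' ψ y) (locTension G G' ψ y)

lemma contDiffAt_locDensity (h : MetOn U G) (h' : MetOn U G') {Ψ : ℝ × E n → E n} {t : ℝ}
    (hy : y ∈ U) (hΨy : Ψ (t, y) ∈ U) (hΨ : ContDiffAt ℝ ∞ Ψ (t, y)) :
    ContDiffAt ℝ ∞ (fun q : ℝ × E n => locDensity G G' (fun z => Ψ (q.1, z)) q.2) (t, y) := by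
  have h1 := contDiffAt_fderiv_snd hΨ
  have h2 := contDiffAt_fderiv_snd h1
  have hG : ContDiffAt ℝ ∞ (fun q : ℝ × E n => G q.2) (t, y) :=
    ContDiffAt.comp (g := G) (t, y) (h.smooth y hy) contDiffAt_snd
  have hΓ : ContDiffAt ℝ ∞ (fun q : ℝ × E n => chr G q.2) (t, y) :=
    ContDiffAt.comp (g := chr G) (t, y) (h.contDiffAt_chr hy) contDiffAt_snd
  have hG' : ContDiffAt ℝ ∞ (fun q : ℝ × E n => G' (Ψ q)) (t, y) :=
    ContDiffAt.comp (g := G') (t, y) (h'.smooth _ hΨy) hΨ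
  have hΓ' : ContDiffAt ℝ ∞ (fun q : ℝ × E n => chr G' (Ψ q)) (t, y) :=
    ContDiffAt.comp (g := chr G') (t, y) (h'.contDiffAt_chr hΨy) hΨ
  have hτ : ContDiffAt ℝ ∞ (fun q : ℝ × E n => locTension G G' (fun z => Ψ (q.1, z)) q.2)
      (t, y) := by
    unfold locTension trG
    refine ContDiffAt.sum fun i _ => ContDiffAt.sum fun j _ =>
      (contDiffAt_bmat_inv hG (h.met y hy) i j).smul ?_
    simp only [sff_apply]
    exact (((h2.clm_apply contDiffAt_const).clm_apply contDiffAt_const).sub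
      (h1.clm_apply ((hΓ.clm_apply contDiffAt_const).clm_apply contDiffAt_const))).add
      ((hΓ'.clm_apply (h1.clm_apply contDiffAt_const)).clm_apply (h1.clm_apply contDiffAt_const))
  exact (hG'.clm_apply hτ).clm_apply hτ

/-- At t = 0 the map is the identity near y, so its first derivative is the identity and its second
derivative is zero. The chain and product rules then collapse to `firstVar`, with time and space
derivatives interchanged. -/
lemma hasDerivAt_locDensity (h' : MetOn U G') {Ψ : ℝ × E n → E n}
    (hy : y ∈ U) (hΨ : ContDiffAt ℝ ∞ Ψ (0, y)) (h0 : ∀ᶠ z in 𝓝 y, Ψ (0, z) = z) :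
    HasDerivAt (fun t => locDensity G G' (fun z => Ψ (t, z)) y)
      (firstVar G G' (fun z => deriv (fun t => Ψ (t, z)) 0) y) 0 := by
  set V : E n → E n := fun z => deriv (fun t => Ψ (t, z)) 0 with hVdef
  have hy0 : Ψ (0, y) = y := h0.self_of_nhds
  have e0 : (fun z => Ψ (0, z)) =ᶠ[𝓝 y] fun z => z := h0
  have e1 : fderiv ℝ (fun z => Ψ (0, z)) =ᶠ[𝓝 y] fun _ => ContinuousLinearMap.id ℝ (E n) := by
    filter_upwards [e0.eventuallyEq_nhds] with z hz
    rw [hz.fderiv_eq]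
    exact fderiv_fun_id
  have hA0 : fderiv ℝ (fun z => Ψ (0, z)) y = ContinuousLinearMap.id ℝ (E n) := e1.self_of_nhds
  have hB0 : fderiv ℝ (fderiv ℝ (fun z => Ψ (0, z))) y = 0 := by
    rw [e1.fderiv_eq, fderiv_fun_const]
    rfl
  have hΨ0 : HasDerivAt (fun t => Ψ (t, y)) (V y) 0 :=
    (hasDerivAt_slice_fst (hΨ.differentiableAt (by simp))).differentiableAt.hasDerivAt
  have hA : HasDerivAt (fun t => fderiv ℝ (fun z => Ψ (t, z)) y) (fderiv ℝ V y) 0 :=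
    hasDerivAt_fderiv_slice (hΨ.of_le two_le_infty)
  have hB : HasDerivAt (fun t => fderiv ℝ (fderiv ℝ (fun z => Ψ (t, z))) y)
      (fderiv ℝ (fderiv ℝ V) y) 0 := by
    have h1 := hasDerivAt_fderiv_slice ((contDiffAt_fderiv_snd hΨ).of_le two_le_infty)
    have e2 : (fun z => deriv (fun s => fderiv ℝ (fun x => Ψ (s, x)) z) 0) =ᶠ[𝓝 y] fderiv ℝ V := by
      have hc : ContinuousAt (fun z : E n => ((0 : ℝ), z)) y := by fun_prop
      filter_upwards [hc.eventually ((hΨ.of_le two_le_infty).eventually (by simp))] with z hz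
      exact (hasDerivAt_fderiv_slice hz).deriv
    rw [← e2.fderiv_eq]
    exact h1
  have hchain : ∀ {Y : Type} [NormedAddCommGroup Y] [NormedSpace ℝ Y] (K : E n → Y),
      DifferentiableAt ℝ K y → HasDerivAt (fun t => K (Ψ (t, y))) (fderiv ℝ K y (V y)) 0 := by
    intro Y _ _ K hK
    have hK' : HasFDerivAt K (fderiv ℝ K y) (Ψ (0, y)) := by
      rw [hy0]
      exact hK.hasFDerivAt
    exact HasFDerivAt.comp_hasDerivAt (0 : ℝ) hK' hΨ0
  have hG' := hchain G' (h'.diff hy)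
  have hΓ' := hchain (chr G') ((h'.contDiffAt_chr hy).differentiableAt (by simp))
  have hS : ∀ u v, HasDerivAt (fun t => sff (chr G) (chr G') (fun z => Ψ (t, z)) y u v)
      (linSff (chr G) (chr G') V y u v) 0 := by
    intro u v
    simp only [sff_apply]
    have hAw : ∀ w, HasDerivAt (fun t => fderiv ℝ (fun z => Ψ (t, z)) y w) (fderiv ℝ V y w) 0 := by
      intro w
      have := hA.clm_apply (hasDerivAt_const (0 : ℝ) w)
      simpa using this
    have hBw : HasDerivAt (fun t => fderiv ℝ (fderiv ℝ (fun z => Ψ (t, z))) y u v)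
        (fderiv ℝ (fderiv ℝ V) y u v) 0 := by
      have := (hB.clm_apply (hasDerivAt_const (0 : ℝ) u)).clm_apply (hasDerivAt_const (0 : ℝ) v)
      simpa using this
    have := (hBw.fun_sub (hAw (chr G y u v))).fun_add ((hΓ'.clm_apply (hAw u)).clm_apply (hAw v))
    refine this.congr_deriv ?_
    rw [linSff, hA0, hy0]
    simp only [ContinuousLinearMap.id_apply, add_apply]
    abel
  have hτ : HasDerivAt (fun t => locTension G G' (fun z => Ψ (t, z)) y)
      (trG (G y) (fun u v => linSff (chr G) (chr G') V y u v)) 0 := by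
    unfold locTension trG
    exact HasDerivAt.fun_sum fun i _ => HasDerivAt.fun_sum fun j _ =>
      (hS (bv i) (bv j)).fun_const_smul _
  have hτ0 : locTension G G' (fun z => Ψ (0, z)) y
      = trG (G y) (fun u v => chr G' y u v - chr G y u v) := by
    refine trG_congr fun u v => ?_
    rw [sff_apply, hA0, hB0, hy0]
    simp only [ContinuousLinearMap.id_apply, zero_apply]
    abel
  have := (hG'.clm_apply hτ).clm_apply hτ
  refine this.congr_deriv ?_
  rw [hτ0, hy0, firstVar]
  simp only [add_apply]
  rw [(h'.met y hy).symm (trG (G y) fun u v => linSff (chr G) (chr G') V y u v)]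
  ring

end LocalDensity

/-! ### Preferred charts, transition maps and the metric in a chart -/

section Charts

variable {n : ℕ} {N : Type*} [TopologicalSpace N] [ChartedSpace (E n) N]

/-- The domain of coordinates of the preferred chart at `p`. -/
def dom (n : ℕ) {N : Type*} [TopologicalSpace N] [ChartedSpace (E n) N] (p : N) : Set (E n) :=
  (extChartAt (𝓡 n) p).target

/-- The change of coordinates from the preferred chart at `p` to the one at `q`. -/
def trans (p q : N) (y : E n) : E n := extChartAt (𝓡 n) q (pt p y)

lemma isOpen_dom (p : N) : IsOpen (dom n p) := isOpen_extChartAt_target p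

lemma pt_mem_source {p : N} {y : E n} (hy : y ∈ dom n p) :
    pt p y ∈ (extChartAt (𝓡 n) p).source := (extChartAt (𝓡 n) p).map_target hy

lemma chart_pt {p : N} {y : E n} (hy : y ∈ dom n p) : extChartAt (𝓡 n) p (pt p y) = y :=
  (extChartAt (𝓡 n) p).right_inv hy

lemma pt_chart {p x : N} (hx : x ∈ (extChartAt (𝓡 n) p).source) :
    pt p (extChartAt (𝓡 n) p x : E n) = x := (extChartAt (𝓡 n) p).left_inv hx

lemma chart_mem_dom {p x : N} (hx : x ∈ (extChartAt (𝓡 n) p).source) :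
    (extChartAt (𝓡 n) p x : E n) ∈ dom n p := (extChartAt (𝓡 n) p).map_source hx

lemma coordAt_mem_dom (x : N) : coordAt x ∈ dom n x := chart_mem_dom (mem_extChartAt_source x)

lemma pt_coordAt (x : N) : pt x (coordAt x : E n) = x := pt_chart (mem_extChartAt_source x)

lemma continuousAt_pt {p : N} {y : E n} (hy : y ∈ dom n p) : ContinuousAt (pt p) y :=
  continuousAt_extChartAt_symm'' hy

lemma eventually_mem_dom {p : N} {y : E n} (hy : y ∈ dom n p) : ∀ᶠ z in 𝓝 y, z ∈ dom n p :=
  (isOpen_dom p).mem_nhds hy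

lemma eventually_pt_mem_source {p q : N} {y : E n} (hy : y ∈ dom n p)
    (hq : pt p y ∈ (extChartAt (𝓡 n) q).source) :
    ∀ᶠ z in 𝓝 y, pt p z ∈ (extChartAt (𝓡 n) q).source :=
  (continuousAt_pt hy).eventually ((isOpen_extChartAt_source q).mem_nhds hq)

lemma trans_mem_dom {p q : N} {y : E n} (hq : pt p y ∈ (extChartAt (𝓡 n) q).source) :
    trans p q y ∈ dom n q := chart_mem_dom hq

lemma pt_trans {p q : N} {y : E n} (hq : pt p y ∈ (extChartAt (𝓡 n) q).source) :
    pt q (trans p q y) = pt p y := pt_chart hq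

lemma trans_self_at (p : N) (y : E n) : trans p (pt p y) y = coordAt (pt p y) := rfl

lemma trans_trans {p q : N} {y : E n} (hy : y ∈ dom n p)
    (hq : pt p y ∈ (extChartAt (𝓡 n) q).source) : trans q p (trans p q y) = y := by
  rw [trans, pt_trans hq, chart_pt hy]

variable [IsManifold (𝓡 n) ∞ N]

lemma contDiffAt_trans {p q : N} {y : E n} (hy : y ∈ dom n p)
    (hq : pt p y ∈ (extChartAt (𝓡 n) q).source) : ContDiffAt ℝ ∞ (trans p q) y := by
  have h := contDiffWithinAt_ext_coord_change (I := 𝓡 n) (n := ∞) q p (y := y) (by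
    rw [PartialEquiv.trans_source]
    exact ⟨hy, hq⟩)
  rw [ModelWithCorners.range_eq_univ, contDiffWithinAt_univ] at h
  exact h

lemma contMDiffAt_pt {p : N} {y : E n} (hy : y ∈ dom n p) :
    ContMDiffAt 𝓘(ℝ, E n) (𝓡 n) ∞ (pt p) y :=
  (contMDiffOn_extChartAt_symm p).contMDiffAt ((isOpen_dom p).mem_nhds hy)

/-- The differential of the parametrization, as an endomorphism of `ℝⁿ`. -/
def paramE (p : N) (y : E n) : E n →L[ℝ] E n := param p y

/-- A tangent vector at `pt p y` is stored by its components in the preferred chart at that very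
point, so the differential of the parametrization is the Jacobian of the transition into that chart.
-/
lemma paramE_eq {p : N} {y : E n} (hy : y ∈ dom n p) :
    paramE p y = fderiv ℝ (trans p (pt p y)) y := by
  have h1 : MDifferentiableAt 𝓘(ℝ, E n) (𝓡 n) (pt p) y :=
    (contMDiffAt_pt hy).mdifferentiableAt (by simp)
  have h2 : paramE p y = fderivWithin ℝ (writtenInExtChartAt 𝓘(ℝ, E n) (𝓡 n) y (pt p))
      (Set.range 𝓘(ℝ, E n)) (extChartAt 𝓘(ℝ, E n) y y) := h1.mfderiv
  rw [h2]
  simp only [writtenInExtChartAt, ModelWithCorners.range_eq_univ, fderivWithin_univ,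
    extChartAt_model_space_eq_id, PartialEquiv.refl_coe, PartialEquiv.refl_symm]
  rfl

/-- The chain rule for changes of coordinates. -/
lemma paramE_comp {p q : N} {y : E n} (hy : y ∈ dom n p)
    (hq : pt p y ∈ (extChartAt (𝓡 n) q).source) (u : E n) :
    paramE p y u = paramE q (trans p q y) (fderiv ℝ (trans p q) y u) := by
  have hx : pt q (trans p q y) = pt p y := pt_trans hq
  rw [paramE_eq hy, paramE_eq (trans_mem_dom hq), hx]
  have e : trans p (pt p y) =ᶠ[𝓝 y] fun z => trans q (pt p y) (trans p q z) := by
    filter_upwards [eventually_pt_mem_source hy hq] with z hz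
    rw [trans, trans, pt_trans hz]
  have h1 : DifferentiableAt ℝ (trans q (pt p y)) (trans p q y) :=
    (contDiffAt_trans (trans_mem_dom hq) (by rw [hx]; exact mem_extChartAt_source _)).differentiableAt
      (by simp)
  have h2 : DifferentiableAt ℝ (trans p q) y := (contDiffAt_trans hy hq).differentiableAt (by simp)
  rw [e.fderiv_eq, fderiv_fun_comp y h1 h2]
  rfl

/-- In the preferred chart at x the coordinate frame at x is the standard basis. Component formulas
evaluated at `coordAt x` are therefore formulas for the tangent vectors themselves. -/
lemma paramE_coordAt (x : N) : paramE x (coordAt x) = ContinuousLinearMap.id ℝ (E n) := by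
  rw [paramE_eq (coordAt_mem_dom x), pt_coordAt]
  have e : trans x x =ᶠ[𝓝 (coordAt x : E n)] fun z => z := by
    filter_upwards [eventually_mem_dom (coordAt_mem_dom x)] with z hz
    exact chart_pt hz
  rw [e.fderiv_eq]
  exact fderiv_fun_id

lemma paramE_injective {p : N} {y : E n} (hy : y ∈ dom n p) : Function.Injective (paramE p y) := by
  intro u v huv
  have h : ∀ w, fderiv ℝ (trans (pt p y) p) (coordAt (pt p y)) (paramE p y w) = w := by
    intro w
    have hs := mem_extChartAt_source (I := 𝓡 n) (pt p y)
    have e : (fun z => trans (pt p y) p (trans p (pt p y) z)) =ᶠ[𝓝 y] fun z => z := by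
      filter_upwards [eventually_mem_dom hy, eventually_pt_mem_source hy hs] with z hz hz2
      exact trans_trans hz hz2
    have h1 : DifferentiableAt ℝ (trans (pt p y) p) (trans p (pt p y) y) :=
      (contDiffAt_trans (trans_mem_dom hs) (by
        rw [pt_trans hs]; exact pt_mem_source hy)).differentiableAt (by simp)
    have h2 : DifferentiableAt ℝ (trans p (pt p y)) y :=
      (contDiffAt_trans hy hs).differentiableAt (by simp)
    have h3 := fderiv_fun_comp y h1 h2
    rw [e.fderiv_eq, fderiv_fun_id] at h3
    rw [paramE_eq hy]
    exact (congrArg (fun A : E n →L[ℝ] E n => A w) h3).symm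
  rw [← h u, ← h v, huv]

/-- The inner product at `x`, in the preferred chart at `x`. -/
def metE (h : RiemMetric n N) (x : N) : E n →L[ℝ] E n →L[ℝ] ℝ := h.inner x

/-- The metric in the preferred chart at `p`. -/
def metIn (h : RiemMetric n N) (p : N) (y : E n) : E n →L[ℝ] E n →L[ℝ] ℝ :=
  (metE h (pt p y)).bilinearComp (paramE p y) (paramE p y)

lemma metIn_apply (h : RiemMetric n N) (p : N) (y u v : E n) :
    metIn h p y u v = metE h (pt p y) (paramE p y u) (paramE p y v) := rfl

lemma metIn_coordAt (h : RiemMetric n N) (x : N) : metIn h x (coordAt x) = metE h x := by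
  ext u v
  rw [metIn_apply, paramE_coordAt, pt_coordAt]
  rfl

/-- Transition maps are isometries of the coordinate metrics; every later change of chart rests on
this. -/
lemma metIn_trans (h : RiemMetric n N) {p q : N} {y : E n} (hy : y ∈ dom n p)
    (hq : pt p y ∈ (extChartAt (𝓡 n) q).source) (u v : E n) :
    metIn h p y u v
      = metIn h q (trans p q y) (fderiv ℝ (trans p q) y u) (fderiv ℝ (trans p q) y v) := by
  rw [metIn_apply, metIn_apply, pt_trans hq, ← paramE_comp hy hq, ← paramE_comp hy hq]

lemma isMet_metIn (h : RiemMetric n N) {p : N} {y : E n} (hy : y ∈ dom n p) :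
    IsMet (metIn h p y) where
  symm u v := h.symm (pt p y) (paramE p y u) (paramE p y v)
  pos v hv := by
    have h0 : paramE p y v ≠ 0 := fun h0 => hv (paramE_injective hy (by rw [map_zero, h0]))
    exact h.pos (pt p y) (paramE p y v) h0

lemma contMDiffAt_coordVec {p : N} {y : E n} (hy : y ∈ dom n p) (v : E n) :
    ContMDiffAt 𝓘(ℝ, E n) ((𝓡 n).prod 𝓘(ℝ, E n)) ∞
      (fun z => Bundle.TotalSpace.mk' (E n) (E := TangentSpace (𝓡 n)) (pt p z) (param p z v)) y := by
  have h1 : ContMDiffOn 𝓘(ℝ, E n) (𝓡 n) ∞ (pt p) (dom n p) := contMDiffOn_extChartAt_symm p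
  have h2 := h1.contMDiffOn_tangentMapWithin (m := ∞) (by simp) (isOpen_dom p).uniqueMDiffOn
  have h3 : ContMDiffAt 𝓘(ℝ, E n) 𝓘(ℝ, E n).tangent ∞
      (fun z => (⟨z, v⟩ : TangentBundle 𝓘(ℝ, E n) (E n))) y :=
    contMDiffAt_vectorSpace_iff_contDiffAt.2 contDiffAt_const
  have h4 : ContMDiffWithinAt 𝓘(ℝ, E n) (𝓡 n).tangent ∞ (fun z => tangentMapWithin 𝓘(ℝ, E n) (𝓡 n)
      (pt p) (dom n p) (⟨z, v⟩ : TangentBundle 𝓘(ℝ, E n) (E n))) (dom n p) y :=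
    ContMDiffWithinAt.comp y (h2 ⟨y, v⟩ hy) h3.contMDiffWithinAt fun z hz => hz
  refine (h4.contMDiffAt ((isOpen_dom p).mem_nhds hy)).congr_of_eventuallyEq ?_
  filter_upwards [eventually_mem_dom hy] with z hz
  unfold tangentMapWithin param
  rw [mfderivWithin_of_isOpen (isOpen_dom p) hz]
  rfl

/-- Each matrix entry pairs the smooth section h with two smooth coordinate fields along `pt p`, and
a bilinear form depends smoothly on its entries. -/
lemma contDiffAt_metIn (h : RiemMetric n N) {p : N} {y : E n} (hy : y ∈ dom n p) :
    ContDiffAt ℝ ∞ (metIn h p) y := by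
  have hent : ∀ i j, ContDiffAt ℝ ∞ (fun z => metIn h p z (bv i) (bv j)) y := by
    intro i j
    have h1 := (h.contMDiff (pt p y)).comp y (contMDiffAt_pt hy)
    have h2 := ContMDiffAt.clm_bundle_apply₂ (F₁ := E n) (F₂ := E n) (F₃ := ℝ)
      (E₃ := fun _ : N => ℝ) h1 (contMDiffAt_coordVec hy (bv i)) (contMDiffAt_coordVec hy (bv j))
    rw [Bundle.contMDiffAt_totalSpace] at h2
    exact contMDiffAt_iff_contDiffAt.1 h2.2
  have e : metIn h p = fun z => ∑ i, ∑ j, metIn h p z (bv i) (bv j) •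
      ((EuclideanSpace.proj i : E n →L[ℝ] ℝ).smulRight (EuclideanSpace.proj j : E n →L[ℝ] ℝ)) := by
    funext z
    refine bil_ext fun i j => ?_
    simp [bv_apply]
  rw [e]
  exact ContDiffAt.sum fun i _ => ContDiffAt.sum fun j _ => (hent i j).smul contDiffAt_const

lemma metOn_metIn (h : RiemMetric n N) (p : N) : MetOn (dom n p) (metIn h p) where
  isOpen := isOpen_dom p
  smooth _ hy := contDiffAt_metIn h hy
  met _ hy := isMet_metIn h hy

/-- Changes of coordinates have vanishing second fundamental form. -/
lemma sff_trans (h : RiemMetric n N) {p q : N} {y : E n} (hy : y ∈ dom n p)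
    (hq : pt p y ∈ (extChartAt (𝓡 n) q).source) (u v : E n) :
    sff (chr (metIn h p)) (chr (metIn h q)) (trans p q) y u v = 0 := by
  refine sff_eq_zero_of_isometry (metOn_metIn h p) (metOn_metIn h q) hy (trans_mem_dom hq)
    ((contDiffAt_trans hy hq).of_le two_le_infty) ?_ u v
  filter_upwards [eventually_mem_dom hy, eventually_pt_mem_source hy hq] with z hz hz2 u v
  exact metIn_trans h hz hz2 u v

lemma christoffel_eq (h : RiemMetric n N) (p : N) (k i j : Fin n) (y : E n) :
    christoffel h p k i j y = chr (metIn h p) y (bv i) (bv j) k := by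
  rw [chr, bilOf_bv]
  rfl

lemma metIn_conformal (h : RiemMetric n N) (ρ : C^∞⟮𝓡 n, N; 𝓘(ℝ, ℝ), ℝ⟯) (p : N) :
    metIn (conformal h ρ) p = conf (fun y => ρ (pt p y)) (metIn h p) := rfl

end Charts

/-! ### The tension field in arbitrary charts -/

section Tension

variable {n : ℕ} {N : Type*} [TopologicalSpace N] [ChartedSpace (E n) N] [IsManifold (𝓡 n) ∞ N]

/-- The expression of a map in the preferred charts at `p` and `q`. -/
def mapIn (φ : N → N) (p q : N) (y : E n) : E n := extChartAt (𝓡 n) q (φ (pt p y))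

lemma pd_coord {ψ : E n → E n} {y : E n} (hψ : DifferentiableAt ℝ ψ y) (i c : Fin n) :
    pd i (fun z => ψ z c) y = fderiv ℝ ψ y (bv i) c := by
  have h := HasFDerivAt.comp (g := (EuclideanSpace.proj c : E n →L[ℝ] ℝ)) y
    (EuclideanSpace.proj c : E n →L[ℝ] ℝ).hasFDerivAt hψ.hasFDerivAt
  have h2 : fderiv ℝ (fun z => ψ z c) y = _ := h.fderiv
  rw [pd_eq, h2]
  rfl

lemma pd_pd_coord {ψ : E n → E n} {y : E n} (hψ : ContDiffAt ℝ 2 ψ y) (i j c : Fin n) :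
    pd i (pd j (fun z => ψ z c)) y = fderiv ℝ (fderiv ℝ ψ) y (bv i) (bv j) c := by
  have e : pd j (fun z => ψ z c) =ᶠ[𝓝 y] fun z => fderiv ℝ ψ z (bv j) c :=
    (ContDiffAt.eventually_differentiableAt (hψ.of_le one_le_two)).mono fun z hz => pd_coord hz j c
  have d := (ContDiffAt.differentiableAt_fderiv hψ).hasFDerivAt.clm_apply
    (hasFDerivAt_const (bv j) y)
  have h1 : pd i (pd j (fun z => ψ z c)) y = pd i (fun z => fderiv ℝ ψ z (bv j) c) y := by
    rw [pd_eq, e.fderiv_eq, pd_eq]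
  rw [h1, pd_coord d.differentiableAt, d.fderiv]
  simp

lemma tension_self (g h : RiemMetric n N) (φ : N → N) (x : N)
    (hφ : ContDiffAt ℝ 2 (mapIn φ x (φ x) : E n → E n) (coordAt x)) :
    (tension g h φ x : E n)
      = locTension (metIn g x) (metIn h (φ x)) (mapIn φ x (φ x)) (coordAt x) := by
  have hd := hφ.differentiableAt two_ne_zero
  have h0 : (mapIn φ x (φ x) (coordAt x) : E n) = coordAt (φ x) := by
    rw [mapIn, pt_coordAt]
    rfl
  have key : ∀ c i j, (sff (chr (metIn g x)) (chr (metIn h (φ x))) (mapIn φ x (φ x)) (coordAt x)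
        (bv i) (bv j)) c
      = pd i (pd j (mapComp φ x (φ x) c)) (coordAt x)
        - ∑ k, christoffel g x k i j (coordAt x) * pd k (mapComp φ x (φ x) c) (coordAt x)
        + ∑ a, ∑ b, christoffel h (φ x) c a b (coordAt (φ x)) *
          pd i (mapComp φ x (φ x) a) (coordAt x) * pd j (mapComp φ x (φ x) b) (coordAt x) := by
    intro c i j
    have hm : ∀ c, mapComp φ x (φ x) c = fun z : E n => mapIn φ x (φ x) z c := fun c => rfl
    simp only [hm, pd_pd_coord hφ, pd_coord hd, christoffel_eq]
    rw [sff_apply, PiLp.add_apply, PiLp.sub_apply, h0]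
    congr 1
    · congr 1
      rw [clm_eq_sum_bv (fderiv ℝ (mapIn φ x (φ x)) (coordAt x))]
      simp
    · rw [bil_eq_sum_bv (chr (metIn h (φ x)) (coordAt (φ x)))]
      simp only [WithLp.ofLp_sum, Finset.sum_apply, PiLp.smul_apply, smul_eq_mul]
      exact Finset.sum_congr rfl fun a _ => Finset.sum_congr rfl fun b _ => by ring
  refine PiLp.ext fun c => ?_
  have h1 : components (φ x) (tension g h φ x) c = ∑ i, ∑ j, gramInv g x i j (coordAt x) *
      (sff (chr (metIn g x)) (chr (metIn h (φ x))) (mapIn φ x (φ x)) (coordAt x)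
        (bv i) (bv j)) c := by
    simp only [key]
    rfl
  refine h1.trans ?_
  rw [locTension, trG]
  simp only [WithLp.ofLp_sum, Finset.sum_apply, PiLp.smul_apply, smul_eq_mul]
  rfl

/-- The tension field in arbitrary preferred charts. -/
lemma tension_eq (g h : RiemMetric n N) (φ : N → N) {p q : N} {y : E n} (hy : y ∈ dom n p)
    (hq : φ (pt p y) ∈ (extChartAt (𝓡 n) q).source) (hc : ContinuousAt φ (pt p y))
    (hφ : ContDiffAt ℝ ∞ (mapIn φ p q) y) :
    (tension g h φ (pt p y) : E n) = paramE q (mapIn φ p q y)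
      (locTension (metIn g p) (metIn h q) (mapIn φ p q) y) := by
  set x := pt p y with hx
  have hxs : x ∈ (extChartAt (𝓡 n) x).source := mem_extChartAt_source x
  have hφxs : φ x ∈ (extChartAt (𝓡 n) (φ x)).source := mem_extChartAt_source (φ x)
  have hptq : pt q (mapIn φ p q y) = φ x := pt_chart hq
  have hψdom : mapIn φ p q y ∈ dom n q := chart_mem_dom hq
  have hq' : pt q (mapIn φ p q y) ∈ (extChartAt (𝓡 n) (φ x)).source := by rw [hptq]; exact hφxs
  have hS := contDiffAt_trans hy hxs
  have hSy : (trans p x y : E n) = coordAt x := rfl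
  have hT := contDiffAt_trans hψdom hq'
  have hxy : (trans x p (coordAt x) : E n) = y := trans_trans hy hxs
  have hxp : pt x (coordAt x : E n) ∈ (extChartAt (𝓡 n) p).source := by
    rw [pt_coordAt]
    exact pt_mem_source hy
  have hR := contDiffAt_trans (coordAt_mem_dom x) hxp
  have ecx : ContinuousAt (fun z => φ (pt p z)) y :=
    ContinuousAt.comp (g := φ) (by exact hc) (continuousAt_pt hy)
  have eq : ∀ᶠ z in 𝓝 y, φ (pt p z) ∈ (extChartAt (𝓡 n) q).source :=
    ecx.eventually ((isOpen_extChartAt_source q).mem_nhds hq)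
  have hmap : ContDiffAt ℝ ∞ (mapIn φ x (φ x) : E n → E n) (coordAt x) := by
    have e1 : (mapIn φ x (φ x) : E n → E n) =ᶠ[𝓝 (coordAt x)]
        fun z => trans q (φ x) (mapIn φ p q (trans x p z)) := by
      have hRc : Filter.Tendsto (trans x p : E n → E n) (𝓝 (coordAt x)) (𝓝 y) := by
        have := hR.continuousAt.tendsto
        rwa [hxy] at this
      filter_upwards [eventually_pt_mem_source (coordAt_mem_dom x) hxp, hRc.eventually eq]
        with z hz hz2
      rw [mapIn, trans, mapIn, pt_chart hz2, pt_trans hz]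
    refine ContDiffAt.congr_of_eventuallyEq ?_ e1
    have h1 : ContDiffAt ℝ ∞ (mapIn φ p q) (trans x p (coordAt x : E n)) := by rwa [hxy]
    have h2 := h1.comp (coordAt x : E n) hR
    have h3 : ContDiffAt ℝ ∞ (trans q (φ x)) ((mapIn φ p q ∘ trans x p) (coordAt x : E n)) := by
      rwa [Function.comp_apply, hxy]
    exact h3.comp (coordAt x : E n) h2
  rw [tension_self g h φ x (hmap.of_le two_le_infty)]
  have e2 : (fun z => mapIn φ x (φ x) (trans p x z)) =ᶠ[𝓝 y]
      fun z => trans q (φ x) (mapIn φ p q z) := by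
    filter_upwards [eventually_pt_mem_source hy hxs, eq] with z hz hz2
    rw [mapIn, pt_trans hz, trans, mapIn, pt_chart hz2]
  have hmap2 : ContDiffAt ℝ 2 (mapIn φ x (φ x)) (trans p x y) := hmap.of_le two_le_infty
  -- The two composites in the commuting square `e2` are expanded by `sff_comp`; the transition maps
  -- contribute nothing, by `sff_trans`.
  have hsff : ∀ u v, sff (chr (metIn g x)) (chr (metIn h (φ x))) (mapIn φ x (φ x)) (coordAt x)
      (fderiv ℝ (trans p x) y u) (fderiv ℝ (trans p x) y v)
      = paramE q (mapIn φ p q y)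
        (sff (chr (metIn g p)) (chr (metIn h q)) (mapIn φ p q) y u v) := by
    intro u v
    have h1 := sff_comp (Γ := chr (metIn g p)) (chr (metIn g x)) (Γ'' := chr (metIn h (φ x))) hmap2
      (hS.of_le two_le_infty) u v
    have h2 := sff_comp (Γ := chr (metIn g p)) (chr (metIn h q)) (Γ'' := chr (metIn h (φ x)))
      (hT.of_le two_le_infty) (hφ.of_le two_le_infty) u v
    rw [sff_trans g hy hxs, map_zero, zero_add] at h1
    rw [sff_trans h hψdom hq', add_zero] at h2
    rw [paramE_eq hψdom, hptq, ← h2, ← hSy, ← h1]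
    have e3 : mapIn φ x (φ x) (trans p x y) = trans q (φ x) (mapIn φ p q y) := e2.self_of_nhds
    rw [sff_apply, sff_apply, e2.fderiv_eq, e2.fderiv.fderiv_eq, e3]
  rw [locTension, locTension, map_trG]
  simp only [← hsff]
  rw [← hSy]
  exact (trG_pull (isMet_metIn g hy) (fderiv ℝ (trans p x) y) (fun u v => metIn_trans g hy hxs u v)
    (sff (chr (metIn g x)) (chr (metIn h (φ x))) (mapIn φ x (φ x)) (trans p x y))).symm

/-- The squared norm of the tension field in arbitrary preferred charts. -/
lemma inner_tension_eq (g h : RiemMetric n N) (φ : N → N) {p q : N} {y : E n} (hy : y ∈ dom n p)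
    (hq : φ (pt p y) ∈ (extChartAt (𝓡 n) q).source) (hc : ContinuousAt φ (pt p y))
    (hφ : ContDiffAt ℝ ∞ (mapIn φ p q) y) :
    h.inner (φ (pt p y)) (tension g h φ (pt p y)) (tension g h φ (pt p y))
      = locDensity (metIn g p) (metIn h q) (mapIn φ p q) y := by
  have hptq : pt q (mapIn φ p q y) = φ (pt p y) := pt_chart hq
  change metE h (φ (pt p y)) (tension g h φ (pt p y) : E n) (tension g h φ (pt p y) : E n) = _
  rw [tension_eq g h φ hy hq hc hφ, locDensity, metIn_apply, hptq]

end Tension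

/-! ### Coordinate invariance of the scalar and one-form expressions -/

section Functions

variable {n : ℕ} {N : Type*} [TopologicalSpace N] [ChartedSpace (E n) N]

/-- The expression of a function in the preferred chart at `p`. -/
def inChart (f : N → ℝ) (p : N) (y : E n) : ℝ := f (pt p y)

/-- Functions which are smooth in all preferred charts. -/
def SmoothFun (n : ℕ) {N : Type*} [TopologicalSpace N] [ChartedSpace (E n) N] (f : N → ℝ) : Prop :=
  ∀ p : N, ∀ y ∈ dom n p, ContDiffAt ℝ ∞ (inChart f p : E n → ℝ) y

lemma inChart_trans (f : N → ℝ) {p q : N} {y : E n} (hy : y ∈ dom n p)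
    (hq : pt p y ∈ (extChartAt (𝓡 n) q).source) :
    (inChart f p : E n → ℝ) =ᶠ[𝓝 y] fun z => inChart f q (trans p q z : E n) := by
  filter_upwards [eventually_pt_mem_source hy hq] with z hz
  rw [inChart, inChart, pt_trans hz]

variable [IsManifold (𝓡 n) ∞ N]

lemma smoothFun_of_contMDiff {f : N → ℝ} (hf : ContMDiff (𝓡 n) 𝓘(ℝ, ℝ) ∞ f) : SmoothFun n f := by
  intro p y hy
  have h1 : ContMDiffAt 𝓘(ℝ, E n) 𝓘(ℝ, ℝ) ∞ (inChart f p : E n → ℝ) y :=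
    ContMDiffAt.comp (g := f) y (hf _) (contMDiffAt_pt hy)
  exact contMDiffAt_iff_contDiffAt.1 h1

lemma contMDiffAt_of_inChart {f : N → ℝ} {p : N} {y : E n} (hy : y ∈ dom n p)
    (hf : ContDiffAt ℝ ∞ (inChart f p : E n → ℝ) y) : ContMDiffAt (𝓡 n) 𝓘(ℝ, ℝ) ∞ f (pt p y) := by
  have hx := pt_mem_source hy
  have h1 : ContMDiffAt (𝓡 n) 𝓘(ℝ, E n) ∞ (extChartAt (𝓡 n) p) (pt p y) :=
    contMDiffAt_extChartAt' (by rwa [extChartAt_source] at hx)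
  have h2 : ContMDiffAt 𝓘(ℝ, E n) 𝓘(ℝ, ℝ) ∞ (inChart f p : E n → ℝ)
      (extChartAt (𝓡 n) p (pt p y)) := by
    rw [chart_pt hy]
    exact hf.contMDiffAt
  refine (h2.comp (pt p y) h1).congr_of_eventuallyEq ?_
  filter_upwards [(isOpen_extChartAt_source p).mem_nhds hx] with z hz
  rw [Function.comp_apply, inChart, pt_chart hz]

lemma dFun_pt {f : N → ℝ} {p : N} {y : E n} (hy : y ∈ dom n p)
    (hf : ContDiffAt ℝ ∞ (inChart f p : E n → ℝ) y) (w : E n) :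
    dFun f (pt p y) (param p y w) = fderiv ℝ (inChart f p : E n → ℝ) y w := by
  have h1 : MDifferentiableAt (𝓡 n) 𝓘(ℝ, ℝ) f (pt p y) :=
    (contMDiffAt_of_inChart hy hf).mdifferentiableAt (by simp)
  have h2 : MDifferentiableAt 𝓘(ℝ, E n) (𝓡 n) (pt p) y :=
    (contMDiffAt_pt hy).mdifferentiableAt (by simp)
  have h3 := mfderiv_comp y h1 h2
  rw [← mfderiv_eq_fderiv]
  exact (congrArg (fun A : E n →L[ℝ] ℝ => A w) h3).symm

lemma fderiv_inChart_trans {f : N → ℝ} {p q : N} (hf : SmoothFun n f) {y : E n} (hy : y ∈ dom n p)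
    (hq : pt p y ∈ (extChartAt (𝓡 n) q).source) (u : E n) :
    fderiv ℝ (inChart f p : E n → ℝ) y u
      = fderiv ℝ (inChart f q : E n → ℝ) (trans p q y) (fderiv ℝ (trans p q) y u) := by
  rw [(inChart_trans f hy hq).fderiv_eq, fderiv_fun_comp y
    ((hf q _ (trans_mem_dom hq)).differentiableAt (by simp))
    ((contDiffAt_trans hy hq).differentiableAt (by simp))]
  rfl

lemma hess_trans (h : RiemMetric n N) {f : N → ℝ} {p q : N} (hf : SmoothFun n f) {y : E n}
    (hy : y ∈ dom n p) (hq : pt p y ∈ (extChartAt (𝓡 n) q).source) (u v : E n) :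
    hess (metIn h p) (inChart f p) y u v = hess (metIn h q) (inChart f q) (trans p q y)
      (fderiv ℝ (trans p q) y u) (fderiv ℝ (trans p q) y v) := by
  have e := inChart_trans f hy hq
  have h1 := sff_comp (Γ := chr (metIn h p)) (chr (metIn h q)) (Γ'' := fun _ => 0)
    ((hf q _ (trans_mem_dom hq)).of_le two_le_infty) ((contDiffAt_trans hy hq).of_le two_le_infty)
    u v
  rw [sff_trans h hy hq, map_zero, zero_add] at h1
  rw [hess, hess, ← h1, sff_apply, sff_apply, e.fderiv_eq, e.fderiv.fderiv_eq]

lemma lap_trans (h : RiemMetric n N) {f : N → ℝ} {p q : N} (hf : SmoothFun n f) {y : E n}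
    (hy : y ∈ dom n p) (hq : pt p y ∈ (extChartAt (𝓡 n) q).source) :
    lap (metIn h p) (inChart f p) y = lap (metIn h q) (inChart f q) (trans p q y) := by
  rw [lap, lap]
  simp only [hess_trans h hf hy hq]
  exact trG_pull (isMet_metIn h hy) _ (fun u v => metIn_trans h hy hq u v) _

lemma nsq_trans (h : RiemMetric n N) {f : N → ℝ} {p q : N} (hf : SmoothFun n f) {y : E n}
    (hy : y ∈ dom n p) (hq : pt p y ∈ (extChartAt (𝓡 n) q).source) :
    nsq (metIn h p) (inChart f p) y = nsq (metIn h q) (inChart f q) (trans p q y) := by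
  rw [nsq, nsq]
  simp only [fderiv_inChart_trans hf hy hq]
  exact trG_pull (isMet_metIn h hy) _ (fun u v => metIn_trans h hy hq u v)
    (tsq (fderiv ℝ (inChart f q) (trans p q y)))

/-- Naturality of the curvature differentiates the second fundamental form of the transition map
once, so its vanishing is needed on a neighbourhood and not only at y. -/
lemma ricT_trans (h : RiemMetric n N) {f : N → ℝ} {p q : N} (hf : SmoothFun n f) {y : E n}
    (hy : y ∈ dom n p) (hq : pt p y ∈ (extChartAt (𝓡 n) q).source) (w : E n) :
    ricT (metIn h p) (inChart f p) y w
      = ricT (metIn h q) (inChart f q) (trans p q y) (fderiv ℝ (trans p q) y w) := by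
  have h0 : ∀ᶠ z in 𝓝 y, ∀ u v, sff (chr (metIn h p)) (chr (metIn h q)) (trans p q) z u v = 0 := by
    filter_upwards [eventually_mem_dom hy, eventually_pt_mem_source hy hq] with z hz hz2 u v
    exact sff_trans h hz hz2 u v
  have hc := curv_map ((contDiffAt_trans hy hq).of_le three_le_infty)
    (((metOn_metIn h p).contDiffAt_chr hy).differentiableAt (by simp))
    (((metOn_metIn h q).contDiffAt_chr (trans_mem_dom hq)).differentiableAt (by simp)) h0
  rw [ricT, ricT]
  simp only [fderiv_inChart_trans hf hy hq, hc]
  congr 1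
  exact trG_pull (isMet_metIn h hy) _ (fun u v => metIn_trans h hy hq u v)
    ((ContinuousLinearMap.compL ℝ (E n) (E n) ℝ (fderiv ℝ (inChart f q) (trans p q y))).comp
      (curv (chr (metIn h q)) (trans p q y) (fderiv ℝ (trans p q) y w)))

lemma fderiv_of_trans {p q : N} {F F' : E n → ℝ} {y : E n} (hy : y ∈ dom n p)
    (hq : pt p y ∈ (extChartAt (𝓡 n) q).source) (hF : DifferentiableAt ℝ F' (trans p q y))
    (h : ∀ z ∈ dom n p, pt p z ∈ (extChartAt (𝓡 n) q).source → F z = F' (trans p q z)) (w : E n) :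
    fderiv ℝ F y w = fderiv ℝ F' (trans p q y) (fderiv ℝ (trans p q) y w) := by
  have e : F =ᶠ[𝓝 y] fun z => F' (trans p q z) := by
    filter_upwards [eventually_mem_dom hy, eventually_pt_mem_source hy hq] with z hz hz2
    exact h z hz hz2
  rw [e.fderiv_eq, fderiv_fun_comp y hF ((contDiffAt_trans hy hq).differentiableAt (by simp))]
  rfl

/-- The Euler–Lagrange form does not depend on coordinates. -/
lemma eulerForm_trans (h : RiemMetric n N) {f : N → ℝ} {p q : N} (hf : SmoothFun n f) {y : E n}
    (hy : y ∈ dom n p) (hq : pt p y ∈ (extChartAt (𝓡 n) q).source) (w : E n) :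
    eulerForm (metIn h p) (inChart f p) y w
      = eulerForm (metIn h q) (inChart f q) (trans p q y) (fderiv ℝ (trans p q) y w) := by
  have hT := trans_mem_dom hq
  rw [eulerForm, eulerForm, lap_trans h hf hy hq, nsq_trans h hf hy hq, ricT_trans h hf hy hq,
    fderiv_inChart_trans hf hy hq,
    fderiv_of_trans hy hq (((metOn_metIn h q).contDiffAt_lap hT (hf q _ hT)).differentiableAt
      (by simp)) fun z hz hz2 => lap_trans h hf hz hz2,
    fderiv_of_trans hy hq (((metOn_metIn h q).contDiffAt_nsq hT (hf q _ hT)).differentiableAt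
      (by simp)) fun z hz hz2 => nsq_trans h hf hz hz2]

end Functions

/-! ### The global operators identified with their coordinate expressions -/

section Operators

variable {n : ℕ} {N : Type*} [TopologicalSpace N] [ChartedSpace (E n) N] [IsManifold (𝓡 n) ∞ N]
  {f : N → ℝ}

lemma dFun_apply (hf : SmoothFun n f) (x : N) (w : E n) :
    dFun (n := n) f x (w : E n) = fderiv ℝ (inChart f x : E n → ℝ) (coordAt x) w := by
  have h1 := dFun_pt (coordAt_mem_dom x) (hf x _ (coordAt_mem_dom x)) w
  rw [← h1]
  have h2 : param x (coordAt x : E n) w = (w : E n) :=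
    congrArg (fun A : E n →L[ℝ] E n => A w) (paramE_coordAt (n := n) x)
  rw [h2]
  congr 1
  exact (pt_coordAt (n := n) x).symm ▸ rfl

lemma coeffOne_dFun (hf : SmoothFun n f) {p : N} {y : E n} (hy : y ∈ dom n p) (j : Fin n) :
    coeffOne (dFun f) p j y = fderiv ℝ (inChart f p : E n → ℝ) y (bv j) :=
  dFun_pt hy (hf p y hy) (bv j)

lemma pd_coeffOne_dFun (hf : SmoothFun n f) {p : N} {y : E n} (hy : y ∈ dom n p) (i j : Fin n) :
    pd i (coeffOne (dFun f) p j) y = fderiv ℝ (fderiv ℝ (inChart f p : E n → ℝ)) y (bv i) (bv j) := by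
  have e : coeffOne (dFun f) p j =ᶠ[𝓝 y] fun z => fderiv ℝ (inChart f p : E n → ℝ) z (bv j) := by
    filter_upwards [eventually_mem_dom hy] with z hz
    exact coeffOne_dFun hf hz j
  have d := (ContDiffAt.differentiableAt_fderiv
    ((hf p y hy).of_le two_le_infty)).hasFDerivAt.clm_apply (hasFDerivAt_const (bv j) y)
  rw [pd_eq, e.fderiv_eq, d.fderiv]
  simp

lemma codiffOne_self (h : RiemMetric n N) (hf : SmoothFun n f) (x : N) :
    codiffOne h (dFun f) x = -lap (metIn h x) (inChart f x) (coordAt x) := by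
  have hy := coordAt_mem_dom (n := n) x
  rw [codiffOne, lap, trG]
  congr 1
  refine Finset.sum_congr rfl fun i _ => Finset.sum_congr rfl fun j _ => ?_
  rw [pd_coeffOne_dFun hf hy, hess_apply, clm_eq_sum_bv (fderiv ℝ (inChart f x) (coordAt x))]
  simp only [coeffOne_dFun hf hy, christoffel_eq, smul_eq_mul]
  rfl

/-- The codifferential is defined with a different chart at each point, whereas its differential
requires one fixed chart; the invariance of `lap` bridges the two. `normSq_pt` plays the same part
for the norm. -/
lemma codiffOne_pt (h : RiemMetric n N) (hf : SmoothFun n f) {p : N} {y : E n} (hy : y ∈ dom n p) :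
    codiffOne h (dFun f) (pt p y) = -lap (metIn h p) (inChart f p) y := by
  rw [codiffOne_self h hf, lap_trans h hf hy (mem_extChartAt_source (pt p y))]
  rfl

lemma sharp_eq (h : RiemMetric n N) (hf : SmoothFun n f) (x : N) :
    sharp h x (dFun (n := n) f x)
      = gradG (metIn h x (coordAt x)) (fderiv ℝ (inChart f x) (coordAt x)) := by
  refine PiLp.ext fun i => ?_
  rw [gradG_apply]
  simp only [← dFun_apply hf]
  rfl

lemma normSq_self (h : RiemMetric n N) (hf : SmoothFun n f) (x : N) :
    normSq h (dFun f) x = nsq (metIn h x) (inChart f x) (coordAt x) := by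
  rw [normSq, sharp_eq h hf, nsq_eq (isMet_metIn h (coordAt_mem_dom x))]
  exact dFun_apply hf x _

lemma normSq_pt (h : RiemMetric n N) (hf : SmoothFun n f) {p : N} {y : E n} (hy : y ∈ dom n p) :
    normSq h (dFun f) (pt p y) = nsq (metIn h p) (inChart f p) y := by
  rw [normSq_self h hf, nsq_trans h hf hy (mem_extChartAt_source (pt p y))]
  rfl

/-- Second derivatives are symmetric, so d² = 0. Hence the summand d*d of the Hodge Laplacian drops
out, and Δ(df) = −d(lap f). -/
lemma dOne_dFun (hf : SmoothFun n f) (x : N) : dOne (dFun (n := n) f) x = 0 := by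
  have hy := coordAt_mem_dom (n := n) x
  have e : pullback (dFun f) x =ᶠ[𝓝 (coordAt x : E n)] fderiv ℝ (inChart f x) := by
    filter_upwards [eventually_mem_dom hy] with z hz
    ext w
    exact dFun_pt hz (hf x z hz) w
  unfold dOne
  rw [e.fderiv_eq]
  refine ContinuousLinearMap.ext fun (u : E n) => ContinuousLinearMap.ext fun (v : E n) => ?_
  change fderiv ℝ (fderiv ℝ (inChart f x)) (coordAt x) u v
    - fderiv ℝ (fderiv ℝ (inChart f x)) (coordAt x) v u = 0
  rw [ContDiffAt.fderiv_fderiv_comm ((hf x _ hy).of_le two_le_infty), sub_self]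

lemma codiffTwo_dOne_dFun (h : RiemMetric n N) (hf : SmoothFun n f) (x : N) :
    codiffTwo h (dOne (dFun (n := n) f)) x = 0 := by
  have h0 : ∀ p i j, coeffTwo (dOne (dFun (n := n) f)) p i j = fun _ => 0 := by
    intro p i j
    funext y
    rw [coeffTwo, dOne_dFun hf]
    rfl
  unfold codiffTwo covectorOfComponents
  simp [h0, pd]
  rfl

lemma hodgeLaplacian_apply (h : RiemMetric n N) (hf : SmoothFun n f) (x : N) (w : E n) :
    hodgeLaplacian h (dFun f) x (w : E n)
      = -fderiv ℝ (lap (metIn h x) (inChart f x)) (coordAt x) w := by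
  have hs : SmoothFun n (codiffOne h (dFun (n := n) f)) := by
    intro p y hy
    refine ((metOn_metIn h p).contDiffAt_lap hy (hf p y hy)).neg.congr_of_eventuallyEq ?_
    filter_upwards [eventually_mem_dom hy] with z hz
    exact codiffOne_pt h hf hz
  have e : (inChart (codiffOne h (dFun f)) x : E n → ℝ) =ᶠ[𝓝 (coordAt x)]
      fun z => -lap (metIn h x) (inChart f x) z := by
    filter_upwards [eventually_mem_dom (coordAt_mem_dom x)] with z hz
    exact codiffOne_pt h hf hz
  unfold hodgeLaplacian
  rw [codiffTwo_dOne_dFun h hf, add_zero, dFun_apply hs, e.fderiv_eq, fderiv_fun_neg]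
  rfl

lemma dFun_normSq_apply (h : RiemMetric n N) (hf : SmoothFun n f) (x : N) (w : E n) :
    dFun (normSq h (dFun (n := n) f)) x (w : E n)
      = fderiv ℝ (nsq (metIn h x) (inChart f x)) (coordAt x) w := by
  have hs : SmoothFun n (normSq h (dFun (n := n) f)) := by
    intro p y hy
    refine ((metOn_metIn h p).contDiffAt_nsq hy (hf p y hy)).congr_of_eventuallyEq ?_
    filter_upwards [eventually_mem_dom hy] with z hz
    exact normSq_pt h hf hz
  have e : (inChart (normSq h (dFun f)) x : E n → ℝ) =ᶠ[𝓝 (coordAt x)]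
      nsq (metIn h x) (inChart f x) := by
    filter_upwards [eventually_mem_dom (coordAt_mem_dom x)] with z hz
    exact normSq_pt h hf hz
  rw [dFun_apply hs, e.fderiv_eq]

/-- The curvature as a linear map in its second argument. -/
def curvLin (Γ : E n → E n →L[ℝ] E n →L[ℝ] E n) (y u v : E n) : E n →L[ℝ] E n :=
  (fderiv ℝ Γ y u).flip v - ((fderiv ℝ Γ y).flip u).flip v + (Γ y u).comp ((Γ y).flip v)
    - (Γ y).flip (Γ y u v)

lemma curvLin_apply (Γ : E n → E n →L[ℝ] E n →L[ℝ] E n) (y u v w : E n) :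
    curvLin Γ y u v w = curv Γ y w u v := rfl

/-- `curv Γ y w u v` stands for R(u, w)v, so the two plane indices i and j appear exchanged. -/
lemma curvature_eq (h : RiemMetric n N) {p : N} {y : E n} (hy : y ∈ dom n p) (l k i j : Fin n) :
    curvature h p l k i j y = curv (chr (metIn h p)) y (bv j) (bv i) (bv k) l := by
  have hd : DifferentiableAt ℝ (chr (metIn h p)) y :=
    ((metOn_metIn h p).contDiffAt_chr hy).differentiableAt (by simp)
  have h1 : ∀ i j k l, pd i (christoffel h p l j k) y
      = fderiv ℝ (chr (metIn h p)) y (bv i) (bv j) (bv k) l := by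
    intro i j k l
    have e : christoffel h p l j k = fun z => chr (metIn h p) z (bv j) (bv k) l := by
      funext z
      exact christoffel_eq h p l j k z
    have hd2 := (hd.hasFDerivAt.clm_apply (hasFDerivAt_const (bv j) y)).clm_apply
      (hasFDerivAt_const (bv k) y)
    rw [e, pd_coord hd2.differentiableAt, hd2.fderiv]
    simp
  have h2 : ∀ a b c l, (chr (metIn h p) y a (chr (metIn h p) y b c)) l
      = ∑ m, chr (metIn h p) y b c m * chr (metIn h p) y a (bv m) l := by
    intro a b c l
    rw [clm_eq_sum_bv (chr (metIn h p) y a)]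
    simp
  rw [curvature, h1, h1, curv_apply]
  simp only [PiLp.add_apply, PiLp.sub_apply, h2, christoffel_eq, Finset.sum_sub_distrib]
  rw [add_sub_assoc]
  congr 2
  · exact Finset.sum_congr rfl fun m _ => mul_comm _ _
  · exact Finset.sum_congr rfl fun m _ => mul_comm _ _

/-- Ric(w, v) is the trace of u ↦ R(u, w)v. Written as a metric trace with v = grad f, the
skew-symmetry of the curvature moves v into the other slot, where pairing with it becomes df; this
accounts for the sign in `ricT`. -/
lemma flat_ricci_apply (h : RiemMetric n N) (hf : SmoothFun n f) (x : N) (w : E n) :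
    flat h x (ricci h x (sharp h x (dFun (n := n) f x))) (w : E n)
      = ricT (metIn h x) (inChart f x) (coordAt x) w := by
  have hy := coordAt_mem_dom (n := n) x
  have hm := isMet_metIn h hy
  set B := metIn h x (coordAt x) with hB
  set Γ := chr (metIn h x) with hΓ
  set y : E n := coordAt x with hyy
  set θ := fderiv ℝ (inChart f x : E n → ℝ) y with hθ
  set v : E n := gradG B θ with hv
  have hsharp : sharp h x (dFun (n := n) f x) = (v : E n) := sharp_eq h hf x
  -- κ is the covector w ↦ Ric(w, v); raising its index yields the Ricci operator applied to v.
  let κ : E n →L[ℝ] ℝ := ∑ i, (EuclideanSpace.proj i : E n →L[ℝ] ℝ).comp (curvLin Γ y (bv i) v)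
  have hκ : ∀ w, κ w = ∑ i, curv Γ y w (bv i) v i := by
    intro w
    simp [κ, curvLin_apply]
  have hric : ∀ j, ∑ k, ricciCoord h x j k y * v k = κ (bv j) := by
    intro j
    rw [hκ]
    simp only [ricciCoord, curvature_eq h hy, Finset.sum_mul]
    rw [Finset.sum_comm]
    refine Finset.sum_congr rfl fun i _ => ?_
    rw [clm_eq_sum_bv (curv Γ y (bv j) (bv i))]
    simp [mul_comm, hΓ]
  have hr : ricci h x (v : E n) = gradG B κ := by
    refine PiLp.ext fun i => ?_
    rw [gradG_apply]
    simp only [← hric, Finset.mul_sum, ← mul_assoc]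
    rfl
  have h1 : flat h x (ricci h x (v : E n)) (w : E n) = κ w := by
    rw [hr, ← hm.apply_gradG κ w, hB, metIn_coordAt]
    rfl
  rw [hsharp, h1, hκ]
  have h2 := hm.trG_apply_clm ((curv Γ y w).flip v)
  simp only [ContinuousLinearMap.flip_apply] at h2
  rw [← h2, hm.trG_swap, ricT, ← trG_neg]
  refine trG_congr fun a b => ?_
  rw [hm.symm, (metOn_metIn h x).curv_skew hy, ← hB, hv, hm.apply_gradG]

/-- The left-hand side of the biharmonicity equation. -/
def bihForm (h : RiemMetric n N) (f : N → ℝ) : OneForm n N := fun x =>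
  -hodgeLaplacian h (dFun f) x
    + ((6 - (n : ℝ)) / 2) • dFun (normSq h (dFun f)) x
    + (2 * codiffOne h (dFun f) x + (2 - (n : ℝ)) * normSq h (dFun f) x) • dFun f x
    + (2 : ℝ) • flat h x (ricci h x (sharp h x (dFun f x)))

lemma bihForm_apply (h : RiemMetric n N) (hf : SmoothFun n f) (x : N) (w : E n) :
    bihForm h f x (w : E n) = eulerForm (metIn h x) (inChart f x) (coordAt x) w := by
  change -hodgeLaplacian h (dFun f) x (w : E n)
      + ((6 - (n : ℝ)) / 2) * dFun (normSq h (dFun f)) x (w : E n)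
      + (2 * codiffOne h (dFun f) x + (2 - (n : ℝ)) * normSq h (dFun f) x) * dFun f x (w : E n)
      + (2 : ℝ) * flat h x (ricci h x (sharp h x (dFun f x))) (w : E n) = _
  rw [hodgeLaplacian_apply h hf, dFun_normSq_apply h hf, codiffOne_self h hf, normSq_self h hf,
    dFun_apply hf, flat_ricci_apply h hf, eulerForm]
  ring

/-- The equation at x refers only to the centre of the preferred chart at x. Invariance of
`eulerForm` spreads it over each whole chart, where it can be integrated. -/
lemma bihForm_eq_zero_iff (h : RiemMetric n N) (hf : SmoothFun n f) :
    (∀ x : N, bihForm h f x = 0)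
      ↔ ∀ p : N, ∀ y ∈ dom n p, ∀ w, eulerForm (metIn h p) (inChart f p) y w = 0 := by
  constructor
  · intro H p y hy w
    rw [eulerForm_trans h hf hy (mem_extChartAt_source (pt p y)), trans_self_at,
      ← bihForm_apply h hf, H]
    rfl
  · intro H x
    refine ContinuousLinearMap.ext fun (w : E n) => ?_
    exact (bihForm_apply h hf x w).trans (H x _ (coordAt_mem_dom x) w)

end Operators

/-! ### The Riemannian volume measure in a chart -/

section Volume

open MeasureTheory Set

variable {n : ℕ} {N : Type*} [TopologicalSpace N] [ChartedSpace (E n) N]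

lemma measurableSet_preimage_pt [MeasurableSpace N] [BorelSpace N] (p : N) {S : Set N}
    (hS : MeasurableSet S) : MeasurableSet (pt p ⁻¹' S ∩ dom n p) := by
  have h1 : ContinuousOn (pt p) (dom n p) := fun y hy => (continuousAt_pt hy).continuousWithinAt
  have h2 : Measurable ((dom n p).domRestrict (pt p)) := h1.domRestrict.measurable
  have h3 := MeasurableSet.subtype_image (isOpen_dom p).measurableSet (h2 hS)
  convert h3 using 1
  ext y
  simp [and_comm, Set.domRestrict]

lemma aemeasurable_pt [MeasurableSpace N] [BorelSpace N] (p : N) (d : E n → ENNReal) :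
    AEMeasurable (pt p) ((volume.restrict (dom n p)).withDensity d) := by
  have h1 : ContinuousOn (pt p) (dom n p) := fun y hy => (continuousAt_pt hy).continuousWithinAt
  exact (h1.aemeasurable (isOpen_dom p).measurableSet).mono_ac (withDensity_absolutelyContinuous _ _)

lemma map_pt_apply [MeasurableSpace N] [BorelSpace N] (p : N) (d : E n → ENNReal) {S : Set N}
    (hS : MeasurableSet S) :
    (((volume.restrict (dom n p)).withDensity d).map (pt p)) S
      = ∫⁻ y in pt p ⁻¹' S ∩ dom n p, d y := by
  rw [Measure.map_apply_of_aemeasurable (aemeasurable_pt p d) hS, withDensity_apply',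
    Measure.restrict_restrict' (isOpen_dom p).measurableSet]

variable [IsManifold (𝓡 n) ∞ N]

/-- The volume density in the preferred chart at `p`. -/
def volDensity (h : RiemMetric n N) (p : N) (y : E n) : ℝ := √(bmat (metIn h p y)).det

lemma contDiffAt_volDensity (h : RiemMetric n N) {p : N} {y : E n} (hy : y ∈ dom n p) :
    ContDiffAt ℝ ∞ (volDensity h p) y :=
  contDiffAt_sqrt_det (contDiffAt_metIn h hy) (isMet_metIn h hy)

lemma volDensity_pos (h : RiemMetric n N) {p : N} {y : E n} (hy : y ∈ dom n p) :
    0 < volDensity h p y := Real.sqrt_pos.2 (isMet_metIn h hy).det_pos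

lemma volDensity_nonneg (h : RiemMetric n N) (p : N) (y : E n) : 0 ≤ volDensity h p y :=
  Real.sqrt_nonneg _

/-- Change of variables between two charts. -/
lemma lintegral_chart_eq [MeasurableSpace N] [BorelSpace N] (h : RiemMetric n N) (p q : N)
    (u : N → ℝ) {S : Set N} (hS : MeasurableSet S)
    (hq : S ⊆ (extChartAt (𝓡 n) q).source) (hp : S ⊆ (extChartAt (𝓡 n) p).source) :
    ∫⁻ y in pt p ⁻¹' S ∩ dom n p, ENNReal.ofReal (u (pt p y) * volDensity h p y)
      = ∫⁻ y in pt q ⁻¹' S ∩ dom n q, ENNReal.ofReal (u (pt q y) * volDensity h q y) := by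
  have him : pt p ⁻¹' S ∩ dom n p = trans q p '' (pt q ⁻¹' S ∩ dom n q) := by
    ext y
    constructor
    · rintro ⟨h1, h2⟩
      have h3 := hq h1
      refine ⟨trans p q y, ⟨?_, trans_mem_dom h3⟩, trans_trans h2 h3⟩
      rw [mem_preimage, pt_trans h3]
      exact h1
    · rintro ⟨z, ⟨h1, h2⟩, rfl⟩
      refine ⟨?_, trans_mem_dom (hp h1)⟩
      rw [mem_preimage, pt_trans (hp h1)]
      exact h1
  rw [him, lintegral_image_eq_lintegral_abs_det_fderiv_mul volume (measurableSet_preimage_pt q hS)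
    (f' := fun y => fderiv ℝ (trans q p) y)]
  · refine setLIntegral_congr_fun (measurableSet_preimage_pt q hS) fun y hy => ?_
    have h1 := sqrt_det_pull (fderiv ℝ (trans q p) y)
      fun a b => metIn_trans h hy.2 (hp hy.1) a b
    rw [← ENNReal.ofReal_mul (abs_nonneg _), pt_trans (hp hy.1)]
    congr 1
    rw [volDensity, volDensity, h1]
    ring
  · intro y hy
    exact ((contDiffAt_trans hy.2 (hp hy.1)).differentiableAt
      (by simp)).hasFDerivAt.hasFDerivWithinAt
  · intro y hy z hz hyz
    rw [← trans_trans hy.2 (hp hy.1), hyz, trans_trans hz.2 (hp hz.1)]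

variable [T2Space N] [SigmaCompactSpace N]

lemma tsupport_chartPartition (p : N) :
    tsupport (chartPartition n N p) ⊆ (extChartAt (𝓡 n) p).source := by
  rw [extChartAt_source]
  exact (SmoothPartitionOfUnity.exists_isSubordinate_chartAt_source (𝓡 n) N).choose_spec p

lemma tsum_chartPartition (x : N) : ∑' p, ENNReal.ofReal (chartPartition n N p x) = 1 := by
  have h1 := (chartPartition n N).sum_finsupport x (mem_univ x)
  rw [tsum_eq_sum (s := (chartPartition n N).finsupport x), ← ENNReal.ofReal_sum_of_nonneg, h1,
    ENNReal.ofReal_one]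
  · exact fun p _ => (chartPartition n N).nonneg p x
  · intro p hp
    rw [SmoothPartitionOfUnity.mem_finsupport, Function.mem_support, not_not] at hp
    rw [hp, ENNReal.ofReal_zero]

-- The volume measure is a sum over all points of N. Local finiteness and σ-compactness leave only
-- countably many nonzero terms, as the interchange of sum and integral requires.
variable (n N) in
lemma countable_chartPartition : {p : N | chartPartition n N p ≠ 0}.Countable := by
  have h1 : LocallyFinite fun p : {p : N | chartPartition n N p ≠ 0} =>
      Function.support (chartPartition n N p) :=
    (chartPartition n N).locallyFinite.comp_injective Subtype.val_injective
  have h2 := h1.countable_univ fun p => by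
    rw [Function.support_nonempty_iff]
    intro h0
    exact p.2 (ContMDiffMap.coe_injective h0)
  exact (Set.countable_univ_iff.1 h2).to_set

variable [MeasurableSpace N] [BorelSpace N]

/-- Change of variables carries each term of the defining sum into the chart at q; there the
partition functions add up to 1, so the choice of partition disappears. -/
lemma volumeMeasure_apply (h : RiemMetric n N) {q : N} {S : Set N} (hS : MeasurableSet S)
    (hq : S ⊆ (extChartAt (𝓡 n) q).source) :
    volumeMeasure h S = ∫⁻ y in pt q ⁻¹' S ∩ dom n q, ENNReal.ofReal (volDensity h q y) := by
  have hterm : ∀ p : N, (((volume.restrict (dom n p)).withDensity fun y : E n =>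
      ENNReal.ofReal (chartPartition n N p (pt p y) * √(gram h p y).det)).map (pt p)) S
      = ∫⁻ y in pt q ⁻¹' S ∩ dom n q,
        ENNReal.ofReal (chartPartition n N p (pt q y) * volDensity h q y) := by
    intro p
    have hS' : MeasurableSet (S ∩ (extChartAt (𝓡 n) p).source) :=
      hS.inter (isOpen_extChartAt_source p).measurableSet
    have h1 := lintegral_chart_eq h p q (chartPartition n N p) hS'
      (inter_subset_left.trans hq) inter_subset_right
    rw [map_pt_apply p _ hS]
    have h2 : pt p ⁻¹' (S ∩ (extChartAt (𝓡 n) p).source) ∩ dom n p = pt p ⁻¹' S ∩ dom n p := by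
      ext y
      simp only [mem_inter_iff, mem_preimage]
      exact ⟨fun hy => ⟨hy.1.1, hy.2⟩, fun hy => ⟨⟨hy.1, pt_mem_source hy.2⟩, hy.2⟩⟩
    rw [h2] at h1
    refine h1.trans ?_
    rw [← lintegral_indicator (measurableSet_preimage_pt q hS),
      ← lintegral_indicator (measurableSet_preimage_pt q hS')]
    refine lintegral_congr fun y => ?_
    -- Where the partition function at p is nonzero, the point already lies in the chart at p, so
    -- cutting S down to that chart loses nothing.
    by_cases h0 : chartPartition n N p (pt q y) = 0
    · simp only [indicator, h0, zero_mul, ENNReal.ofReal_zero, ite_self]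
    · have h3 := tsupport_chartPartition p (subset_tsupport _ h0)
      have h4 : y ∈ pt q ⁻¹' (S ∩ (extChartAt (𝓡 n) p).source) ∩ dom n q
          ↔ y ∈ pt q ⁻¹' S ∩ dom n q := ⟨fun h => ⟨h.1.1, h.2⟩, fun h => ⟨⟨h.1, h3⟩, h.2⟩⟩
      by_cases hm : y ∈ pt q ⁻¹' S ∩ dom n q
      · rw [indicator_of_mem hm, indicator_of_mem (h4.2 hm)]
      · rw [indicator_of_notMem hm, indicator_of_notMem fun h => hm (h4.1 h)]
  rw [volumeMeasure, Measure.sum_apply _ hS]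
  refine (tsum_congr hterm).trans ?_
  have hC := countable_chartPartition n N
  have : Countable {p : N | chartPartition n N p ≠ 0} := hC.to_subtype
  have hsub : ∀ F : N → ENNReal, (∀ p, chartPartition n N p = 0 → F p = 0) →
      ∑' p : {p : N | chartPartition n N p ≠ 0}, F p = ∑' p, F p := by
    intro F hF
    refine tsum_subtype_eq_of_support_subset fun p hp => ?_
    intro h0
    exact hp (hF p h0)
  have hmeas : ∀ p : N, AEMeasurable (fun y => ENNReal.ofReal
      (chartPartition n N p (pt q y) * volDensity h q y))
      (volume.restrict (pt q ⁻¹' S ∩ dom n q)) := by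
    intro p
    refine AEMeasurable.ennreal_ofReal ?_
    have hc : ContinuousOn (fun y => chartPartition n N p (pt q y) * volDensity h q y)
        (dom n q) := by
      intro y hy
      have h1 : ContinuousAt (fun y => chartPartition n N p (pt q y)) y :=
        ContinuousAt.comp (g := chartPartition n N p)
          (chartPartition n N p).contMDiff.continuous.continuousAt (continuousAt_pt hy)
      exact (h1.mul (contDiffAt_volDensity h hy).continuousAt).continuousWithinAt
    exact (hc.aemeasurable (isOpen_dom q).measurableSet).mono_measure
      (Measure.restrict_mono inter_subset_right le_rfl)
  rw [← hsub _ fun p hp => by simp [hp], ← lintegral_tsum fun p : {p : N | chartPartition n N p ≠ 0} => hmeas p]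
  refine lintegral_congr fun y => ?_
  rw [hsub (fun p => ENNReal.ofReal (chartPartition n N p (pt q y) * volDensity h q y))
    fun p hp => by simp [hp]]
  simp only [ENNReal.ofReal_mul ((chartPartition n N).nonneg _ _)]
  rw [ENNReal.tsum_mul_right, tsum_chartPartition, one_mul]

/-- The volume measure in a chart. -/
lemma volumeMeasure_restrict (h : RiemMetric n N) (q : N) :
    (volumeMeasure h).restrict (extChartAt (𝓡 n) q).source
      = ((volume.restrict (dom n q)).withDensity
          fun y => ENNReal.ofReal (volDensity h q y)).map (pt q) := by
  ext S hS
  have ho := (isOpen_extChartAt_source (I := 𝓡 n) q).measurableSet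
  rw [Measure.restrict_apply hS, volumeMeasure_apply h (hS.inter ho) inter_subset_right,
    map_pt_apply q _ hS]
  congr 2
  ext y
  simp only [mem_inter_iff, mem_preimage]
  exact ⟨fun hy => ⟨hy.1.1, hy.2⟩, fun hy => ⟨⟨hy.1, pt_mem_source hy.2⟩, hy.2⟩⟩

/-- Every point has a neighbourhood lying over a closed coordinate ball inside the chart domain, on
which the density is continuous and hence integrable. -/
instance isFiniteMeasureOnCompacts_volumeMeasure (h : RiemMetric n N) :
    IsFiniteMeasureOnCompacts (volumeMeasure h) where
  lt_top_of_isCompact := by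
    intro K hK
    refine hK.measure_lt_top_of_nhdsWithin fun x _ => ?_
    refine Measure.FiniteAtFilter.filter_mono nhdsWithin_le_nhds ?_
    obtain ⟨r, hr, hball⟩ := Metric.nhds_basis_closedBall.mem_iff.1
      ((isOpen_dom x).mem_nhds (coordAt_mem_dom (n := n) x))
    have hV : IsOpen ((extChartAt (𝓡 n) x).source
        ∩ extChartAt (𝓡 n) x ⁻¹' Metric.ball (coordAt x) r) :=
      (continuousOn_extChartAt x).isOpen_inter_preimage (isOpen_extChartAt_source x) Metric.isOpen_ball
    refine ⟨_, hV.mem_nhds ⟨mem_extChartAt_source x, Metric.mem_ball_self hr⟩, ?_⟩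
    rw [volumeMeasure_apply h hV.measurableSet inter_subset_left]
    have hsub : pt x ⁻¹' ((extChartAt (𝓡 n) x).source
        ∩ extChartAt (𝓡 n) x ⁻¹' Metric.ball (coordAt x) r) ∩ dom n x
        ⊆ Metric.closedBall (coordAt x) r := by
      rintro y ⟨⟨_, h2⟩, h3⟩
      rw [mem_preimage, chart_pt h3] at h2
      exact Metric.ball_subset_closedBall h2
    refine (lintegral_mono_set hsub).trans_lt ?_
    have hc : ContinuousOn (volDensity h x) (Metric.closedBall (coordAt x) r) := fun y hy =>
      (contDiffAt_volDensity h (hball hy)).continuousAt.continuousWithinAt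
    have hi := hc.integrableOn_compact (μ := volume) (isCompact_closedBall _ _)
    exact hi.lintegral_lt_top

/-- Integration in a chart. -/
lemma setIntegral_volumeMeasure (h : RiemMetric n N) {q : N} {f : N → ℝ} (hf : Continuous f)
    {S : Set N} (hS : MeasurableSet S) (hq : S ⊆ (extChartAt (𝓡 n) q).source) :
    ∫ x in S, f x ∂(volumeMeasure h)
      = ∫ y in pt q ⁻¹' S ∩ dom n q, volDensity h q y * f (pt q y) := by
  have h1 : (volumeMeasure h).restrict S
      = ((volumeMeasure h).restrict (extChartAt (𝓡 n) q).source).restrict S := by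
    rw [Measure.restrict_restrict hS, inter_eq_left.2 hq]
  have hd : AEMeasurable (fun y => ENNReal.ofReal (volDensity h q y))
      (volume.restrict (dom n q)) := by
    have hc : ContinuousOn (volDensity h q) (dom n q) := fun y hy =>
      (contDiffAt_volDensity h hy).continuousAt.continuousWithinAt
    exact (hc.aemeasurable (isOpen_dom q).measurableSet).ennreal_ofReal
  rw [h1, volumeMeasure_restrict, ← integral_indicator hS,
    integral_map (aemeasurable_pt q _) (hf.stronglyMeasurable.indicator hS).aestronglyMeasurable]
  have h2 := integral_withDensity_eq_integral_toReal_smul₀ hd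
    (Filter.Eventually.of_forall fun _ => ENNReal.ofReal_lt_top) (fun y => S.indicator f (pt q y))
  rw [h2, ← Measure.restrict_restrict_of_subset (s := pt q ⁻¹' S ∩ dom n q) (t := dom n q)
    inter_subset_right, ← integral_indicator (measurableSet_preimage_pt q hS)]
  refine setIntegral_congr_fun (isOpen_dom q).measurableSet fun y hy => ?_
  by_cases hyS : pt q y ∈ S
  · rw [indicator_of_mem hyS, indicator_of_mem (s := pt q ⁻¹' S ∩ dom n q) ⟨hyS, hy⟩,
      ENNReal.toReal_ofReal (volDensity_nonneg h q y), smul_eq_mul]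
  · rw [indicator_of_notMem hyS, indicator_of_notMem (s := pt q ⁻¹' S ∩ dom n q) fun h => hyS h.1,
      smul_zero]

end Volume

/-! ### Variations of the identity and differentiation of the bienergy -/

section Variation

open MeasureTheory Set

variable {n : ℕ} {N : Type*} [TopologicalSpace N] [ChartedSpace (E n) N]

/-- A smooth variation of the identity map, constant in time outside `K`. -/
structure IsVariation (K : Set N) (ε : ℝ) (Φ : ℝ → N → N) : Prop where
  pos : 0 < ε
  smooth : ContMDiffOn (𝓘(ℝ, ℝ).prod (𝓡 n)) (𝓡 n) ∞ (fun q : ℝ × N => Φ q.1 q.2)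
    (Ioo (-ε) ε ×ˢ univ)
  zero : ∀ x, Φ 0 x = x
  fixed : ∀ t ∈ Ioo (-ε) ε, ∀ x ∉ K, Φ t x = x

/-- A variation of the identity map in the preferred chart at `p`. -/
def varIn (Φ : ℝ → N → N) (p : N) (q : ℝ × E n) : E n := mapIn (Φ q.1) p p q.2

/-- The variation field in the preferred chart at `p`. -/
def varField (Φ : ℝ → N → N) (p : N) (y : E n) : E n := deriv (fun t => varIn Φ p (t, y)) 0

variable {K : Set N} {ε : ℝ} {Φ : ℝ → N → N}

lemma IsVariation.contMDiffAt (hΦ : IsVariation (n := n) K ε Φ) {q : ℝ × N}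
    (hq : q.1 ∈ Ioo (-ε) ε) :
    ContMDiffAt (𝓘(ℝ, ℝ).prod (𝓡 n)) (𝓡 n) ∞ (fun q : ℝ × N => Φ q.1 q.2) q :=
  hΦ.smooth.contMDiffAt ((isOpen_Ioo.prod isOpen_univ).mem_nhds ⟨hq, mem_univ _⟩)

lemma IsVariation.varIn_zero (hΦ : IsVariation (n := n) K ε Φ) {p : N} {y : E n}
    (hy : y ∈ dom n p) : varIn Φ p (0, y) = y := by
  rw [varIn, mapIn, hΦ.zero]
  exact chart_pt hy

variable [IsManifold (𝓡 n) ∞ N]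

/-- The squared norm of the tension field along a variation. -/
def energyDensity (g h : RiemMetric n N) (Φ : ℝ → N → N) (q : ℝ × N) : ℝ :=
  h.inner (Φ q.1 q.2) (tension g h (Φ q.1) q.2) (tension g h (Φ q.1) q.2)

/-- The time derivative of the squared norm of the tension field along a variation. -/
def energyDeriv (g h : RiemMetric n N) (Φ : ℝ → N → N) (q : ℝ × N) : ℝ :=
  deriv (fun s => energyDensity g h Φ (s, q.2)) q.1

lemma continuousAt_deriv_slice {X : Type*} [NormedAddCommGroup X] [NormedSpace ℝ X]
    {L : ℝ × X → ℝ} {q : ℝ × X} (hL : ContDiffAt ℝ ∞ L q) :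
    ContinuousAt (fun q : ℝ × X => deriv (fun s => L (s, q.2)) q.1) q := by
  have e : (fun q : ℝ × X => deriv (fun s => L (s, q.2)) q.1) =ᶠ[𝓝 q] fun q => fderiv ℝ L q (1, 0) := by
    filter_upwards [ContDiffAt.eventually_differentiableAt (hL.of_le (by simp))] with q hq
    exact (hasDerivAt_slice_fst hq).deriv
  exact ((contDiffAt_fderiv_infty hL).continuousAt.clm_apply continuousAt_const).congr_of_eventuallyEq e

lemma IsVariation.contMDiffAt_comp_pt (hΦ : IsVariation (n := n) K ε Φ) {p : N} {q : ℝ × E n}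
    (hq : q.1 ∈ Ioo (-ε) ε) (hy : q.2 ∈ dom n p) :
    ContMDiffAt 𝓘(ℝ, ℝ × E n) (𝓡 n) ∞ (fun q : ℝ × E n => Φ q.1 (pt p q.2)) q := by
  have h1 : ContMDiffAt 𝓘(ℝ, ℝ × E n) 𝓘(ℝ, ℝ) ∞ (fun q : ℝ × E n => q.1) q :=
    contDiffAt_fst.contMDiffAt
  have h2 : ContMDiffAt 𝓘(ℝ, ℝ × E n) 𝓘(ℝ, E n) ∞ (fun q : ℝ × E n => q.2) q :=
    contDiffAt_snd.contMDiffAt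
  have h3 : ContMDiffAt 𝓘(ℝ, ℝ × E n) (𝓡 n) ∞ (fun q : ℝ × E n => pt p q.2) q :=
    ContMDiffAt.comp (g := pt p) q (contMDiffAt_pt hy) h2
  exact ContMDiffAt.comp (g := fun q : ℝ × N => Φ q.1 q.2) (f := fun q : ℝ × E n => (q.1, pt p q.2))
    q (hΦ.contMDiffAt hq) (h1.prodMk h3)

lemma IsVariation.eventually (hΦ : IsVariation (n := n) K ε Φ) {p : N} {y : E n}
    (hy : y ∈ dom n p) : ∀ᶠ q : ℝ × E n in 𝓝 (0, y), q.1 ∈ Ioo (-ε) ε ∧ q.2 ∈ dom n p ∧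
      Φ q.1 (pt p q.2) ∈ (extChartAt (𝓡 n) p).source := by
  have h0 : (0 : ℝ) ∈ Ioo (-ε) ε := ⟨by linarith [hΦ.pos], hΦ.pos⟩
  have hc : ContinuousAt (fun q : ℝ × E n => Φ q.1 (pt p q.2)) (0, y) :=
    (hΦ.contMDiffAt_comp_pt (q := (0, y)) h0 hy).continuousAt
  have h1 : Φ 0 (pt p y) ∈ (extChartAt (𝓡 n) p).source := by
    rw [hΦ.zero]
    exact pt_mem_source hy
  have e1 : ∀ᶠ q : ℝ × E n in 𝓝 (0, y), q.1 ∈ Ioo (-ε) ε :=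
    continuousAt_fst.eventually (isOpen_Ioo.mem_nhds h0)
  have e2 : ∀ᶠ q : ℝ × E n in 𝓝 (0, y), q.2 ∈ dom n p :=
    continuousAt_snd.eventually (eventually_mem_dom hy)
  exact e1.and (e2.and (hc.eventually ((isOpen_extChartAt_source p).mem_nhds h1)))

lemma IsVariation.contDiffAt_varIn (hΦ : IsVariation (n := n) K ε Φ) {p : N} {q : ℝ × E n}
    (hq : q.1 ∈ Ioo (-ε) ε) (hy : q.2 ∈ dom n p)
    (hs : Φ q.1 (pt p q.2) ∈ (extChartAt (𝓡 n) p).source) :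
    ContDiffAt ℝ ∞ (varIn Φ p : ℝ × E n → E n) q := by
  have h1 : ContMDiffAt (𝓡 n) 𝓘(ℝ, E n) ∞ (extChartAt (𝓡 n) p) (Φ q.1 (pt p q.2)) :=
    contMDiffAt_extChartAt' (by rwa [extChartAt_source] at hs)
  exact contMDiffAt_iff_contDiffAt.1 (ContMDiffAt.comp (g := extChartAt (𝓡 n) p)
    (f := fun q : ℝ × E n => Φ q.1 (pt p q.2)) q h1 (hΦ.contMDiffAt_comp_pt hq hy))

lemma IsVariation.energyDensity_eq (hΦ : IsVariation (n := n) K ε Φ) (g h : RiemMetric n N) {p : N}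
    {q : ℝ × E n} (hq : q.1 ∈ Ioo (-ε) ε) (hy : q.2 ∈ dom n p)
    (hs : Φ q.1 (pt p q.2) ∈ (extChartAt (𝓡 n) p).source) :
    energyDensity g h Φ (q.1, pt p q.2)
      = locDensity (metIn g p) (metIn h p) (fun z => varIn Φ p (q.1, z)) q.2 := by
  have h1 : ContinuousAt (Φ q.1) (pt p q.2) :=
    ContinuousAt.comp (g := fun q : ℝ × N => Φ q.1 q.2) (f := fun x => (q.1, x))
      (hΦ.contMDiffAt (q := (q.1, pt p q.2)) hq).continuousAt (by fun_prop)
  have h2 : ContDiffAt ℝ ∞ (mapIn (Φ q.1) p p : E n → E n) q.2 :=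
    ContDiffAt.comp (g := varIn Φ p) (f := fun z : E n => (q.1, z)) q.2
      (hΦ.contDiffAt_varIn hq hy hs) (contDiffAt_const.prodMk contDiffAt_id)
  exact inner_tension_eq g h (Φ q.1) hy hs h1 h2

lemma IsVariation.contDiffAt_energyDensity (hΦ : IsVariation (n := n) K ε Φ) (g h : RiemMetric n N)
    {p : N} {y : E n} (hy : y ∈ dom n p) : ∀ᶠ q : ℝ × E n in 𝓝 (0, y),
      ContDiffAt ℝ ∞ (fun q : ℝ × E n => energyDensity g h Φ (q.1, pt p q.2)) q := by
  filter_upwards [(hΦ.eventually hy).eventually_nhds] with q hq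
  obtain ⟨h1, h2, h3⟩ := hq.self_of_nhds
  have h4 := contDiffAt_locDensity (metOn_metIn g p) (metOn_metIn h p) (t := q.1) h2
    (chart_mem_dom h3) (hΦ.contDiffAt_varIn h1 h2 h3)
  refine h4.congr_of_eventuallyEq ?_
  filter_upwards [hq] with r hr
  exact hΦ.energyDensity_eq g h hr.1 hr.2.1 hr.2.2

lemma IsVariation.contDiffAt_varIn_zero (hΦ : IsVariation (n := n) K ε Φ) {p : N} {y : E n}
    (hy : y ∈ dom n p) : ContDiffAt ℝ ∞ (varIn Φ p : ℝ × E n → E n) (0, y) := by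
  obtain ⟨h1, h2, h3⟩ := (hΦ.eventually hy).self_of_nhds
  exact hΦ.contDiffAt_varIn h1 h2 h3

lemma IsVariation.contDiffAt_varField (hΦ : IsVariation (n := n) K ε Φ) {p : N} {y : E n}
    (hy : y ∈ dom n p) : ContDiffAt ℝ ∞ (varField Φ p : E n → E n) y :=
  contDiffAt_deriv_fst (hΦ.contDiffAt_varIn_zero hy)

/-- The first variation of the energy density in a chart. -/
lemma IsVariation.energyDeriv_pt (hΦ : IsVariation (n := n) K ε Φ) (g h : RiemMetric n N) {p : N}
    {y : E n} (hy : y ∈ dom n p) : energyDeriv g h Φ (0, pt p y)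
      = firstVar (metIn g p) (metIn h p) (varField Φ p) y := by
  have h1 := hasDerivAt_locDensity (G := metIn g p) (metOn_metIn h p) hy
    (hΦ.contDiffAt_varIn_zero hy) (by
      filter_upwards [eventually_mem_dom hy] with z hz
      exact hΦ.varIn_zero hz)
  have hc : ContinuousAt (fun t : ℝ => (t, y)) 0 := by fun_prop
  have e : (fun t => energyDensity g h Φ (t, pt p y)) =ᶠ[𝓝 0]
      fun t => locDensity (metIn g p) (metIn h p) (fun z => varIn Φ p (t, z)) y := by
    filter_upwards [hc.eventually (hΦ.eventually hy)] with t ht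
    exact hΦ.energyDensity_eq g h (q := (t, y)) ht.1 ht.2.1 ht.2.2
  exact (h1.congr_of_eventuallyEq e).deriv

/-- These are the local inputs for differentiation under the integral sign. They hold on a full
neighbourhood in ℝ × N, so that compactness of K can make the time interval uniform. -/
lemma IsVariation.eventually_energyDensity (hΦ : IsVariation (n := n) K ε Φ) (g h : RiemMetric n N)
    (x : N) : ∀ᶠ q : ℝ × N in 𝓝 (0, x),
      DifferentiableAt ℝ (fun s => energyDensity g h Φ (s, q.2)) q.1 ∧
      ContinuousAt (fun z => energyDensity g h Φ (q.1, z)) q.2 ∧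
      ContinuousAt (energyDeriv g h Φ) q := by
  have hsrc := mem_extChartAt_source (I := 𝓡 n) x
  have hc : ContinuousAt (fun q : ℝ × N => (q.1, (extChartAt (𝓡 n) x q.2 : E n))) (0, x) :=
    continuousAt_fst.prodMk (ContinuousAt.comp (g := extChartAt (𝓡 n) x)
      (f := fun q : ℝ × N => q.2) (continuousAt_extChartAt x) continuousAt_snd)
  have e1 : ∀ᶠ q : ℝ × N in 𝓝 (0, x), q.2 ∈ (extChartAt (𝓡 n) x).source :=
    continuousAt_snd.eventually ((isOpen_extChartAt_source x).mem_nhds hsrc)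
  filter_upwards [e1, hc.eventually (hΦ.contDiffAt_energyDensity g h (coordAt_mem_dom x))]
    with q hq hL
  set L : ℝ × E n → ℝ := fun q => energyDensity g h Φ (q.1, pt x q.2) with hLdef
  have hF : ∀ s, ∀ z ∈ (extChartAt (𝓡 n) x).source,
      energyDensity g h Φ (s, z) = L (s, extChartAt (𝓡 n) x z) := by
    intro s z hz
    rw [hLdef]
    simp only [pt_chart hz]
  have hcx : ContinuousAt (extChartAt (𝓡 n) x) q.2 :=
    continuousAt_extChartAt' hq
  have e2 : ∀ᶠ z in 𝓝 q.2, z ∈ (extChartAt (𝓡 n) x).source :=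
    (isOpen_extChartAt_source x).mem_nhds hq
  refine ⟨?_, ?_, ?_⟩
  · simp only [fun s => hF s q.2 hq]
    exact (hasDerivAt_slice_fst (hL.differentiableAt (by simp))).differentiableAt
  · have h1 : ContinuousAt (fun z => L (q.1, extChartAt (𝓡 n) x z)) q.2 :=
      ContinuousAt.comp (g := L) (f := fun z => (q.1, (extChartAt (𝓡 n) x z : E n)))
        hL.continuousAt (continuousAt_const.prodMk hcx)
    refine h1.congr_of_eventuallyEq ?_
    filter_upwards [e2] with z hz
    exact hF q.1 z hz
  · have h1 : ContinuousAt (fun r : ℝ × N => (r.1, (extChartAt (𝓡 n) x r.2 : E n))) q :=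
      continuousAt_fst.prodMk (ContinuousAt.comp (g := extChartAt (𝓡 n) x)
        (f := fun q : ℝ × N => q.2) hcx continuousAt_snd)
    have h2 := ContinuousAt.comp (g := fun q : ℝ × E n => deriv (fun s => L (s, q.2)) q.1)
      (f := fun r : ℝ × N => (r.1, (extChartAt (𝓡 n) x r.2 : E n))) (x := q)
      (continuousAt_deriv_slice hL) h1
    refine h2.congr_of_eventuallyEq ?_
    filter_upwards [continuousAt_snd.eventually e2] with r hr
    rw [energyDeriv]
    simp only [fun s => hF s r.2 hr]
    rfl

lemma IsVariation.continuous_energyDeriv (hΦ : IsVariation (n := n) K ε Φ) (g h : RiemMetric n N) :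
    Continuous fun x => energyDeriv g h Φ (0, x) := by
  rw [continuous_iff_continuousAt]
  intro x
  exact ContinuousAt.comp (g := energyDeriv g h Φ) (f := fun x : N => ((0 : ℝ), x))
    (hΦ.eventually_energyDensity g h x).self_of_nhds.2.2 (by fun_prop)

/-- As K is closed, the variation field vanishes on a neighbourhood of x, and so do the derivatives
of it that `firstVar` involves. -/
lemma IsVariation.energyDeriv_eq_zero (hΦ : IsVariation (n := n) K ε Φ) (g h : RiemMetric n N)
    (hK : IsClosed K) {x : N} (hx : x ∉ K) : energyDeriv g h Φ (0, x) = 0 := by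
  have h1 := hΦ.energyDeriv_pt g h (coordAt_mem_dom x)
  rw [pt_coordAt] at h1
  have h2 : ∀ᶠ z in 𝓝 (coordAt x : E n), varField Φ x z = 0 := by
    have hc : ContinuousAt (pt x) (coordAt x : E n) := continuousAt_pt (coordAt_mem_dom x)
    have h3 : ∀ᶠ z in 𝓝 (coordAt x : E n), pt x z ∈ Kᶜ :=
      hc.eventually (hK.isOpen_compl.mem_nhds (by rw [pt_coordAt]; exact hx))
    filter_upwards [h3] with z hz
    have h4 : (fun t => varIn Φ x (t, z)) =ᶠ[𝓝 0] fun _ => extChartAt (𝓡 n) x (pt x z) := by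
      filter_upwards [Ioo_mem_nhds (neg_lt_zero.2 hΦ.pos) hΦ.pos] with t ht
      rw [varIn, mapIn, hΦ.fixed t ht _ hz]
    rw [varField, h4.deriv_eq, deriv_const]
  have h3 : varField Φ x =ᶠ[𝓝 (coordAt x : E n)] fun _ => 0 := h2
  have h5 : fderiv ℝ (varField Φ x) =ᶠ[𝓝 (coordAt x : E n)] fun _ => 0 := by
    filter_upwards [h3.eventuallyEq_nhds] with z hz
    rw [hz.fderiv_eq, fderiv_fun_const]
    rfl
  rw [h1, firstVar]
  simp only [linSff, h3.self_of_nhds, h5.self_of_nhds, h5.fderiv_eq, fderiv_fun_const]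
  simp [trG]

variable [T2Space N] [SigmaCompactSpace N] [MeasurableSpace N] [BorelSpace N]

/-- The derivative of the bienergy along a variation. -/
lemma IsVariation.hasDerivAt_bienergy (hΦ : IsVariation (n := n) K ε Φ) (g h : RiemMetric n N)
    (hK : IsCompact K) : HasDerivAt (fun t => bienergy g h K (Φ t))
      (1 / 2 * ∫ x in K, energyDeriv g h Φ (0, x) ∂(volumeMeasure g)) 0 := by
  have hKm : MeasurableSet K := hK.measurableSet
  have hcont := hΦ.continuous_energyDeriv g h
  obtain ⟨C, hC⟩ := hK.exists_bound_of_continuousOn hcont.continuousOn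
  -- A tube argument: C bounds the time derivative on K at t = 0, and by continuity and compactness
  -- C + 1 bounds it on K for all small t. This constant is the dominating function.
  have htube : ∀ᶠ t in 𝓝 (0 : ℝ), ∀ x ∈ K,
      DifferentiableAt ℝ (fun s => energyDensity g h Φ (s, x)) t ∧
      ContinuousAt (fun z => energyDensity g h Φ (t, z)) x ∧
      ‖energyDeriv g h Φ (t, x)‖ ≤ C + 1 := by
    refine hK.eventually_forall_of_forall_eventually (P := fun t x =>
      DifferentiableAt ℝ (fun s => energyDensity g h Φ (s, x)) t ∧
      ContinuousAt (fun z => energyDensity g h Φ (t, z)) x ∧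
      ‖energyDeriv g h Φ (t, x)‖ ≤ C + 1) fun x hx => ?_
    have h1 := hΦ.eventually_energyDensity g h x
    have h2 : ContinuousAt (fun q => ‖energyDeriv g h Φ q‖) (0, x) := h1.self_of_nhds.2.2.norm
    have h3 : ‖energyDeriv g h Φ (0, x)‖ < C + 1 := lt_of_le_of_lt (hC x hx) (lt_add_one C)
    filter_upwards [h1, h2.eventually (Iio_mem_nhds h3)] with q hq hq2
    exact ⟨hq.1, hq.2.1, le_of_lt hq2⟩
  have hmeas : ∀ᶠ t in 𝓝 (0 : ℝ), AEStronglyMeasurable (fun x => energyDensity g h Φ (t, x))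
      ((volumeMeasure g).restrict K) := by
    filter_upwards [htube] with t ht
    have hc : ContinuousOn (fun x => energyDensity g h Φ (t, x)) K := fun x hx =>
      (ht x hx).2.1.continuousWithinAt
    exact hc.aestronglyMeasurable hKm
  have hint : Integrable (fun x => energyDensity g h Φ (0, x)) ((volumeMeasure g).restrict K) := by
    have hc : ContinuousOn (fun x => energyDensity g h Φ (0, x)) K := fun x hx =>
      (htube.self_of_nhds x hx).2.1.continuousWithinAt
    exact hc.integrableOn_compact hK
  have h1 := hasDerivAt_integral_of_dominated_loc_of_deriv_le (μ := (volumeMeasure g).restrict K)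
    (F := fun t x => energyDensity g h Φ (t, x)) (F' := fun t x => energyDeriv g h Φ (t, x))
    (bound := fun _ => C + 1) htube hmeas hint
    hcont.aestronglyMeasurable
    (by
      filter_upwards [ae_restrict_mem hKm] with x hx t ht
      exact (ht x hx).2.2)
    (integrableOn_const hK.measure_lt_top.ne)
    (by
      filter_upwards [ae_restrict_mem hKm] with x hx t ht
      exact (ht x hx).1.hasDerivAt)
  exact h1.2.const_mul (1 / 2)

end Variation

/-! ### The divergence theorem on a coordinate domain -/

section Divergence

open MeasureTheory Set

variable {n : ℕ}

/-- Integration by parts against the constant function 1. -/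
lemma integral_fderiv_eq_zero {f : E n → ℝ} (hf : ContDiff ℝ 1 f) (hc : HasCompactSupport f)
    (v : E n) : ∫ y, fderiv ℝ f y v = 0 := by
  have hd : Continuous fun y => fderiv ℝ f y v :=
    (hf.continuous_fderiv one_ne_zero).clm_apply continuous_const
  have hi : Integrable fun y => fderiv ℝ f y v :=
    hd.integrable_of_hasCompactSupport (hc.fderiv_apply (𝕜 := ℝ) v)
  have h := integral_mul_fderiv_eq_neg_fderiv_mul_of_integrable (μ := (volume : Measure (E n)))
    (f := fun _ => (1 : ℝ)) (g := f) (v := v) (by simp) (by simpa using hi)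
    (by simpa using hf.continuous.integrable_of_hasCompactSupport hc)
    (fun x _ => differentiableAt_const _) (fun x _ => hf.differentiable one_ne_zero x)
  simpa using h

variable {U : Set (E n)} {G : E n → E n →L[ℝ] E n →L[ℝ] ℝ}

lemma MetOn.sum_fderiv_eq_divG (h : MetOn U G) {θ : E n → E n →L[ℝ] ℝ} {y : E n} (hy : y ∈ U)
    (hθ : ContDiffAt ℝ ∞ θ y) :
    ∑ i, fderiv ℝ (fun z => √(bmat (G z)).det * gradG (G z) (θ z) i) y (bv i)
      = √(bmat (G y)).det * divG G θ y :=
  sum_fderiv_sqrt_det_gradG ((h.smooth y hy).of_le (by simp)) (h.met y hy) (h.chr_symm hy)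
    (h.compat hy) (hθ.differentiableAt (by simp))

/-- The divergence theorem for compactly supported one-forms on a domain. -/
lemma MetOn.integral_divG (h : MetOn U G) {K : Set (E n)} (hK : IsCompact K) (hKU : K ⊆ U)
    {θ : E n → E n →L[ℝ] ℝ} (hθ : ∀ y ∈ U, ContDiffAt ℝ ∞ θ y) (h0 : ∀ y ∈ U \ K, θ y = 0) :
    IntegrableOn (fun y => √(bmat (G y)).det * divG G θ y) K ∧
      ∫ y in K, √(bmat (G y)).det * divG G θ y = 0 := by
  classical
  let w : Fin n → E n → ℝ := fun i z => √(bmat (G z)).det * gradG (G z) (θ z) i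
  -- The component is extended by zero outside U. It vanishes off the compact set K ⊆ U, so the
  -- extension is C¹ on all of ℝⁿ: near K it agrees with w, and off K it is locally zero.
  let W : Fin n → E n → ℝ := fun i => U.indicator (w i)
  have hw : ∀ i, ∀ y ∈ U, ContDiffAt ℝ ∞ (w i) y := by
    intro i y hy
    have h1 := contDiffAt_gradG (h.smooth y hy) (h.met y hy) (hθ y hy)
    exact (contDiffAt_sqrt_det (h.smooth y hy) (h.met y hy)).mul
      ((EuclideanSpace.proj i : E n →L[ℝ] ℝ).contDiff.contDiffAt.comp y h1)
  have hWU : ∀ i, ∀ y ∈ U, W i =ᶠ[𝓝 y] w i := by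
    intro i y hy
    filter_upwards [h.isOpen.mem_nhds hy] with z hz
    exact indicator_of_mem hz _
  have hW0 : ∀ i, ∀ y ∉ K, W i y = 0 := by
    intro i y hy
    by_cases hyU : y ∈ U
    · simp [W, w, hyU, h0 y ⟨hyU, hy⟩, gradG_apply]
    · exact indicator_of_notMem hyU _
  have hWn : ∀ i, ∀ y ∉ K, W i =ᶠ[𝓝 y] fun _ => 0 := by
    intro i y hy
    filter_upwards [hK.isClosed.isOpen_compl.mem_nhds hy] with z hz
    exact hW0 i z hz
  have hWc : ∀ i, ContDiff ℝ 1 (W i) := by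
    intro i
    rw [contDiff_iff_contDiffAt]
    intro y
    by_cases hy : y ∈ K
    · exact ((hw i y (hKU hy)).of_le (by simp)).congr_of_eventuallyEq (hWU i y (hKU hy))
    · exact contDiffAt_const.congr_of_eventuallyEq (hWn i y hy)
  have hWs : ∀ i, HasCompactSupport (W i) := fun i => HasCompactSupport.intro hK fun y => hW0 i y
  have hint : ∀ i, Integrable fun y => fderiv ℝ (W i) y (bv i) := fun i =>
    (((hWc i).continuous_fderiv one_ne_zero).clm_apply
      continuous_const).integrable_of_hasCompactSupport ((hWs i).fderiv_apply (𝕜 := ℝ) (bv i))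
  have hsum : ∀ y ∈ K, ∑ i, fderiv ℝ (W i) y (bv i) = √(bmat (G y)).det * divG G θ y := by
    intro y hy
    rw [← h.sum_fderiv_eq_divG (hKU hy) (hθ y (hKU hy))]
    exact Finset.sum_congr rfl fun i _ => by rw [(hWU i y (hKU hy)).fderiv_eq]
  have hsum0 : ∀ y ∉ K, ∑ i, fderiv ℝ (W i) y (bv i) = 0 := by
    intro y hy
    refine Finset.sum_eq_zero fun i _ => ?_
    rw [(hWn i y hy).fderiv_eq, fderiv_fun_const]
    rfl
  have hI : Integrable fun y => ∑ i, fderiv ℝ (W i) y (bv i) :=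
    integrable_finsetSum _ fun i _ => hint i
  refine ⟨(integrableOn_congr_fun hsum hK.measurableSet).1 hI.integrableOn, ?_⟩
  rw [← setIntegral_congr_fun hK.measurableSet hsum,
    setIntegral_eq_integral_of_forall_compl_eq_zero hsum0, integral_finsetSum _ fun i _ => hint i]
  exact Finset.sum_eq_zero fun i _ => integral_fderiv_eq_zero (hWc i) (hWs i) _

/-- Continuity is what turns the almost-everywhere conclusion of the fundamental lemma of the
calculus of variations into a pointwise one. -/
lemma MetOn.continuousAt_eulerForm (h : MetOn U G) {r : E n → ℝ} {y : E n} (hy : y ∈ U)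
    (hr : ContDiffAt ℝ ∞ r y) (w : E n) : ContinuousAt (fun z => eulerForm G r z w) y := by
  have hap : ∀ {f : E n → ℝ}, ContDiffAt ℝ ∞ f y → ContinuousAt (fun z => fderiv ℝ f z w) y :=
    fun hf => (contDiffAt_fderiv_infty hf).continuousAt.clm_apply continuousAt_const
  have hlap := h.contDiffAt_lap hy hr
  have hnsq := h.contDiffAt_nsq hy hr
  have hΓ := (h.contDiffAt_chr hy).continuousAt
  have hDΓ := (contDiffAt_fderiv_infty (h.contDiffAt_chr hy)).continuousAt
  have hdr := (contDiffAt_fderiv_infty hr).continuousAt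
  have hc : ∀ u : E n, ContinuousAt (fun _ : E n => u) y := fun u => continuousAt_const
  have hric : ContinuousAt (fun z => ricT G r z w) y := by
    unfold ricT trG
    refine ContinuousAt.neg (tendsto_finsetSum _ fun i _ => tendsto_finsetSum _ fun j _ => ?_)
    have h1 : ContinuousAt (fun z => (bmat (G z))⁻¹ i j) y :=
      (contDiffAt_bmat_inv (h.smooth y hy) (h.met y hy) i j).continuousAt
    simp only [curv_apply]
    have h2 : ∀ a b c : E n, ContinuousAt (fun z => fderiv ℝ (chr G) z a b c) y := fun a b c =>
      ((hDΓ.clm_apply (hc a)).clm_apply (hc b)).clm_apply (hc c)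
    have h3 : ∀ a c d : E n, ContinuousAt (fun z => chr G z a (chr G z c d)) y := fun a c d =>
      (hΓ.clm_apply (hc a)).clm_apply ((hΓ.clm_apply (hc c)).clm_apply (hc d))
    exact h1.smul (hdr.clm_apply ((((h2 _ _ _).sub (h2 _ _ _)).add (h3 _ _ _)).sub (h3 _ _ _)))
  unfold eulerForm
  exact (((hap hlap).add (continuousAt_const.mul (hap hnsq))).add
    (((continuousAt_const.mul hlap.continuousAt).add
      (continuousAt_const.mul hnsq.continuousAt)).mul (hap hr))).add (continuousAt_const.mul hric)

lemma bdryForm_eq_zero {r : E n → ℝ} {V : E n → E n} {y : E n} (hV : V =ᶠ[𝓝 y] fun _ => 0) :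
    bdryForm G r V y = 0 := by
  have e : (fun x => fderiv ℝ (halfExp r) x (V x)) =ᶠ[𝓝 y] fun _ => 0 := by
    filter_upwards [hV] with z hz
    rw [hz, map_zero]
  rw [bdryForm, e.fderiv_eq, hV.self_of_nhds, fderiv_fun_const]
  simp

end Divergence

/-! ### Variations supported in one chart -/

section SingleChart

open MeasureTheory Set

variable {n : ℕ} {N : Type*} [TopologicalSpace N] [ChartedSpace (E n) N]
  {K : Set N} {ε : ℝ} {Φ : ℝ → N → N}

lemma isCompact_preimage_pt {q : N} (hK : IsCompact K) (hq : K ⊆ (extChartAt (𝓡 n) q).source) :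
    IsCompact (pt q ⁻¹' K ∩ dom n q) := by
  have h1 : pt q ⁻¹' K ∩ dom n q = (extChartAt (𝓡 n) q : N → E n) '' K := by
    ext y
    constructor
    · rintro ⟨h1, h2⟩
      exact ⟨pt q y, h1, chart_pt h2⟩
    · rintro ⟨x, hx, rfl⟩
      refine ⟨?_, chart_mem_dom (hq hx)⟩
      rw [mem_preimage, pt_chart (hq hx)]
      exact hx
  rw [h1]
  exact hK.image_of_continuousOn ((continuousOn_extChartAt q).mono hq)

lemma IsVariation.varField_eq_zero (hΦ : IsVariation (n := n) K ε Φ) {q : N} {y : E n}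
    (hy : pt q y ∉ K) : varField Φ q y = 0 := by
  have h4 : (fun t => varIn Φ q (t, y)) =ᶠ[𝓝 0] fun _ => extChartAt (𝓡 n) q (pt q y) := by
    filter_upwards [Ioo_mem_nhds (neg_lt_zero.2 hΦ.pos) hΦ.pos] with t ht
    rw [varIn, mapIn, hΦ.fixed t ht _ hy]
  rw [varField, h4.deriv_eq, deriv_const]

variable [IsManifold (𝓡 n) ∞ N] [T2Space N] [SigmaCompactSpace N] [MeasurableSpace N] [BorelSpace N]

/-- The derivative of the bienergy along a variation supported in a chart. -/
lemma IsVariation.integral_energyDeriv (hΦ : IsVariation (n := n) K ε Φ) (h : RiemMetric n N)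
    (ρ : C^∞⟮𝓡 n, N; 𝓘(ℝ, ℝ), ℝ⟯) (hK : IsCompact K) {q : N}
    (hq : K ⊆ (extChartAt (𝓡 n) q).source) :
    1 / 2 * ∫ x in K, energyDeriv h (conformal h ρ) Φ (0, x) ∂(volumeMeasure h)
      = (2 - (n : ℝ)) * ∫ y in pt q ⁻¹' K ∩ dom n q, volDensity h q y *
        (Real.exp (2 * inChart ρ q y) *
          eulerForm (metIn h q) (inChart ρ q) y (varField Φ q y)) := by
  have hρ : SmoothFun n ρ := smoothFun_of_contMDiff ρ.contMDiff
  set G := metIn h q with hG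
  set r : E n → ℝ := inChart ρ q with hr
  set V : E n → E n := varField Φ q with hV
  set C : Set (E n) := pt q ⁻¹' K ∩ dom n q with hCdef
  have hC : IsCompact C := isCompact_preimage_pt hK hq
  have hCd : C ⊆ dom n q := inter_subset_right
  have hmet : MetOn (dom n q) G := metOn_metIn h q
  have hdiv := hmet.integral_divG hC hCd (θ := bdryForm G r V)
    (fun y hy => hmet.contDiffAt_bdryForm hy (hρ q y hy) (hΦ.contDiffAt_varField hy)) (by
      rintro y ⟨hy, hyC⟩
      refine bdryForm_eq_zero ?_
      filter_upwards [hC.isClosed.isOpen_compl.mem_nhds hyC, eventually_mem_dom hy] with z hz hzd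
      exact hΦ.varField_eq_zero fun hzK => hz ⟨hzK, hzd⟩)
  have hcont := hΦ.continuous_energyDeriv h (conformal h ρ)
  have hpt : ∀ y ∈ C, 1 / 2 * (volDensity h q y * energyDeriv h (conformal h ρ) Φ (0, pt q y))
      = (2 - (n : ℝ)) * (volDensity h q y * (Real.exp (2 * r y) * eulerForm G r y (V y)))
        + (2 - (n : ℝ)) * (√(bmat (G y)).det * divG G (bdryForm G r V) y) := by
    intro y hy
    have hyd := hCd hy
    have h1 := firstVar_conf hmet (hρ q) hyd (hΦ.contDiffAt_varField hyd)
    rw [hΦ.energyDeriv_pt h (conformal h ρ) hyd, metIn_conformal]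
    change 1 / 2 * (volDensity h q y * firstVar G (conf r G) V y) = _
    have h2 : volDensity h q y = √(bmat (G y)).det := rfl
    rw [← h2]
    linear_combination volDensity h q y * h1
  have hint1 : IntegrableOn (fun y => 1 / 2 *
      (volDensity h q y * energyDeriv h (conformal h ρ) Φ (0, pt q y))) C := by
    refine ContinuousOn.integrableOn_compact hC fun y hy => ?_
    have h1 : ContinuousAt (fun y => energyDeriv h (conformal h ρ) Φ (0, pt q y)) y :=
      ContinuousAt.comp (g := fun x => energyDeriv h (conformal h ρ) Φ (0, x)) hcont.continuousAt
        (continuousAt_pt (hCd hy))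
    exact (continuousAt_const.mul ((contDiffAt_volDensity h (hCd hy)).continuousAt.mul
      h1)).continuousWithinAt
  have hint2 := hdiv.1.const_mul (2 - (n : ℝ))
  have hint3 := hint1.sub hint2
  -- The Euler–Lagrange integrand is written as a difference of two functions already known to be
  -- integrable, so the integral splits and the divergence part drops out.
  have e3 : ∫ y in C, (2 - (n : ℝ)) *
      (volDensity h q y * (Real.exp (2 * r y) * eulerForm G r y (V y)))
      = ∫ y in C, (1 / 2 * (volDensity h q y * energyDeriv h (conformal h ρ) Φ (0, pt q y))
        - (2 - (n : ℝ)) * (√(bmat (G y)).det * divG G (bdryForm G r V) y)) :=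
    setIntegral_congr_fun hC.measurableSet fun y hy => by
      simp only [hpt y hy]
      ring
  rw [setIntegral_volumeMeasure h hcont hK.measurableSet hq, ← integral_const_mul,
    ← integral_const_mul, e3, integral_sub hint1 hint2, integral_const_mul (2 - (n : ℝ)), hdiv.2,
    mul_zero, sub_zero]

end SingleChart

/-! ### Linearity of the first variation in the variation field -/

section Linearity

variable {n : ℕ} {G G' : E n → E n →L[ℝ] E n →L[ℝ] ℝ} {y : E n}

lemma firstVar_congr {V W : E n → E n} (hVW : V =ᶠ[𝓝 y] W) :
    firstVar G G' V y = firstVar G G' W y := by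
  rw [firstVar, firstVar]
  simp only [linSff, hVW.self_of_nhds, hVW.fderiv_eq, hVW.fderiv.fderiv_eq]

lemma firstVar_zero : firstVar G G' (fun _ => 0) y = 0 := by
  have h : fderiv ℝ (fun _ : E n => (0 : E n)) = fun _ => 0 := fderiv_const (0 : E n)
  rw [firstVar]
  simp only [linSff, h, fderiv_fun_const]
  simp [trG]

lemma firstVar_add {V W : E n → E n} (hV : ContDiffAt ℝ 2 V y) (hW : ContDiffAt ℝ 2 W y) :
    firstVar G G' (fun z => V z + W z) y = firstVar G G' V y + firstVar G G' W y := by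
  have e : fderiv ℝ (fun z => V z + W z) =ᶠ[𝓝 y] fun z => fderiv ℝ V z + fderiv ℝ W z := by
    filter_upwards [ContDiffAt.eventually_differentiableAt (hV.of_le one_le_two),
      ContDiffAt.eventually_differentiableAt (hW.of_le one_le_two)] with z h1 h2
    exact fderiv_fun_add h1 h2
  have h2 : fderiv ℝ (fderiv ℝ fun z => V z + W z) y
      = fderiv ℝ (fderiv ℝ V) y + fderiv ℝ (fderiv ℝ W) y := by
    rw [e.fderiv_eq, fderiv_fun_add (ContDiffAt.differentiableAt_fderiv hV)
      (ContDiffAt.differentiableAt_fderiv hW)]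
  have h3 : ∀ u v, linSff (chr G) (chr G') (fun z => V z + W z) y u v
      = linSff (chr G) (chr G') V y u v + linSff (chr G) (chr G') W y u v := by
    intro u v
    simp only [linSff, h2, e.self_of_nhds, map_add, add_apply]
    abel
  rw [firstVar, firstVar, firstVar]
  simp only [h3, trG_add, map_add, add_apply]
  ring

lemma firstVar_sum {ι : Type*} (S : Finset ι) {V : ι → E n → E n}
    (hV : ∀ i ∈ S, ContDiffAt ℝ 2 (V i) y) :
    firstVar G G' (fun z => ∑ i ∈ S, V i z) y = ∑ i ∈ S, firstVar G G' (V i) y := by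
  classical
  induction S using Finset.induction_on with
  | empty => simpa using firstVar_zero
  | insert a s ha ih =>
    simp only [Finset.sum_insert ha]
    rw [firstVar_add (hV a (Finset.mem_insert_self a s))
      (ContDiffAt.sum fun i hi => hV i (Finset.mem_insert_of_mem hi)),
      ih fun i hi => hV i (Finset.mem_insert_of_mem hi)]

end Linearity

/-! ### Reduction to a chart by a partition of unity -/

section Localization

open MeasureTheory Set

variable {n : ℕ} {N : Type*} [TopologicalSpace N] [ChartedSpace (E n) N]
  {K : Set N} {ε : ℝ} {Φ : ℝ → N → N}

/-- The variation with time rescaled by a function. -/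
def rescale (Φ : ℝ → N → N) (u : N → ℝ) (t : ℝ) (x : N) : N := Φ (t * u x) x

/-- The bounds 0 ≤ u ≤ 1 keep the rescaled time in the interval. Where u vanishes the time is 0 and
the map is the identity, so the support shrinks to that of u. -/
lemma IsVariation.rescale (hΦ : IsVariation (n := n) K ε Φ) {u : N → ℝ}
    (hu : ContMDiff (𝓡 n) 𝓘(ℝ, ℝ) ∞ u) (h0 : ∀ x, 0 ≤ u x) (h1 : ∀ x, u x ≤ 1) :
    IsVariation (n := n) (K ∩ tsupport u) ε (rescale Φ u) := by
  have hmem : ∀ t ∈ Ioo (-ε) ε, ∀ x, t * u x ∈ Ioo (-ε) ε := by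
    intro t ht x
    rw [mem_Ioo, ← abs_lt, abs_mul, abs_of_nonneg (h0 x)]
    exact (mul_le_of_le_one_right (abs_nonneg t) (h1 x)).trans_lt (abs_lt.2 ht)
  refine ⟨hΦ.pos, ?_, fun x => ?_, fun t ht x hx => ?_⟩
  · have hm : ContMDiff (𝓘(ℝ, ℝ).prod (𝓡 n)) 𝓘(ℝ, ℝ) ∞ fun q : ℝ × N => q.1 * u q.2 :=
      contMDiff_fst.mul (hu.comp contMDiff_snd)
    exact hΦ.smooth.comp (hm.prodMk contMDiff_snd).contMDiffOn
      fun q hq => ⟨hmem q.1 hq.1 q.2, mem_univ _⟩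
  · rw [Biharmonic.rescale, zero_mul, hΦ.zero]
  · rw [Biharmonic.rescale]
    by_cases hxK : x ∈ K
    · rw [image_eq_zero_of_notMem_tsupport fun hxu => hx ⟨hxK, hxu⟩, mul_zero, hΦ.zero]
    · exact hΦ.fixed _ (hmem t ht x) x hxK

/-- Multiplying the field by u is achieved by slowing down time, so a partition of unity splits the
field into pieces that are again fields of genuine variations. -/
lemma varField_rescale (u : N → ℝ) (p : N) (y : E n) :
    varField (rescale Φ u) p y = u (pt p y) • varField Φ p y := by
  have h := deriv_comp_mul_left (u (pt p y)) (fun t => varIn Φ p (t, y)) 0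
  rw [mul_zero] at h
  simp only [mul_comm] at h
  exact h

variable [IsManifold (𝓡 n) ∞ N] [T2Space N] [SigmaCompactSpace N]

/-- The finite sum has to equal 1 near each point of K, not only at it, because the first variation
involves derivatives of the field. -/
lemma exists_finset_chartPartition (hK : IsCompact K) :
    ∃ S : Finset N, ∀ x ∈ K, ∀ᶠ z in 𝓝 x, ∑ q ∈ S, chartPartition n N q z = 1 := by
  classical
  have h : ∃ S : Finset N, ∀ x ∈ K, ∀ᶠ z in 𝓝 x, (chartPartition n N).finsupport z ⊆ S := by
    refine hK.induction_on (p := fun A => ∃ S : Finset N, ∀ x ∈ A, ∀ᶠ z in 𝓝 x,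
      (chartPartition n N).finsupport z ⊆ S) ⟨∅, by simp⟩ ?_ ?_ ?_
    · rintro A B hAB ⟨S, hS⟩
      exact ⟨S, fun x hx => hS x (hAB hx)⟩
    · rintro A B ⟨S, hS⟩ ⟨S', hS'⟩
      refine ⟨S ∪ S', ?_⟩
      rintro x (hx | hx)
      · exact (hS x hx).mono fun z hz => hz.trans Finset.subset_union_left
      · exact (hS' x hx).mono fun z hz => hz.trans Finset.subset_union_right
    · intro x _
      have h1 := ((chartPartition n N).eventually_finsupport_subset x).eventually_nhds
      exact ⟨_, mem_nhdsWithin_of_mem_nhds h1, (chartPartition n N).fintsupport x,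
        fun y hy => hy⟩
  obtain ⟨S, hS⟩ := h
  exact ⟨S, fun x hx => (hS x hx).mono fun z hz =>
    (chartPartition n N).sum_finsupport' z (mem_univ z) hz⟩

lemma IsVariation.rescale_chartPartition (hΦ : IsVariation (n := n) K ε Φ) (q : N) :
    IsVariation (n := n) (K ∩ tsupport (chartPartition n N q)) ε
      (Biharmonic.rescale Φ (chartPartition n N q)) :=
  hΦ.rescale (chartPartition n N q).contMDiff (fun x => (chartPartition n N).nonneg q x)
    fun x => (chartPartition n N).le_one q x

/-- The rescaled fields add up to the original field near x, and `firstVar` is local and additive in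
the field. -/
lemma IsVariation.energyDeriv_eq_sum (hΦ : IsVariation (n := n) K ε Φ) (g h : RiemMetric n N)
    {S : Finset N} {x : N} (hS : ∀ᶠ z in 𝓝 x, ∑ q ∈ S, chartPartition n N q z = 1) :
    energyDeriv g h Φ (0, x)
      = ∑ q ∈ S, energyDeriv g h (Biharmonic.rescale Φ (chartPartition n N q)) (0, x) := by
  have hy := coordAt_mem_dom (n := n) x
  have key : ∀ {L : Set N} {Ψ : ℝ → N → N}, IsVariation (n := n) L ε Ψ → energyDeriv g h Ψ (0, x)
      = firstVar (metIn g x) (metIn h x) (varField Ψ x) (coordAt x) := by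
    intro L Ψ hΨ
    rw [← hΨ.energyDeriv_pt g h hy, pt_coordAt]
  have e : varField Φ x =ᶠ[𝓝 (coordAt x : E n)] fun z => ∑ q ∈ S,
      varField (Biharmonic.rescale Φ (chartPartition n N q)) x z := by
    have hc : ContinuousAt (pt x) (coordAt x : E n) := continuousAt_pt hy
    have h1 : ∀ᶠ z in 𝓝 (coordAt x : E n), ∑ q ∈ S, chartPartition n N q (pt x z) = 1 :=
      hc.eventually (by rwa [pt_coordAt])
    filter_upwards [h1] with z hz
    simp only [varField_rescale]
    rw [← Finset.sum_smul, hz, one_smul]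
  rw [key hΦ, firstVar_congr e, firstVar_sum S fun q _ =>
    ((hΦ.rescale_chartPartition q).contDiffAt_varField hy).of_le two_le_infty]
  exact Finset.sum_congr rfl fun q _ => (key (hΦ.rescale_chartPartition q)).symm

variable [MeasurableSpace N] [BorelSpace N]

/-- The first variation of the bienergy vanishes if the Euler–Lagrange form does. -/
lemma IsVariation.integral_energyDeriv_eq_zero (hΦ : IsVariation (n := n) K ε Φ)
    (h : RiemMetric n N) (ρ : C^∞⟮𝓡 n, N; 𝓘(ℝ, ℝ), ℝ⟯) (hK : IsCompact K)
    (H : ∀ p : N, ∀ y ∈ dom n p, ∀ w, eulerForm (metIn h p) (inChart ρ p) y w = 0) :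
    1 / 2 * ∫ x in K, energyDeriv h (conformal h ρ) Φ (0, x) ∂(volumeMeasure h) = 0 := by
  obtain ⟨S, hS⟩ := exists_finset_chartPartition (n := n) hK
  have h1 : ∀ q, ∫ x in K, energyDeriv h (conformal h ρ)
      (Biharmonic.rescale Φ (chartPartition n N q)) (0, x) ∂(volumeMeasure h) = 0 := by
    intro q
    have hv := hΦ.rescale_chartPartition q
    have hKq : IsCompact (K ∩ tsupport (chartPartition n N q)) :=
      hK.inter_right (isClosed_tsupport _)
    have h2 := hv.integral_energyDeriv h ρ hKq (q := q)
      (inter_subset_right.trans (tsupport_chartPartition q))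
    have h3 : ∫ y in pt q ⁻¹' (K ∩ tsupport (chartPartition n N q)) ∩ dom n q, volDensity h q y *
        (Real.exp (2 * inChart ρ q y) * eulerForm (metIn h q) (inChart ρ q) y
          (varField (Biharmonic.rescale Φ (chartPartition n N q)) q y)) = 0 := by
      refine setIntegral_eq_zero_of_forall_eq_zero fun y hy => ?_
      rw [H q y hy.2, mul_zero, mul_zero]
    rw [h3, mul_zero] at h2
    -- The first variation of the rescaled family vanishes off the support of the partition
    -- function, so integrating over K is the same as integrating over the part inside the chart.
    rw [setIntegral_eq_of_subset_of_forall_sdiff_eq_zero hK.measurableSet inter_subset_left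
      fun x hx => hv.energyDeriv_eq_zero h (conformal h ρ) hKq.isClosed hx.2]
    linarith
  rw [setIntegral_congr_fun hK.measurableSet fun x hx =>
    hΦ.energyDeriv_eq_sum h (conformal h ρ) (hS x hx), integral_finsetSum _ fun q _ =>
      ((hΦ.rescale_chartPartition q).continuous_energyDeriv h
        (conformal h ρ)).continuousOn.integrableOn_compact hK,
    Finset.sum_eq_zero fun q _ => h1 q, mul_zero]

end Localization

/-! ### Test variations and the Euler–Lagrange equation -/

section BumpVariation

open MeasureTheory Set

variable {n : ℕ} {G : E n → E n →L[ℝ] E n →L[ℝ] ℝ} {r : E n → ℝ} {y : E n}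

/-- Homogeneity frees the test function η from the field ηw, leaving η times a fixed continuous
function. -/
lemma eulerForm_smul (c : ℝ) (w : E n) : eulerForm G r y (c • w) = c * eulerForm G r y w := by
  have h : ricT G r y (c • w) = c * ricT G r y w := by
    rw [ricT, ricT, mul_neg, ← smul_eq_mul c, ← trG_smul]
    congr 1
    refine trG_congr fun u v => ?_
    rw [← curvLin_apply, map_smul, map_smul, curvLin_apply]
  simp only [eulerForm, map_smul, h, smul_eq_mul]
  ring

variable {N : Type*} [TopologicalSpace N] [ChartedSpace (E n) N]

open Classical in
/-- The variation which translates by `t η w` in the preferred chart at `q`. -/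
def bumpVariation (q : N) (η : E n → ℝ) (w : E n) (t : ℝ) (x : N) : N :=
  if x ∈ (extChartAt (𝓡 n) q).source then
    pt q ((extChartAt (𝓡 n) q x : E n) + (t * η (extChartAt (𝓡 n) q x)) • w) else x

variable {q : N} {η : E n → ℝ} {w : E n}

lemma bumpVariation_of_mem {x : N} (hx : x ∈ (extChartAt (𝓡 n) q).source) (t : ℝ) :
    bumpVariation q η w t x
      = pt q ((extChartAt (𝓡 n) q x : E n) + (t * η (extChartAt (𝓡 n) q x)) • w) := if_pos hx

lemma bumpVariation_of_notMem {x : N} (hx : x ∉ pt q '' tsupport η) (t : ℝ) :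
    bumpVariation q η w t x = x := by
  by_cases hxs : x ∈ (extChartAt (𝓡 n) q).source
  · have h0 : η (extChartAt (𝓡 n) q x) = 0 := by
      refine image_eq_zero_of_notMem_tsupport fun h => hx ⟨_, h, pt_chart hxs⟩
    rw [bumpVariation_of_mem hxs, h0, mul_zero, zero_smul, add_zero, pt_chart hxs]
  · exact if_neg hxs

lemma isCompact_image_pt {C : Set (E n)} (hC : IsCompact C) (hq : C ⊆ dom n q) :
    IsCompact (pt q '' C) :=
  hC.image_of_continuousOn fun _ hy => (continuousAt_pt (hq hy)).continuousWithinAt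

/-- For small t, uniformly over the compact support of η, the translated points stay in the open
chart domain; off the support nothing moves. -/
lemma exists_forall_add_smul_mem (hη : Continuous η) (hc : HasCompactSupport η)
    (hs : tsupport η ⊆ dom n q) (w : E n) :
    ∃ ε : ℝ, 0 < ε ∧ ∀ t ∈ Ioo (-ε) ε, ∀ y ∈ dom n q, y + (t * η y) • w ∈ dom n q := by
  have h : ∀ᶠ t in 𝓝 (0 : ℝ), ∀ y ∈ tsupport η, y + (t * η y) • w ∈ dom n q := by
    have hcomp : IsCompact (tsupport η) := hc
    refine hcomp.eventually_forall_of_forall_eventually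
      (P := fun t y => y + (t * η y) • w ∈ dom n q) fun y hy => ?_
    have hcont : ContinuousAt (fun z : ℝ × E n => z.2 + (z.1 * η z.2) • w) (0, y) := by fun_prop
    refine hcont.eventually ((isOpen_dom q).mem_nhds ?_)
    simpa using hs hy
  obtain ⟨ε, hε, hball⟩ := Metric.eventually_nhds_iff_ball.1 h
  refine ⟨ε, hε, fun t ht y hy => ?_⟩
  by_cases hyη : y ∈ tsupport η
  · refine hball t ?_ y hyη
    rw [Metric.mem_ball, dist_zero_right, Real.norm_eq_abs, abs_lt]
    exact ht
  · rw [image_eq_zero_of_notMem_tsupport hyη, mul_zero, zero_smul, add_zero]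
    exact hy

lemma varField_bumpVariation {ε : ℝ} (hε : 0 < ε)
    (H : ∀ t ∈ Ioo (-ε) ε, ∀ y ∈ dom n q, y + (t * η y) • w ∈ dom n q) (hy : y ∈ dom n q) :
    varField (bumpVariation q η w) q y = η y • w := by
  have e : (fun t => varIn (bumpVariation q η w) q (t, y)) =ᶠ[𝓝 0]
      fun t => y + (t * η y) • w := by
    filter_upwards [Ioo_mem_nhds (neg_lt_zero.2 hε) hε] with t ht
    rw [varIn, mapIn, bumpVariation_of_mem (pt_mem_source hy), chart_pt hy]
    exact chart_pt (H t ht y hy)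
  have h : HasDerivAt (fun t : ℝ => y + (t * η y) • w) ((1 * η y) • w) 0 :=
    (((hasDerivAt_id (0 : ℝ)).mul_const (η y)).smul_const w).const_add y
  rw [varField, e.deriv_eq, h.deriv, one_mul]

variable [IsManifold (𝓡 n) ∞ N]

lemma isVariation_bumpVariation [T2Space N] (hη : ContDiff ℝ ∞ η) (hc : HasCompactSupport η)
    (hs : tsupport η ⊆ dom n q) {ε : ℝ} (hε : 0 < ε)
    (H : ∀ t ∈ Ioo (-ε) ε, ∀ y ∈ dom n q, y + (t * η y) • w ∈ dom n q) :
    IsVariation (n := n) (pt q '' tsupport η) ε (bumpVariation q η w) := by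
  refine ⟨hε, ?_, fun x => ?_, fun t _ x hx => bumpVariation_of_notMem hx t⟩
  · rintro ⟨t, x⟩ ⟨ht, -⟩
    refine ContMDiffAt.contMDiffWithinAt ?_
    by_cases hx : x ∈ (extChartAt (𝓡 n) q).source
    · have h1 : ContMDiffAt (𝓡 n) 𝓘(ℝ, E n) ∞ (extChartAt (𝓡 n) q) x :=
        contMDiffAt_extChartAt' (by rwa [extChartAt_source] at hx)
      have h2 : ContMDiffAt (𝓘(ℝ, ℝ).prod (𝓡 n)) 𝓘(ℝ, ℝ × E n) ∞
          (fun z : ℝ × N => (z.1, (extChartAt (𝓡 n) q z.2 : E n))) (t, x) :=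
        contMDiffAt_fst.prodMk_space (ContMDiffAt.comp (g := extChartAt (𝓡 n) q)
          (f := fun z : ℝ × N => z.2) (t, x) h1 contMDiffAt_snd)
      have h3 : ContDiff ℝ ∞ fun z : ℝ × E n => z.2 + (z.1 * η z.2) • w :=
        contDiff_snd.add ((contDiff_fst.mul (hη.comp contDiff_snd)).smul contDiff_const)
      have h4 : ContMDiffAt 𝓘(ℝ, E n) (𝓡 n) ∞ (pt q)
          ((extChartAt (𝓡 n) q x : E n) + (t * η (extChartAt (𝓡 n) q x)) • w) :=
        contMDiffAt_pt (H t ht _ (chart_mem_dom hx))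
      have h5 := ContMDiffAt.comp (g := fun z : ℝ × E n => z.2 + (z.1 * η z.2) • w) (t, x)
        h3.contMDiff.contMDiffAt h2
      refine (ContMDiffAt.comp (g := pt q) (t, x) h4 h5).congr_of_eventuallyEq ?_
      filter_upwards [continuousAt_snd.eventually
        ((isOpen_extChartAt_source q).mem_nhds hx)] with z hz
      exact bumpVariation_of_mem hz z.1
    -- In a Hausdorff space the compact image of the support is closed, so near a point outside the
    -- chart the variation is the identity for all times.
    · have hx' : x ∉ pt q '' tsupport η := by
        rintro ⟨y, hy, rfl⟩
        exact hx (pt_mem_source (hs hy))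
      refine contMDiffAt_snd.congr_of_eventuallyEq ?_
      filter_upwards [continuousAt_snd.eventually
        ((isCompact_image_pt hc hs).isClosed.isOpen_compl.mem_nhds hx')] with z hz
      exact bumpVariation_of_notMem hz z.1
  · by_cases hxs : x ∈ (extChartAt (𝓡 n) q).source
    · rw [bumpVariation_of_mem hxs, zero_mul, zero_smul, add_zero, pt_chart hxs]
    · exact if_neg hxs

variable [T2Space N] [SigmaCompactSpace N] [MeasurableSpace N] [BorelSpace N]

/-- The Euler–Lagrange form vanishes if the first variation of the bienergy does. -/
lemma eulerForm_eq_zero_of_forall (hn : n ≠ 2) (h : RiemMetric n N)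
    (ρ : C^∞⟮𝓡 n, N; 𝓘(ℝ, ℝ), ℝ⟯)
    (H : ∀ (K : Set N) (ε : ℝ) (Φ : ℝ → N → N), IsCompact K → IsVariation (n := n) K ε Φ →
      1 / 2 * ∫ x in K, energyDeriv h (conformal h ρ) Φ (0, x) ∂(volumeMeasure h) = 0)
    (hy : y ∈ dom n q) (w : E n) : eulerForm (metIn h q) (inChart ρ q) y w = 0 := by
  have hρ : SmoothFun n ρ := smoothFun_of_contMDiff ρ.contMDiff
  have hn' : (2 - (n : ℝ)) ≠ 0 := sub_ne_zero.2 (by exact_mod_cast hn.symm)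
  set f : E n → ℝ := fun y => volDensity h q y * (Real.exp (2 * inChart ρ q y) *
    eulerForm (metIn h q) (inChart ρ q) y w) with hf
  have hfc : ContinuousOn f (dom n q) := by
    intro z hz
    have h1 : ContinuousAt (inChart ρ q) z := (hρ q z hz).continuousAt
    exact ((contDiffAt_volDensity h hz).continuousAt.mul
      ((continuousAt_const.mul h1).rexp.mul ((metOn_metIn h q).continuousAt_eulerForm hz
        (hρ q z hz) w))).continuousWithinAt
  -- The fundamental lemma of the calculus of variations: each test function η is realized by the
  -- variation with field ηw, and vanishing of its first variation says that η is orthogonal to f.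
  have hae := (isOpen_dom q).ae_eq_zero_of_integral_contDiff_smul_eq_zero (μ := volume)
    (hfc.locallyIntegrableOn (isOpen_dom q).measurableSet) (by
      intro η hη hc hs
      obtain ⟨ε, hε, hmem⟩ := exists_forall_add_smul_mem hη.continuous hc hs w
      have hv := isVariation_bumpVariation hη hc hs hε hmem
      have hK := isCompact_image_pt hc hs
      have hKq : pt q '' tsupport η ⊆ (extChartAt (𝓡 n) q).source := by
        rintro _ ⟨z, hz, rfl⟩
        exact pt_mem_source (hs hz)
      have h1 := hv.integral_energyDeriv h ρ hK hKq
      rw [H _ _ _ hK hv] at h1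
      -- Dimension two is excluded exactly here: there the identity is harmonic for every ρ and the
      -- factor 2 − n carries no information.
      have h2 := (mul_eq_zero.1 h1.symm).resolve_left hn'
      have hset : pt q ⁻¹' (pt q '' tsupport η) ∩ dom n q = tsupport η := by
        ext z
        constructor
        · rintro ⟨⟨z', hz', e⟩, hz⟩
          rwa [← chart_pt hz, ← e, chart_pt (hs hz')]
        · exact fun hz => ⟨⟨z, hz, rfl⟩, hs hz⟩
      rw [hset] at h2
      rw [← setIntegral_eq_integral_of_forall_compl_eq_zero (s := tsupport η), ← h2]
      · refine setIntegral_congr_fun (isClosed_tsupport η).measurableSet fun z hz => ?_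
        simp only [hf, varField_bumpVariation hε hmem (hs hz), eulerForm_smul, smul_eq_mul]
        ring
      · intro z hz
        rw [image_eq_zero_of_notMem_tsupport hz, zero_smul])
  -- Lebesgue measure charges every nonempty open set, so the continuous f vanishes throughout the
  -- domain; its density and exponential factors are positive and can be cancelled.
  have hzero : EqOn f (fun _ => 0) (dom n q) := by
    refine Measure.eqOn_open_of_ae_eq (μ := (volume : Measure (E n))) ?_ (isOpen_dom q) hfc
      continuousOn_const
    exact (ae_restrict_iff' (isOpen_dom q).measurableSet).2 hae
  have h3 := hzero hy
  simp only [hf, mul_eq_zero, (volDensity_pos h hy).ne', (Real.exp_pos _).ne', false_or] at h3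
  exact h3

/-- The identity map is biharmonic if and only if the Euler–Lagrange form vanishes. -/
lemma isBiharmonic_id_iff (hn : n ≠ 2) (h : RiemMetric n N) (ρ : C^∞⟮𝓡 n, N; 𝓘(ℝ, ℝ), ℝ⟯) :
    IsBiharmonic h (conformal h ρ) (fun x : N => x) ↔
      ∀ p : N, ∀ y ∈ dom n p, ∀ w, eulerForm (metIn h p) (inChart ρ p) y w = 0 := by
  constructor
  · rintro ⟨-, H⟩ p y hy w
    -- The bienergy has the computed derivative along any variation and, by hypothesis, the
    -- derivative zero; derivatives are unique.
    refine eulerForm_eq_zero_of_forall hn h ρ (fun K ε Φ hK hΦ => ?_) hy w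
    exact (hΦ.hasDerivAt_bienergy h (conformal h ρ) hK).unique
      (H K hK ε hΦ.pos Φ hΦ.smooth (funext hΦ.zero) hΦ.fixed)
  · refine fun H => ⟨contMDiff_id, fun K hK ε hε Φ hs h0 hfix => ?_⟩
    have hΦ : IsVariation (n := n) K ε Φ := ⟨hε, hs, fun x => congrFun h0 x, hfix⟩
    exact (hΦ.hasDerivAt_bienergy h (conformal h ρ) hK).congr_deriv
      (hΦ.integral_energyDeriv_eq_zero h ρ hK H)

end BumpVariation


end Biharmonic

end

theorem mainTheorem5 (n : ℕ) (hn : 2 < n) {N : Type*} [TopologicalSpace N] [T2Space N]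
    [SigmaCompactSpace N] [ChartedSpace (EuclideanSpace ℝ (Fin n)) N] [IsManifold (𝓡 n) ∞ N]
    [MeasurableSpace N] [BorelSpace N] (h : Biharmonic.RiemMetric n N)
    (ρ : C^∞⟮𝓡 n, N; 𝓘(ℝ, ℝ), ℝ⟯) (α : Biharmonic.OneForm n N)
    (hα : α = Biharmonic.dFun (fun x => ρ x)) :
    Biharmonic.IsBiharmonic h (Biharmonic.conformal h ρ) (fun x : N => x) ↔
      ∀ x : N,
        -Biharmonic.hodgeLaplacian h α x
          + ((6 - (n : ℝ)) / 2) • Biharmonic.dFun (Biharmonic.normSq h α) x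
          + (2 * Biharmonic.codiffOne h α x + (2 - (n : ℝ)) * Biharmonic.normSq h α x) • α x
          + (2 : ℝ) • Biharmonic.flat h x (Biharmonic.ricci h x (Biharmonic.sharp h x (α x)))
        = 0 := by
  subst hα
  rw [Biharmonic.isBiharmonic_id_iff hn.ne' h ρ,
    ← Biharmonic.bihForm_eq_zero_iff h (Biharmonic.smoothFun_of_contMDiff ρ.contMDiff)]
  rfl
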